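/- Let $m\ge 1$ be an integer, $a(x)=(x^{2m}+1)^{1/(2m)}$, and consider $\mathbb R_t\times\mathbb R_x\times\mathbb S^2$ with the Lorentzian metric $-dt^2+dx^2+a(x)^2\,d\sigma^2_{\mathbb S^2}$, so that $$\Box_{\mathfrak g}u=-\partial_t^2u+a^{-2}\partial_x\bigl(a^2\partial_xu\bigr)+a^{-2}\Delta_{\mathbb S^2}u .$$ All $L^2$ norms in space are taken with respect to $dV=a(x)^2\,dx\,d\sigma$; $\nabla_0$ denotes the gradient on $\mathbb S^2$, $|\partial u|^2=(\partial_tu)^2+(\partial_xu)^2+a^{-2}|\nabla_0u|^2$, and $E[u](t)=\int|\partial u|^2\,dV$. For $s\in\mathbb R$ let $\langle D_\omega\rangle^s=(1-a(x)^{-2}\Delta_{\mathbb S^2})^{s/2}$, that is, multiplication by $(1+\ell(\ell+1)a(x)^{-2})^{s/2}$ on spherical harmonics of degree $\ell$. With $\langle x\rangle=(1+x^2)^{1/2}$, put $$\|u\|_{LE^1}^2=\sup_{j\ge0}2^{-j}\int_0^T\!\!\int_{2^j\le\langle x\rangle<2^{j+1}}\bigl(|\partial u|^2+\langle x\rangle^{-2}u^2\bigr)\,dV\,dt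 .$$ Let $\beta:\mathbb R\to\mathbb R$ be smooth and non-increasing, with $\beta(\rho)=1$ for $\rho<1/2$ and $\beta(\rho)=0$ for $\rho>1$. All functions below are real valued. (1) There are $c>0$ and $L\in\mathbb N$ such that for every integer $\ell\ge L$ there exist smooth compactly supported functions $\psi_0,\psi_1$ on $\mathbb R\times\mathbb S^2$, not both zero, which for each $x$ are spherical harmonics of degree $\ell$ on $\mathbb S^2$ (or zero), and a time $T>0$, such that the Cauchy problem $\Box_{\mathfrak g}\psi=0$, $(\psi,\partial_t\psi)|_{t=0}=(\psi_0,\psi_1)$ has a smooth solution on $\mathbb R\times\mathbb R\times\mathbb S^2$ and its solution (every $C^2$ solution) $\psi$ satisfies $$\int_0^T\bigl\|\beta(|x|)\,a^{-1}|\nabla_0\psi|\bigr\|_{L^2}^2\,dt\;\ge\;c\,\Bigl(\bigl\|a^{-1}\bigl|\nabla_0\langle D_\omega\rangle^{\frac{m-1}{2(m+1)}}\psi_0\bigr|\bigr\|_{L^2}^2+\bigl\|\langle D_\omega\rangle^{\frac{m-1}{2(m+1)}}\psi_1\bigr\|_{L^2}^2\Bigr)>0 .$$ (2) Consequently, the local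 energy estimate $\|u\|_{LE^1}^2\le C\,E\bigl[\langle D_\omega\rangle^{\frac{m-1}{2(m+1)}}u\bigr](0)$ for solutions of $\Box_{\mathfrak g}u=0$, with $C$ independent of $u$ and $T$, cannot be improved by any power: for every $\delta>0$ and every $C$ there are a smooth solution $u$ of $\Box_{\mathfrak g}u=0$ with smooth compactly supported Cauchy data at $t=0$ and a time $T>0$ such that $$\|u\|_{LE^1}^2>C\,E\bigl[\langle D_\omega\rangle^{\frac{m-1}{2(m+1)}-\delta}u\bigr](0).$$ -/

import Mathlib

open Set MeasureTheory Filter Topology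
open scoped ContDiff Manifold

noncomputable section

namespace WarpedWave

/-! ### The unit sphere `S² ⊆ ℝ³` with its round metric -/

/-- Euclidean three-space. -/
abbrev E3 : Type := EuclideanSpace ℝ (Fin 3)

/-- The unit sphere `S²`, with Mathlib's manifold structure. -/
abbrev S2 : Type := Metric.sphere (0 : E3) 1

/-- The surface measure of `S²` (total mass `4π`). -/
def sigma : Measure S2 := (volume : Measure E3).toSphere

/-- The extension of a function on `S²` to `ℝ³ ∖ {0}` that is constant along rays
(value `0` at the origin). -/
def radialExt (f : S2 → ℝ) (y : E3) : ℝ :=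
  open Classical in
  if h : y = 0 then 0
  else f ⟨‖y‖⁻¹ • y, by simp [norm_smul, h]⟩

/-- The gradient of `f` on the round sphere, as a vector of `ℝ³` tangent to `S²` at `θ`: the
Euclidean gradient at `θ` of the radially constant extension. -/
def sphGrad (f : S2 → ℝ) (θ : S2) : E3 := gradient (radialExt f) (θ : E3)

/-- The Laplace-Beltrami operator of the round sphere: the Euclidean Laplacian, on the sphere, of
the radially constant extension. -/
def sphLaplacian (f : S2 → ℝ) (θ : S2) : ℝ :=
  Laplacian.laplacian (radialExt f) (θ : E3)

/-- `Y` is a (smooth) spherical harmonic of degree `ℓ`, that is, it belongs to the eigenspace of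
the Laplacian of `S²` for the eigenvalue `-ℓ(ℓ+1)`.  The zero function is included. -/
def IsSphericalHarmonic (ℓ : ℕ) (Y : S2 → ℝ) : Prop :=
  ContMDiff (𝓡 2) 𝓘(ℝ, ℝ) ∞ Y ∧ ∀ θ, sphLaplacian Y θ = -((ℓ : ℝ) * (ℓ + 1)) * Y θ

/-- The `L²(S²)`-orthogonal projection of `f` onto the spherical harmonics of degree `ℓ`. For
continuous `f` it exists and is unique. -/
def sphProj (ℓ : ℕ) (f : S2 → ℝ) : S2 → ℝ :=
  open Classical in
  if h : ∃ Y : S2 → ℝ, IsSphericalHarmonic ℓ Y ∧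
      ∀ Z : S2 → ℝ, IsSphericalHarmonic ℓ Z → ∫ θ, (f θ - Y θ) * Z θ ∂sigma = 0
  then h.choose else 0

/-! ### The warped product `ℝ × ℝ × S²` with `ds² = -dt² + dx² + a(x)² dσ²` -/

/-- The generating function `a(x) = (x^{2m} + 1)^{1/(2m)}`. -/
def warp (m : ℕ) (x : ℝ) : ℝ := (x ^ (2 * m) + 1) ^ (1 / (2 * (m : ℝ)))

/-- The measure `dV = a(x)² dx dσ` on `ℝ × S²`. -/
def volM (m : ℕ) : Measure (ℝ × S2) :=
  ((volume : Measure ℝ).withDensity fun x => ENNReal.ofReal (warp m x ^ 2)).prod sigma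

/-- The wave operator
`□ u = -∂_t² u + a⁻² ∂_x (a² ∂_x u) + a⁻² Δ_{S²} u`. -/
def box (m : ℕ) (u : ℝ → ℝ → S2 → ℝ) (t x : ℝ) (θ : S2) : ℝ :=
  - deriv (fun t' => deriv (fun t'' => u t'' x θ) t') t
  + (warp m x ^ 2)⁻¹ * deriv (fun x' => warp m x' ^ 2 * deriv (fun x'' => u t x'' θ) x') x
  + (warp m x ^ 2)⁻¹ * sphLaplacian (u t x) θ

/-- `C^n` functions on the Riemannian manifold `ℝ × S²`. -/
def SmoothOnSpace (n : ℕ∞ω) (f : ℝ → S2 → ℝ) : Prop :=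
  ContMDiff (𝓘(ℝ, ℝ).prod (𝓡 2)) 𝓘(ℝ, ℝ) n (fun p : ℝ × S2 => f p.1 p.2)

/-- `C^n` functions on the space-time `ℝ × ℝ × S²`. -/
def SmoothOnSpacetime (n : ℕ∞ω) (u : ℝ → ℝ → S2 → ℝ) : Prop :=
  ContMDiff (𝓘(ℝ, ℝ).prod (𝓘(ℝ, ℝ).prod (𝓡 2))) 𝓘(ℝ, ℝ) n
    (fun p : ℝ × ℝ × S2 => u p.1 p.2.1 p.2.2)

/-- Test functions on `ℝ × S²`: smooth with compact support. -/
def IsTestFunction (f : ℝ → S2 → ℝ) : Prop :=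
  SmoothOnSpace ∞ f ∧ HasCompactSupport (fun p : ℝ × S2 => f p.1 p.2)

/-- `ψ` is a classical solution, of class `C^n`, of the Cauchy problem
`□ ψ = 0`, `(ψ, ∂_t ψ)|_{t=0} = (ψ₀, ψ₁)`. (To be used with `n ≥ 2`.) -/
structure IsWaveSolution (m : ℕ) (n : ℕ∞ω) (ψ₀ ψ₁ : ℝ → S2 → ℝ)
    (ψ : ℝ → ℝ → S2 → ℝ) : Prop where
  smooth : SmoothOnSpacetime n ψ
  box_eq_zero : ∀ t x θ, box m ψ t x θ = 0
  initial : ∀ x θ, ψ 0 x θ = ψ₀ x θ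
  initial_deriv : ∀ x θ, deriv (fun t => ψ t x θ) 0 = ψ₁ x θ

/-- `⟨D_ω⟩^s = (1 + D_ω²)^{s/2}` with `D_ω = a(x)⁻¹ (-Δ_{S²})^{1/2}`, given by the spectral
decomposition of `Δ_{S²}`: on the spherical harmonics of degree `ℓ` it is multiplication by
`(1 + ℓ(ℓ+1)/a(x)²)^{s/2}`. -/
def angPow (m : ℕ) (s : ℝ) (f : ℝ → S2 → ℝ) (x : ℝ) (θ : S2) : ℝ :=
  ∑' ℓ : ℕ, (1 + (ℓ : ℝ) * (ℓ + 1) / warp m x ^ 2) ^ (s / 2) * sphProj ℓ (f x) θ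

/-! ### Norms (all squared, with values in `[0, ∞]`) -/

/-- `‖f‖²_{L²(dV)}`. -/
def sqNorm (m : ℕ) (f : ℝ → S2 → ℝ) : ENNReal :=
  ∫⁻ p : ℝ × S2, ENNReal.ofReal (f p.1 p.2 ^ 2) ∂(volM m)

/-- `a(x)⁻¹ |∇̸₀ f|`. -/
def angGradNorm (m : ℕ) (f : ℝ → S2 → ℝ) (x : ℝ) (θ : S2) : ℝ :=
  (warp m x)⁻¹ * ‖sphGrad (f x) θ‖

/-- `|∂u|² = (∂_t u)² + (∂_x u)² + a⁻² |∇̸₀ u|²`. -/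
def sqDeriv (m : ℕ) (u : ℝ → ℝ → S2 → ℝ) (t x : ℝ) (θ : S2) : ℝ :=
  deriv (fun t' => u t' x θ) t ^ 2 + deriv (fun x' => u t x' θ) x ^ 2
    + angGradNorm m (u t) x θ ^ 2

/-- The energy `E[u](t) = ∫ |∂u|² dV`. -/
def energy (m : ℕ) (u : ℝ → ℝ → S2 → ℝ) (t : ℝ) : ENNReal :=
  ∫⁻ p : ℝ × S2, ENNReal.ofReal (sqDeriv m u t p.1 p.2) ∂(volM m)

/-- The dyadic region `⟨x⟩ ≈ 2^j`, with `⟨x⟩ = (1 + x²)^{1/2}`. -/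
def dyadic (j : ℕ) : Set ℝ := {x | (2 : ℝ) ^ j ≤ √(1 + x ^ 2) ∧ √(1 + x ^ 2) < 2 ^ (j + 1)}

/-- `‖u‖²_{LE¹}` over `[0,T]`:
`sup_j 2^{-j} ∫_0^T ∫_{⟨x⟩ ≈ 2^j} |∂u|² + ⟨x⟩^{-2} u² dV dt`. -/
def sqNormLE1 (m : ℕ) (T : ℝ) (u : ℝ → ℝ → S2 → ℝ) : ENNReal :=
  ⨆ j : ℕ, ((2 : ENNReal) ^ j)⁻¹ * ∫⁻ t in Icc 0 T, ∫⁻ p in dyadic j ×ˢ (univ : Set S2),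
    ENNReal.ofReal (sqDeriv m u t p.1 p.2 + (1 + p.1 ^ 2)⁻¹ * u t p.1 p.2 ^ 2) ∂(volM m)

/-- The sharp loss `(m-1)/(2(m+1))`. -/
def loss (m : ℕ) : ℝ := ((m : ℝ) - 1) / (2 * ((m : ℝ) + 1))

/-- `‖⟨D_ω⟩^s a⁻¹ |∇̸₀ ψ₀|‖²_{L²} + ‖⟨D_ω⟩^s ψ₁‖²_{L²}`, where `⟨D_ω⟩^s` acts before the length of
the gradient is taken (it commutes with `∇̸₀` and with multiplication by `a⁻¹`). -/
def sqDataNorm (m : ℕ) (s : ℝ) (ψ₀ ψ₁ : ℝ → S2 → ℝ) : ENNReal :=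
  sqNorm m (angGradNorm m (angPow m s ψ₀)) + sqNorm m (angPow m s ψ₁)

end WarpedWave

end

noncomputable section

namespace WarpedWave

/-! ### The radially constant extension -/

/-! The sphere x = 0 is trapped, and a² - 1 ≤ x^{2m} is so flat there that a wave of angular
frequency √λ, with λ = ℓ(ℓ+1), stays near it for a long time when it is spread over the right width
h. Along ∂_x² the width costs h⁻², and along the well it costs λ h^{2m}. The two balance when λ
h^{2m+2} = 1. The initial position is φ(x) Y(θ), with φ a bump of width h and Y a spherical harmonic
of degree ℓ, and the initial velocity is zero.

Concentration is proved by duality, for an arbitrary C² solution u, without uniqueness, finite speed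
of propagation or control of u away from x = 0. Let g(t) be the integral of a² φ Y u over a slab
around x = 0. By the wave equation and the symmetry of the spherical Laplacian, g'' + λ g = G, where
G is the pairing of Y u with the residue (a² φ')' + λ (a² - 1) φ, of size h⁻²
(`slabPair_second_deriv`, `abs_radialResidue_scaled_le`). Let H(t) be the angular Dirichlet energy
in the slab and N = ∫ Y². Green's identity on the sphere and Cauchy-Schwarz give g² ≲ (N h/λ) H and
G² ≲ (N h⁻³/λ) H (`slabPair_sq_le`). If ∫ H were small, g would be small in L² in time; but then G
would be small as well, and Duhamel's formula would keep g close to g(0) cos(√λ t), which is not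
small. Quantitatively (`oscillator_lower_bound`), g(0)² T ≲ (N h/λ + (T²/λ) N h⁻³/λ) ∫ H. The two
terms balance at T = h² √λ = λ^{(m-1)/(2(m+1))}, and since g(0) is at least of size h N, it follows
that ∫ H ≳ T λ N h (`exists_slabEnergy_lower_bound`).

On functions of degree ℓ supported in |x| ≤ 1 the square of ⟨D_ω⟩^s is comparable to λ^s, so the
data norm with the loss (m-1)/(2(m+1)) is comparable to T λ N h, which is the first claim. With δ
less, the energy is O(λ^{-δ} T λ N h), the radial derivative being harmless because h⁻¹ ≤ λ h.
Letting ℓ tend to infinity gives the second claim.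

The remaining work supplies the ingredients: calculus on the sphere through radially constant
extensions to ℝ³, including Green's identity and the harmonics Re (θ₀ + iθ₁)^ℓ; and existence of
smooth solutions (`exists_isWaveSolution`), obtained by separating variables and solving a
one-dimensional wave equation with bounded potential as a Volterra equation in characteristic
coordinates. -/

theorem radialExt_of_ne_zero (f : S2 → ℝ) {y : E3} (hy : y ≠ 0) :
    radialExt f y = f ⟨‖y‖⁻¹ • y, by simp [norm_smul, hy]⟩ := by
  simp [radialExt, hy]

theorem radialExt_coe (f : S2 → ℝ) (θ : S2) : radialExt f (θ : E3) = f θ := by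
  have h : ‖(θ : E3)‖ = 1 := by simp
  have h0 : (θ : E3) ≠ 0 := by
    intro h'; rw [h'] at h; simp at h
  rw [radialExt_of_ne_zero f h0]
  congr 1
  ext1
  simp [h]

theorem coe_ne_zero (θ : S2) : (θ : E3) ≠ 0 := by
  have h : ‖(θ : E3)‖ = 1 := by simp
  intro h'; rw [h'] at h; simp at h

theorem radialExt_smul_pos (f : S2 → ℝ) {r : ℝ} (hr : 0 < r) (y : E3) :
    radialExt f (r • y) = radialExt f y := by
  by_cases hy : y = 0
  · simp [hy]
  · have : r • y ≠ 0 := smul_ne_zero hr.ne' hy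
    rw [radialExt_of_ne_zero f hy, radialExt_of_ne_zero f this]
    congr 1
    ext1
    simp only [norm_smul, smul_smul, Real.norm_eq_abs, abs_of_pos hr]
    congr 1
    field_simp

/-- The extension to `ℝ × ℝ × ℝ³` of a function on space-time, constant along rays. -/
def spacetimeExt (u : ℝ → ℝ → S2 → ℝ) (p : ℝ × ℝ × E3) : ℝ := radialExt (u p.1 p.2.1) p.2.2

/-- The complement of the zero section of `ℝ × ℝ × ℝ³`. -/
def offZero : TopologicalSpace.Opens (ℝ × ℝ × E3) :=
  ⟨{p | p.2.2 ≠ 0}, isOpen_ne_fun (by fun_prop) (by fun_prop)⟩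

/-- Off the zero section the extension is u composed with the smooth map y ↦ y/‖y‖. This converts
smoothness on the manifold into ordinary differentiability on a vector space, where all later
calculus takes place. The open submanifold `offZero` is needed because the map into the sphere is
only defined there. -/
theorem contDiffAt_spacetimeExt {n : ℕ∞ω} {u : ℝ → ℝ → S2 → ℝ} (hu : SmoothOnSpacetime n u)
    {p : ℝ × ℝ × E3} (hp : p.2.2 ≠ 0) : ContDiffAt ℝ n (spacetimeExt u) p := by
  have hval : ContMDiff 𝓘(ℝ, ℝ × ℝ × E3) 𝓘(ℝ, ℝ × ℝ × E3) n
      (Subtype.val : offZero → ℝ × ℝ × E3) := contMDiff_subtype_val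
  have h3 : ContMDiff 𝓘(ℝ, ℝ × ℝ × E3) 𝓘(ℝ, E3) n
      (fun q : offZero => ‖q.1.2.2‖⁻¹ • q.1.2.2) := by
    intro q
    refine (contMDiffAt_subtype_iff (f := fun q : ℝ × ℝ × E3 => ‖q.2.2‖⁻¹ • q.2.2)).2 ?_
    refine ContDiffAt.contMDiffAt ?_
    have hq : q.1.2.2 ≠ 0 := q.2
    have h1 : ContDiffAt ℝ n (fun q : ℝ × ℝ × E3 => q.2.2) q.1 := by fun_prop
    exact ((h1.norm ℝ hq).inv (by simpa using hq)).smul h1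
  have h4 : ContMDiff 𝓘(ℝ, ℝ × ℝ × E3) (𝓡 2) n (fun q : offZero =>
      (⟨‖q.1.2.2‖⁻¹ • q.1.2.2, by
        have : q.1.2.2 ≠ 0 := q.2
        simp [norm_smul, this]⟩ : S2)) :=
    have : Fact (Module.finrank ℝ E3 = 2 + 1) := ⟨by simp⟩
    h3.codRestrict_sphere _
  have h1 : ContMDiff 𝓘(ℝ, ℝ × ℝ × E3) 𝓘(ℝ, ℝ) n (fun q : offZero => q.1.1) :=
    (contDiff_fst.contMDiff (n := n)).comp hval
  have h2 : ContMDiff 𝓘(ℝ, ℝ × ℝ × E3) 𝓘(ℝ, ℝ) n (fun q : offZero => q.1.2.1) :=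
    ((contDiff_fst.comp contDiff_snd).contMDiff (n := n)).comp hval
  have h5 := hu.comp (h1.prodMk (h2.prodMk h4))
  have h6 : ContMDiff 𝓘(ℝ, ℝ × ℝ × E3) 𝓘(ℝ, ℝ) n (fun q : offZero => spacetimeExt u q.1) := by
    convert h5 using 2 with q
    exact radialExt_of_ne_zero _ q.2
  exact contMDiffAt_iff_contDiffAt.1 (contMDiffAt_subtype_iff.1 (h6 ⟨p, hp⟩))

theorem smoothOnSpacetime_const {n : ℕ∞ω} {f : S2 → ℝ} (hf : ContMDiff (𝓡 2) 𝓘(ℝ, ℝ) n f) :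
    SmoothOnSpacetime n (fun _ _ => f) :=
  hf.comp (contMDiff_snd.comp contMDiff_snd)

theorem contDiffAt_radialExt {n : ℕ∞ω} {f : S2 → ℝ} (hf : ContMDiff (𝓡 2) 𝓘(ℝ, ℝ) n f)
    {y : E3} (hy : y ≠ 0) : ContDiffAt ℝ n (radialExt f) y := by
  have h := contDiffAt_spacetimeExt (smoothOnSpacetime_const hf) (p := (0, 0, y)) hy
  have h2 : ContDiffAt ℝ n (fun y : E3 => ((0 : ℝ), (0 : ℝ), y)) y := by fun_prop
  exact h.comp y h2

theorem SmoothOnSpacetime.slice {n : ℕ∞ω} {u : ℝ → ℝ → S2 → ℝ} (hu : SmoothOnSpacetime n u)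
    (t x : ℝ) : ContMDiff (𝓡 2) 𝓘(ℝ, ℝ) n (u t x) :=
  hu.comp (contMDiff_const.prodMk (contMDiff_const.prodMk contMDiff_id))

/-! ### Partial derivatives on space-time -/

/-- The standard basis of `ℝ³`. -/
def stdE (i : Fin 3) : E3 := EuclideanSpace.basisFun (Fin 3) ℝ i

theorem laplacian_eq_sum {f : E3 → ℝ} {y : E3} (hf : ContDiffAt ℝ 2 f y) :
    Laplacian.laplacian f y = ∑ i, fderiv ℝ (fun z => fderiv ℝ f z (stdE i)) y (stdE i) := by
  rw [InnerProductSpace.laplacian_eq_iteratedFDeriv_orthonormalBasis f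
    (EuclideanSpace.basisFun (Fin 3) ℝ)]
  refine Finset.sum_congr rfl fun i _ => ?_
  rw [iteratedFDeriv_two_apply]
  have hd : DifferentiableAt ℝ (fderiv ℝ f) y :=
    (hf.fderiv_right (m := 1) (by norm_num)).differentiableAt (by norm_num)
  rw [fderiv_clm_apply hd (differentiableAt_const _)]
  simp [stdE]

theorem contDiffAt_fderiv_apply {E : Type*} [NormedAddCommGroup E] [NormedSpace ℝ E] {F : E → ℝ}
    {p : E} {m n : ℕ∞ω} (hF : ContDiffAt ℝ n F p) (hmn : m + 1 ≤ n) (e : E) :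
    ContDiffAt ℝ m (fun q => fderiv ℝ F q e) p :=
  (hF.fderiv_right hmn).clm_apply contDiffAt_const

section Spacetime

variable {u : ℝ → ℝ → S2 → ℝ}

theorem hasDerivAt_time {G : ℝ × ℝ × E3 → ℝ} {t x : ℝ} {y : E3}
    (hG : DifferentiableAt ℝ G (t, x, y)) :
    HasDerivAt (fun s => G (s, x, y)) (fderiv ℝ G (t, x, y) (1, 0, 0)) t := by
  have h : HasDerivAt (fun s : ℝ => (s, x, y)) ((1 : ℝ), (0 : ℝ), (0 : E3)) t :=
    (hasDerivAt_id t).prodMk (hasDerivAt_const t (x, y))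
  exact hG.hasFDerivAt.comp_hasDerivAt t h

theorem hasDerivAt_space {G : ℝ × ℝ × E3 → ℝ} {t x : ℝ} {y : E3}
    (hG : DifferentiableAt ℝ G (t, x, y)) :
    HasDerivAt (fun s => G (t, s, y)) (fderiv ℝ G (t, x, y) (0, 1, 0)) x := by
  have h : HasDerivAt (fun s : ℝ => (t, s, y)) ((0 : ℝ), (1 : ℝ), (0 : E3)) x :=
    (hasDerivAt_const x t).prodMk ((hasDerivAt_id x).prodMk (hasDerivAt_const x y))
  exact hG.hasFDerivAt.comp_hasDerivAt x h

theorem hasFDerivAt_angle {G : ℝ × ℝ × E3 → ℝ} {t x : ℝ} {y : E3}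
    (hG : DifferentiableAt ℝ G (t, x, y)) :
    HasFDerivAt (fun z => G (t, x, z)) ((fderiv ℝ G (t, x, y)).comp
      ((ContinuousLinearMap.inr ℝ ℝ (ℝ × E3)).comp (ContinuousLinearMap.inr ℝ ℝ E3))) y := by
  have h : HasFDerivAt (fun z : E3 => (t, x, z))
      ((ContinuousLinearMap.inr ℝ ℝ (ℝ × E3)).comp (ContinuousLinearMap.inr ℝ ℝ E3)) y := by
    refine ((hasFDerivAt_const t y).prodMk ((hasFDerivAt_const x y).prodMk
      (hasFDerivAt_id y))).congr_fderiv ?_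
    ext <;> simp
  exact hG.hasFDerivAt.comp y h

/-- The partial derivative of `spacetimeExt u` in the direction `e`, on `ℝ × ℝ × S²`. -/
def dExt (u : ℝ → ℝ → S2 → ℝ) (e : ℝ × ℝ × E3) (t x : ℝ) (θ : S2) : ℝ :=
  fderiv ℝ (spacetimeExt u) (t, x, (θ : E3)) e

/-- The second partial derivative of `spacetimeExt u` in the direction `e`. -/
def ddExt (u : ℝ → ℝ → S2 → ℝ) (e : ℝ × ℝ × E3) (t x : ℝ) (θ : S2) : ℝ :=
  fderiv ℝ (fun q => fderiv ℝ (spacetimeExt u) q e) (t, x, (θ : E3)) e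

theorem hasDerivAt_fst (hu : SmoothOnSpacetime 2 u) (t x : ℝ) (θ : S2) :
    HasDerivAt (fun s => u s x θ) (dExt u (1, 0, 0) t x θ) t := by
  have := hasDerivAt_time ((contDiffAt_spacetimeExt hu (p := (t, x, (θ : E3)))
    (coe_ne_zero θ)).differentiableAt (by norm_num))
  simpa only [spacetimeExt, radialExt_coe] using! this

theorem hasDerivAt_fst_fst (hu : SmoothOnSpacetime 2 u) (t x : ℝ) (θ : S2) :
    HasDerivAt (fun s => dExt u (1, 0, 0) s x θ) (ddExt u (1, 0, 0) t x θ) t :=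
  hasDerivAt_time ((contDiffAt_fderiv_apply (m := 1) (contDiffAt_spacetimeExt hu
    (p := (t, x, (θ : E3))) (coe_ne_zero θ)) (by norm_num) (1, 0, 0)).differentiableAt
    (by norm_num))

theorem hasDerivAt_snd (hu : SmoothOnSpacetime 2 u) (t x : ℝ) (θ : S2) :
    HasDerivAt (fun s => u t s θ) (dExt u (0, 1, 0) t x θ) x := by
  have := hasDerivAt_space ((contDiffAt_spacetimeExt hu (p := (t, x, (θ : E3)))
    (coe_ne_zero θ)).differentiableAt (by norm_num))
  simpa only [spacetimeExt, radialExt_coe] using! this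

theorem hasDerivAt_snd_snd (hu : SmoothOnSpacetime 2 u) (t x : ℝ) (θ : S2) :
    HasDerivAt (fun s => dExt u (0, 1, 0) t s θ) (ddExt u (0, 1, 0) t x θ) x :=
  hasDerivAt_space ((contDiffAt_fderiv_apply (m := 1) (contDiffAt_spacetimeExt hu
    (p := (t, x, (θ : E3))) (coe_ne_zero θ)) (by norm_num) (0, 1, 0)).differentiableAt
    (by norm_num))

theorem fderiv_radialExt_apply (hu : SmoothOnSpacetime 2 u) (t x : ℝ) {y : E3} (hy : y ≠ 0)
    (e : E3) :
    fderiv ℝ (radialExt (u t x)) y e = fderiv ℝ (spacetimeExt u) (t, x, y) (0, 0, e) := by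
  have := hasFDerivAt_angle ((contDiffAt_spacetimeExt hu (p := (t, x, y))
    hy).differentiableAt (by norm_num))
  simp only [spacetimeExt] at this
  rw [this.fderiv]
  rfl

/-- Writing the spherical Laplacian through derivatives of the joint extension makes its continuity
in (t, x, θ) together visible. -/
theorem sphLaplacian_eq_sum (hu : SmoothOnSpacetime 2 u) (t x : ℝ) (θ : S2) :
    sphLaplacian (u t x) θ = ∑ i, ddExt u (0, 0, stdE i) t x θ := by
  rw [sphLaplacian, laplacian_eq_sum (contDiffAt_radialExt (hu.slice t x) (coe_ne_zero θ))]
  refine Finset.sum_congr rfl fun i _ => ?_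
  have h1 : (fun z => fderiv ℝ (radialExt (u t x)) z (stdE i)) =ᶠ[𝓝 (θ : E3)]
      fun z => fderiv ℝ (spacetimeExt u) (t, x, z) (0, 0, stdE i) := by
    filter_upwards [isOpen_ne.mem_nhds (coe_ne_zero θ)] with z hz
    exact fderiv_radialExt_apply hu t x hz _
  rw [h1.fderiv_eq]
  have h2 := hasFDerivAt_angle (((contDiffAt_fderiv_apply (m := 1) (contDiffAt_spacetimeExt hu
    (p := (t, x, (θ : E3))) (coe_ne_zero θ)) (by norm_num) (0, 0, stdE i)).differentiableAt
    (by norm_num)))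
  rw [h2.fderiv]
  rfl

theorem continuousAt_spacetime_coe (p : ℝ × ℝ × S2) :
    ContinuousAt (fun p : ℝ × ℝ × S2 => (p.1, p.2.1, (p.2.2 : E3))) p := by fun_prop

theorem continuous_of_smoothOnSpacetime {n : ℕ∞ω} (hu : SmoothOnSpacetime n u) :
    Continuous fun p : ℝ × ℝ × S2 => u p.1 p.2.1 p.2.2 := hu.continuous

theorem continuous_dExt (hu : SmoothOnSpacetime 2 u) (e : ℝ × ℝ × E3) :
    Continuous fun p : ℝ × ℝ × S2 => dExt u e p.1 p.2.1 p.2.2 := by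
  rw [continuous_iff_continuousAt]
  intro p
  have h := contDiffAt_fderiv_apply (m := 1) (contDiffAt_spacetimeExt hu
    (p := (p.1, p.2.1, (p.2.2 : E3))) (coe_ne_zero _)) (by norm_num) e
  exact h.continuousAt.comp (f := fun p : ℝ × ℝ × S2 => (p.1, p.2.1, (p.2.2 : E3)))
    (continuousAt_spacetime_coe p)

theorem continuous_ddExt (hu : SmoothOnSpacetime 2 u) (e : ℝ × ℝ × E3) :
    Continuous fun p : ℝ × ℝ × S2 => ddExt u e p.1 p.2.1 p.2.2 := by
  rw [continuous_iff_continuousAt]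
  intro p
  have h := contDiffAt_fderiv_apply (m := 0) (contDiffAt_fderiv_apply (m := 1)
    (contDiffAt_spacetimeExt hu (p := (p.1, p.2.1, (p.2.2 : E3))) (coe_ne_zero _))
    (by norm_num) e) (by norm_num) e
  exact h.continuousAt.comp (f := fun p : ℝ × ℝ × S2 => (p.1, p.2.1, (p.2.2 : E3)))
    (continuousAt_spacetime_coe p)

theorem continuous_sphLaplacian (hu : SmoothOnSpacetime 2 u) :
    Continuous fun p : ℝ × ℝ × S2 => sphLaplacian (u p.1 p.2.1) p.2.2 := by
  simp only [sphLaplacian_eq_sum hu]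
  exact continuous_finsetSum _ fun i _ => continuous_ddExt hu _

theorem sphGrad_eq_sum (hu : SmoothOnSpacetime 2 u) (t x : ℝ) (θ : S2) :
    sphGrad (u t x) θ = ∑ i, dExt u (0, 0, stdE i) t x θ • stdE i := by
  rw [← (EuclideanSpace.basisFun (Fin 3) ℝ).sum_repr' (sphGrad (u t x) θ)]
  refine Finset.sum_congr rfl fun i _ => ?_
  rw [real_inner_comm, sphGrad, inner_gradient_left]
  · rw [dExt, ← fderiv_radialExt_apply hu t x (coe_ne_zero θ)]
    rfl

theorem continuous_sphGrad (hu : SmoothOnSpacetime 2 u) :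
    Continuous fun p : ℝ × ℝ × S2 => sphGrad (u p.1 p.2.1) p.2.2 := by
  simp only [sphGrad_eq_sum hu]
  exact continuous_finsetSum _ fun i _ => (continuous_dExt hu _).smul continuous_const

end Spacetime

theorem sphGrad_smul {f : S2 → ℝ} (c : ℝ) (hf : ContMDiff (𝓡 2) 𝓘(ℝ, ℝ) 1 f) (θ : S2) :
    sphGrad (fun θ => c * f θ) θ = c • sphGrad f θ := by
  have h : radialExt (fun θ => c * f θ) = c • radialExt f := by
    ext y
    by_cases hy : y = 0 <;> simp [radialExt, hy]
  have hd := (contDiffAt_radialExt hf (coe_ne_zero θ)).differentiableAt (by norm_num)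
  rw [sphGrad, h, gradient, fderiv_const_smul hd]
  simp [sphGrad, gradient]

theorem sphLaplacian_smul {f : S2 → ℝ} (c : ℝ) (hf : ContMDiff (𝓡 2) 𝓘(ℝ, ℝ) 2 f) (θ : S2) :
    sphLaplacian (fun θ => c * f θ) θ = c * sphLaplacian f θ := by
  have h : radialExt (fun θ => c * f θ) = c • radialExt f := by
    ext y
    by_cases hy : y = 0 <;> simp [radialExt, hy]
  rw [sphLaplacian, h, InnerProductSpace.laplacian_smul _
    (contDiffAt_radialExt hf (coe_ne_zero θ))]
  simp [sphLaplacian]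

theorem sphLaplacian_sub {f g : S2 → ℝ} (hf : ContMDiff (𝓡 2) 𝓘(ℝ, ℝ) 2 f)
    (hg : ContMDiff (𝓡 2) 𝓘(ℝ, ℝ) 2 g) (θ : S2) :
    sphLaplacian (fun θ => f θ - g θ) θ = sphLaplacian f θ - sphLaplacian g θ := by
  have h : radialExt (fun θ => f θ - g θ) = radialExt f - radialExt g := by
    ext y
    by_cases hy : y = 0 <;> simp [radialExt, hy]
  rw [sphLaplacian, h, ContDiffAt.laplacian_sub
    (contDiffAt_radialExt hf (coe_ne_zero θ)) (contDiffAt_radialExt hg (coe_ne_zero θ))]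
  simp [sphLaplacian]

/-! ### Polar coordinates and Green's identity on the sphere -/

/-- Polar coordinates; the origin is a null set. No integrability is required, since the integral of
a product function over a product measure factors unconditionally. -/
theorem integral_radialExt_mul (k : S2 → ℝ) (η : ℝ → ℝ) :
    ∫ y : E3, radialExt k y * η ‖y‖ =
      (∫ θ, k θ ∂sigma) * ∫ r in Ioi (0 : ℝ), r ^ 2 * η r := by
  have hdim : Module.finrank ℝ E3 - 1 = 2 := by simp
  calc
    ∫ y : E3, radialExt k y * η ‖y‖
      = ∫ y : ({(0 : E3)}ᶜ : Set E3), radialExt k y.1 * η ‖y.1‖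
          ∂((volume : Measure E3).comap (↑)) := by
        rw [integral_subtype_comap (measurableSet_singleton _).compl
          fun y : E3 => radialExt k y * η ‖y‖, restrict_compl_singleton]
    _ = ∫ p, k p.1 * η p.2 ∂((volume : Measure E3).toSphere.prod
          (Measure.volumeIoiPow (Module.finrank ℝ E3 - 1))) := by
        have h := (volume : Measure E3).measurePreserving_homeomorphUnitSphereProd.integral_comp
          (Homeomorph.measurableEmbedding _)
          (fun p : S2 × Ioi (0 : ℝ) => k p.1 * η (p.2 : ℝ))
        rw [← h]
        refine integral_congr_ae (ae_of_all _ fun y => ?_)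
        have hy : (y : E3) ≠ 0 := y.2
        simp only [radialExt_of_ne_zero k hy]
        congr 2
        · ext1; simp
        · simp
    _ = (∫ θ, k θ ∂sigma) * ∫ r : Ioi (0 : ℝ), η r ∂(Measure.volumeIoiPow 2) := by
        rw [hdim]
        exact integral_prod_mul k (fun r : Ioi (0 : ℝ) => η r)
    _ = _ := by
        congr 1
        simp only [Measure.volumeIoiPow, ENNReal.ofReal]
        rw [integral_withDensity_eq_integral_smul,
          integral_subtype_comap measurableSet_Ioi fun a ↦ Real.toNNReal (a ^ 2) • η a,
          setIntegral_congr_fun measurableSet_Ioi fun x hx ↦ ?_]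
        · rw [NNReal.smul_def, Real.coe_toNNReal _ (pow_nonneg hx.out.le _)]; rfl
        · exact (measurable_subtype_coe.pow_const _).real_toNNReal

/-- A smooth cutoff to radii near `1`. -/
def radialBump : ContDiffBump (1 : ℝ) := ⟨1 / 8, 1 / 4, by norm_num, by norm_num⟩

theorem radialBump_eq_zero {r : ℝ} (hr : ¬ (1 / 2 < r ∧ r < 3 / 2)) : radialBump r = 0 := by
  apply radialBump.zero_of_le_dist
  rw [Real.dist_eq]
  change 1 / 4 ≤ _
  by_contra! h
  rw [abs_lt] at h
  exact hr ⟨by linarith, by linarith⟩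

theorem integral_radialBump_pos : 0 < ∫ r in Ioi (0 : ℝ), radialBump r := by
  rw [setIntegral_eq_integral_of_forall_compl_eq_zero]
  · exact radialBump.integral_pos
  · intro r hr
    apply radialBump_eq_zero
    simp only [mem_Ioi, not_lt] at hr
    intro h; linarith [h.1]

/-- Vanishing near the origin removes the only possible singularity of a radially constant
extension. -/
theorem integrable_of_annulus {k : E3 → ℝ} (hk : ∀ y, y ≠ 0 → ContinuousAt k y)
    (h0 : ∀ y : E3, ¬ (1 / 2 < ‖y‖ ∧ ‖y‖ < 3 / 2) → k y = 0) : Integrable k := by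
  apply Continuous.integrable_of_hasCompactSupport
  · rw [continuous_iff_continuousAt]
    intro y
    by_cases hy : y = 0
    · have : k =ᶠ[𝓝 y] fun _ => 0 := by
        filter_upwards [Metric.ball_mem_nhds y (show (0 : ℝ) < 1 / 2 by norm_num)] with z hz
        apply h0
        rw [hy, mem_ball_zero_iff] at hz
        intro h; linarith [h.1]
      exact this.continuousAt
    · exact hk y hy
  · apply HasCompactSupport.intro (isCompact_closedBall (0 : E3) 2)
    intro y hy
    apply h0
    simp only [mem_closedBall_zero_iff, not_le] at hy
    intro h; linarith [h.2]

/-- A function homogeneous of degree 0 has a differential homogeneous of degree -1. -/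
theorem fderiv_radialExt_smul (f : S2 → ℝ) {r : ℝ} (hr : 0 < r) (y : E3) :
    fderiv ℝ (radialExt f) (r • y) = r⁻¹ • fderiv ℝ (radialExt f) y := by
  have h := fderiv_comp_smul (𝕜 := ℝ) (f := radialExt f) (x := y) r
  have h2 : (fun z : E3 => radialExt f (r • z)) = radialExt f :=
    funext fun z => radialExt_smul_pos f hr z
  rw [h2] at h
  rw [h, smul_smul, inv_mul_cancel₀ hr.ne', one_smul]

theorem fderiv_fderiv_radialExt_smul (f : S2 → ℝ) {r : ℝ} (hr : 0 < r) (y e : E3) :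
    fderiv ℝ (fun z => fderiv ℝ (radialExt f) z e) (r • y) e =
      (r ^ 2)⁻¹ * fderiv ℝ (fun z => fderiv ℝ (radialExt f) z e) y e := by
  set P : E3 → ℝ := fun z => fderiv ℝ (radialExt f) z e with hP
  have h := fderiv_comp_smul (𝕜 := ℝ) (f := P) (x := y) r
  have h2 : (fun z : E3 => P (r • z)) = r⁻¹ • P := by
    funext z
    simp [hP, fderiv_radialExt_smul f hr]
  rw [h2, fderiv_const_smul_field, Pi.smul_apply] at h
  have h3 := congrArg (fun L => r⁻¹ * L e) h
  simp only [smul_apply, smul_eq_mul] at h3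
  rw [← mul_assoc r⁻¹ r, inv_mul_cancel₀ hr.ne', one_mul] at h3
  rw [← h3]
  field_simp

/-- Euler's identity in degree 0: the extension is constant along the ray through y. -/
theorem fderiv_radialExt_self {f : S2 → ℝ} {y : E3}
    (hf : DifferentiableAt ℝ (radialExt f) y) : fderiv ℝ (radialExt f) y y = 0 := by
  have h1 : HasDerivAt (fun s : ℝ => s • y) y 1 := by
    simpa using (hasDerivAt_id (1 : ℝ)).smul_const y
  have h2 : HasDerivAt (fun s : ℝ => radialExt f (s • y)) (fderiv ℝ (radialExt f) y y) 1 := by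
    have h3 : HasFDerivAt (radialExt f) (fderiv ℝ (radialExt f) y) ((1 : ℝ) • y) := by
      simpa using hf.hasFDerivAt
    exact h3.comp_hasDerivAt 1 h1
  have h4 : (fun s : ℝ => radialExt f (s • y)) =ᶠ[𝓝 1] fun _ => radialExt f y := by
    filter_upwards [lt_mem_nhds (show (0 : ℝ) < 1 by norm_num)] with s hs
    exact radialExt_smul_pos f hs y
  exact (h4.hasDerivAt_iff.1 h2).unique (hasDerivAt_const _ _)

theorem sum_inner_stdE_smul (y : E3) : ∑ i, inner ℝ (stdE i) y • stdE i = y :=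
  (EuclideanSpace.basisFun (Fin 3) ℝ).sum_repr' y

theorem inner_sphGrad (f g : S2 → ℝ) (θ : S2) :
    inner ℝ (sphGrad f θ) (sphGrad g θ) =
      ∑ i, fderiv ℝ (radialExt f) θ (stdE i) * fderiv ℝ (radialExt g) θ (stdE i) := by
  rw [← (EuclideanSpace.basisFun (Fin 3) ℝ).sum_inner_mul_inner]
  refine Finset.sum_congr rfl fun i _ => ?_
  rw [real_inner_comm (sphGrad g θ), sphGrad, sphGrad, inner_gradient_left, inner_gradient_left]
  rfl

/-- Green's identity on the sphere. -/
theorem integral_mul_sphLaplacian {f g : S2 → ℝ} (hf : ContMDiff (𝓡 2) 𝓘(ℝ, ℝ) 2 f)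
    (hg : ContMDiff (𝓡 2) 𝓘(ℝ, ℝ) 2 g) :
    ∫ θ, g θ * sphLaplacian f θ ∂sigma = -∫ θ, inner ℝ (sphGrad g θ) (sphGrad f θ) ∂sigma := by
  set F := radialExt f
  set G := radialExt g
  have hF : ∀ y : E3, y ≠ 0 → ContDiffAt ℝ 2 F y := fun y hy => contDiffAt_radialExt hf hy
  have hG : ∀ y : E3, y ≠ 0 → ContDiffAt ℝ 2 G y := fun y hy => contDiffAt_radialExt hg hy
  -- Green's identity is deduced from integration by parts in ℝ³, with G cut off to an annulus by
  -- the radial factor ρ.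
  set ρ : E3 → ℝ := fun y => radialBump ‖y‖ with hρ
  have hρC : ∀ y : E3, y ≠ 0 → ContDiffAt ℝ 2 ρ y := fun y hy =>
    radialBump.contDiffAt.comp y (contDiffAt_norm ℝ hy)
  have hρG : ∀ y : E3, y ≠ 0 → ContDiffAt ℝ 2 (fun z => ρ z * G z) y := fun y hy =>
    (hρC y hy).mul (hG y hy)
  have hρ0 : ∀ y : E3, ¬ (1 / 2 < ‖y‖ ∧ ‖y‖ < 3 / 2) → ρ y = 0 := fun y hy =>
    radialBump_eq_zero hy
  have hev : ∀ y : E3, ¬ (1 / 2 < ‖y‖ ∧ ‖y‖ < 3 / 2) → ρ =ᶠ[𝓝 y] fun _ => 0 := by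
    intro y hy
    by_cases h1 : 1 / 2 < ‖y‖
    · have h2 : 3 / 2 ≤ ‖y‖ := by
        by_contra! h; exact hy ⟨h1, h⟩
      have : ∀ᶠ z : E3 in 𝓝 y, 5 / 4 < ‖z‖ :=
        continuous_norm.continuousAt.eventually (lt_mem_nhds (by linarith))
      filter_upwards [this] with z hz
      apply radialBump.zero_of_le_dist
      rw [Real.dist_eq]
      change 1 / 4 ≤ _
      exact le_trans (by linarith) (le_abs_self _)
    · have : ∀ᶠ z : E3 in 𝓝 y, ‖z‖ < 3 / 4 :=
        continuous_norm.continuousAt.eventually (gt_mem_nhds (by linarith))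
      filter_upwards [this] with z hz
      apply radialBump.zero_of_le_dist
      rw [Real.dist_eq]
      change 1 / 4 ≤ _
      exact le_trans (by linarith) (neg_le_abs _)
  have hρG0 : ∀ y : E3, ¬ (1 / 2 < ‖y‖ ∧ ‖y‖ < 3 / 2) →
      (fun z => ρ z * G z) =ᶠ[𝓝 y] fun _ => 0 := fun y hy => by
    filter_upwards [hev y hy] with z hz
    rw [hz, zero_mul]
  have hρGd : ∀ y : E3, DifferentiableAt ℝ (fun z => ρ z * G z) y := by
    intro y
    by_cases hy : y = 0
    · exact (hρG0 y (by rw [hy, norm_zero]; norm_num)).differentiableAt_iff.2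
        (differentiableAt_const _)
    · exact (hρG y hy).differentiableAt (by norm_num)
  have hFd : ∀ (y : E3), y ≠ 0 → ∀ e, ContDiffAt ℝ 1 (fun z => fderiv ℝ F z e) y :=
    fun y hy e => contDiffAt_fderiv_apply (hF y hy) (by norm_num) e
  have hI1 : ∀ i, Integrable fun y => fderiv ℝ (fun z => ρ z * G z) y (stdE i) *
      fderiv ℝ F y (stdE i) := by
    intro i
    apply integrable_of_annulus
    · intro y hy
      exact (contDiffAt_fderiv_apply (m := 1) (hρG y hy) (by norm_num) _).continuousAt.mul
        (hFd y hy _).continuousAt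
    · intro y hy
      rw [(hρG0 y hy).fderiv_eq]
      simp
  have hI2 : ∀ i, Integrable fun y => (ρ y * G y) *
      fderiv ℝ (fun z => fderiv ℝ F z (stdE i)) y (stdE i) := by
    intro i
    apply integrable_of_annulus
    · intro y hy
      exact (hρG y hy).continuousAt.mul
        (contDiffAt_fderiv_apply (m := 0) (hFd y hy _) (by norm_num) _).continuousAt
    · intro y hy
      rw [hρ0 y hy]
      simp
  have hI3 : ∀ i, Integrable fun y => (ρ y * G y) * fderiv ℝ F y (stdE i) := by
    intro i
    apply integrable_of_annulus
    · intro y hy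
      exact (hρG y hy).continuousAt.mul (hFd y hy _).continuousAt
    · intro y hy
      rw [hρ0 y hy]
      simp
  have hzero : ∀ y ∈ tsupport (fun z => ρ z * G z), y ≠ 0 := by
    rintro y hy rfl
    exact (notMem_tsupport_iff_eventuallyEq.2 (hρG0 0 (by rw [norm_zero]; norm_num))) hy
  have hparts : ∀ i, ∫ y, (ρ y * G y) * fderiv ℝ (fun z => fderiv ℝ F z (stdE i)) y (stdE i) =
      -∫ y, fderiv ℝ (fun z => ρ z * G z) y (stdE i) * fderiv ℝ F y (stdE i) := fun i =>
    integral_mul_fderiv_eq_neg_fderiv_mul_of_integrable (hI1 i) (hI2 i) (hI3 i)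
      (fun y _ => hρGd y) (fun y hy => (hFd y (hzero y hy) _).differentiableAt (by norm_num))
  have hsum : ∫ y, ∑ i, (ρ y * G y) * fderiv ℝ (fun z => fderiv ℝ F z (stdE i)) y (stdE i) =
      -∫ y, ∑ i, fderiv ℝ (fun z => ρ z * G z) y (stdE i) * fderiv ℝ F y (stdE i) := by
    rw [integral_finsetSum _ fun i _ => hI2 i, integral_finsetSum _ fun i _ => hI1 i,
      ← Finset.sum_neg_distrib]
    exact Finset.sum_congr rfl fun i _ => hparts i
  -- Both integrands are homogeneous of degree -2 apart from ρ, so each becomes a function on the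
  -- sphere times r⁻² ρ, and polar coordinates give the same radial constant on both sides.
  have hpolar : ∀ y : E3, y ≠ 0 → ∃ θ : S2, ∃ r : ℝ, 0 < r ∧ r = ‖y‖ ∧ y = r • (θ : E3) ∧
      ∀ k : S2 → ℝ, radialExt k y = k θ := by
    intro y hy
    refine ⟨⟨‖y‖⁻¹ • y, by simp [norm_smul, hy]⟩, ‖y‖, norm_pos_iff.2 hy, rfl, ?_, fun k =>
      radialExt_of_ne_zero k hy⟩
    simp [smul_smul, hy]
  have hleft : (fun y => ∑ i, (ρ y * G y) * fderiv ℝ (fun z => fderiv ℝ F z (stdE i)) y (stdE i))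
      = fun y => radialExt (fun θ => g θ * sphLaplacian f θ) y *
          ((fun r => (r ^ 2)⁻¹ * radialBump r) ‖y‖) := by
    funext y
    by_cases hy : y = 0
    · rw [hρ0 y (by rw [hy, norm_zero]; norm_num)]
      simp [hy, radialExt]
    obtain ⟨θ, r, hr, hrn, hyr, hk⟩ := hpolar y hy
    rw [hk, ← Finset.mul_sum]
    have h1 : ∑ i, fderiv ℝ (fun z => fderiv ℝ F z (stdE i)) y (stdE i) =
        (r ^ 2)⁻¹ * sphLaplacian f θ := by
      rw [sphLaplacian, laplacian_eq_sum (hF _ (coe_ne_zero θ)), Finset.mul_sum]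
      refine Finset.sum_congr rfl fun i _ => ?_
      rw [hyr]
      exact fderiv_fderiv_radialExt_smul f hr _ _
    rw [h1, show G y = g θ from hk g, ← hrn, hρ]
    simp only [← hrn]
    ring
  have hright : (fun y => ∑ i, fderiv ℝ (fun z => ρ z * G z) y (stdE i) * fderiv ℝ F y (stdE i))
      = fun y => radialExt (fun θ => inner ℝ (sphGrad g θ) (sphGrad f θ)) y *
          ((fun r => (r ^ 2)⁻¹ * radialBump r) ‖y‖) := by
    funext y
    by_cases hy : y = 0
    · rw [(hρG0 y (by rw [hy, norm_zero]; norm_num)).fderiv_eq]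
      simp [hy, radialExt]
    have hdρ := (hρC y hy).differentiableAt (by norm_num)
    have hdG := (hG y hy).differentiableAt (by norm_num)
    have hdF := (hF y hy).differentiableAt (by norm_num)
    have hρ' : ∀ e, fderiv ℝ ρ y e = (deriv radialBump ‖y‖ * ‖y‖⁻¹) * inner ℝ e y := by
      intro e
      have h1 := (radialBump.contDiff (n := 1)).differentiable (by norm_num) ‖y‖
      have h2 := h1.hasDerivAt.comp_hasFDerivAt y
        ((contDiffAt_norm ℝ hy (n := 1)).differentiableAt (by norm_num)).hasFDerivAt
      have h3 : fderiv ℝ ρ y = _ := h2.fderiv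
      rw [h3]
      simp only [smul_apply, smul_eq_mul]
      rw [mul_assoc]
      congr 1
      have h4 := (hasStrictFDerivAt_norm_sq y).hasFDerivAt.fderiv
      have h5 : HasFDerivAt (fun z : E3 => ‖z‖ ^ 2) ((2 * ‖y‖) • fderiv ℝ (fun z : E3 => ‖z‖) y)
          y := by
        have := ((contDiffAt_norm ℝ hy (n := 1)).differentiableAt (by norm_num)).hasFDerivAt.pow 2
        simpa using! this
      rw [h5.fderiv] at h4
      have h6 := congrArg (fun L => L e) h4
      simp only [smul_apply, smul_eq_mul, innerSL_apply_apply,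
        nsmul_eq_mul] at h6
      have hn : ‖y‖ ≠ 0 := by simpa using hy
      rw [real_inner_comm]
      field_simp
      push_cast at h6
      linarith
    obtain ⟨θ, r, hr, hrn, hyr, hk⟩ := hpolar y hy
    have h1 : ∀ i, fderiv ℝ (fun z => ρ z * G z) y (stdE i) * fderiv ℝ F y (stdE i) =
        ρ y * (fderiv ℝ G y (stdE i) * fderiv ℝ F y (stdE i)) +
        (G y * (deriv radialBump ‖y‖ * ‖y‖⁻¹)) * (inner ℝ (stdE i) y * fderiv ℝ F y (stdE i)) := by
      intro i
      rw [fderiv_fun_mul hdρ hdG]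
      simp only [add_apply, smul_apply, smul_eq_mul, hρ']
      ring
    simp only [h1]
    rw [Finset.sum_add_distrib, ← Finset.mul_sum, ← Finset.mul_sum]
    -- The gradient of the cutoff is radial and F has no radial derivative, so the cutoff
    -- contributes no error term.
    have h2 : ∑ i, inner ℝ (stdE i) y * fderiv ℝ F y (stdE i) = 0 := by
      have h3 := congrArg (fderiv ℝ F y) (sum_inner_stdE_smul y)
      rw [map_sum, fderiv_radialExt_self hdF] at h3
      simpa using h3
    rw [h2, mul_zero, add_zero, hk, inner_sphGrad]
    have h4 : ∀ i, fderiv ℝ G y (stdE i) * fderiv ℝ F y (stdE i) = (r ^ 2)⁻¹ *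
        (fderiv ℝ G θ (stdE i) * fderiv ℝ F θ (stdE i)) := by
      intro i
      rw [hyr, fderiv_radialExt_smul f hr, fderiv_radialExt_smul g hr]
      simp only [smul_apply, smul_eq_mul]
      field_simp
      rfl
    simp only [h4, ← Finset.mul_sum, hρ, ← hrn]
    ring
  rw [hleft, hright, integral_radialExt_mul _ fun r => (r ^ 2)⁻¹ * radialBump r,
    integral_radialExt_mul _ fun r => (r ^ 2)⁻¹ * radialBump r, ← neg_mul] at hsum
  refine mul_right_cancel₀ ?_ hsum
  -- The Jacobian r² cancels the r⁻² of homogeneity; what is left is positive and can be divided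
  -- out.
  have : ∫ r in Ioi (0 : ℝ), r ^ 2 * ((r ^ 2)⁻¹ * radialBump r) =
      ∫ r in Ioi (0 : ℝ), radialBump r := by
    refine setIntegral_congr_fun measurableSet_Ioi fun r hr => ?_
    have : r ≠ 0 := ne_of_gt hr
    field_simp
  rw [this]
  exact integral_radialBump_pos.ne'

theorem integral_mul_sphLaplacian_comm {f g : S2 → ℝ} (hf : ContMDiff (𝓡 2) 𝓘(ℝ, ℝ) 2 f)
    (hg : ContMDiff (𝓡 2) 𝓘(ℝ, ℝ) 2 g) :
    ∫ θ, g θ * sphLaplacian f θ ∂sigma = ∫ θ, f θ * sphLaplacian g θ ∂sigma := by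
  rw [integral_mul_sphLaplacian hf hg, integral_mul_sphLaplacian hg hf]
  simp only [real_inner_comm]

/-! ### Spherical harmonics -/

/-- The second derivative in the direction `e`, computed along a line. -/
theorem fderiv_fderiv_eq_of_line {F : E3 → ℝ} {y e : E3} (hF : ContDiffAt ℝ 2 F y) {k : ℝ → ℝ}
    {k' : ℝ} (h1 : ∀ᶠ s in 𝓝 (0 : ℝ), HasDerivAt (fun s => F (y + s • e)) (k s) s)
    (h2 : HasDerivAt k k' 0) : fderiv ℝ (fun z => fderiv ℝ F z e) y e = k' := by
  have hline : ∀ s : ℝ, HasDerivAt (fun s : ℝ => y + s • e) e s := fun s => by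
    simpa using ((hasDerivAt_id s).smul_const e).const_add y
  have hcont : ContinuousAt (fun s : ℝ => y + s • e) 0 := (hline 0).continuousAt
  have hev : ∀ᶠ s in 𝓝 (0 : ℝ), k s = fderiv ℝ F (y + s • e) e := by
    have h3 : ∀ᶠ z in 𝓝 (y + (0 : ℝ) • e), ContDiffAt ℝ 2 F z := by
      simpa using hF.eventually (by simp)
    filter_upwards [hcont.eventually h3, h1] with s hs hs'
    exact hs'.unique
      ((hs.differentiableAt (by norm_num)).hasFDerivAt.comp_hasDerivAt s (hline s))
  have h4 : DifferentiableAt ℝ (fun z => fderiv ℝ F z e) (y + (0 : ℝ) • e) := by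
    simpa using (contDiffAt_fderiv_apply (m := 1) hF (by norm_num) e).differentiableAt
      (by norm_num)
  have h5 := h4.hasFDerivAt.comp_hasDerivAt (0 : ℝ) (hline 0)
  have h6 := (EventuallyEq.hasDerivAt_iff hev).1 h2
  have h7 := h5.unique h6
  simpa using h7

/-- The complex number `y₀ + i y₁`. -/
def horiz (y : E3) : ℂ := ⟨y 0, y 1⟩

/-- The sectoral spherical harmonic `Re (θ₀ + i θ₁)^ℓ`. -/
def sectoral (ℓ : ℕ) (θ : S2) : ℝ := (horiz θ ^ ℓ).re

theorem contDiff_horiz {n : ℕ∞ω} : ContDiff ℝ n horiz := by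
  have h : horiz = fun y : E3 => ((y 0 : ℝ) : ℂ) + ((y 1 : ℝ) : ℂ) * Complex.I := by
    funext y
    apply Complex.ext <;> simp [horiz]
  rw [h]
  have h0 : ∀ i : Fin 3, ContDiff ℝ n fun y : E3 => y i := fun i => by fun_prop
  exact (Complex.ofRealCLM.contDiff.comp (h0 0)).add
    ((Complex.ofRealCLM.contDiff.comp (h0 1)).mul contDiff_const)

theorem contMDiff_sectoral {n : ℕ∞ω} (ℓ : ℕ) : ContMDiff (𝓡 2) 𝓘(ℝ, ℝ) n (sectoral ℓ) := by
  have : Fact (Module.finrank ℝ E3 = 2 + 1) := ⟨by simp⟩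
  have h : ContDiff ℝ n fun y : E3 => (horiz y ^ ℓ).re :=
    Complex.reCLM.contDiff.comp (contDiff_horiz.pow ℓ)
  exact h.contMDiff.comp contMDiff_coe_sphere

theorem radialExt_sectoral (ℓ : ℕ) {y : E3} (hy : y ≠ 0) :
    radialExt (sectoral ℓ) y = (horiz y ^ ℓ).re * (‖y‖ ^ 2) ^ (-(ℓ : ℝ) / 2) := by
  rw [radialExt_of_ne_zero _ hy, sectoral]
  have h1 : horiz (‖y‖⁻¹ • y) = ((‖y‖⁻¹ : ℝ) : ℂ) * horiz y := by
    apply Complex.ext <;> simp [horiz]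
  simp only [h1]
  rw [mul_pow, ← Complex.ofReal_pow, Complex.re_ofReal_mul, mul_comm]
  congr 1
  have hn : 0 < ‖y‖ := norm_pos_iff.2 hy
  rw [← Real.rpow_natCast ‖y‖ 2, ← Real.rpow_mul hn.le, inv_pow, ← Real.rpow_natCast,
    ← Real.rpow_neg hn.le]
  congr 1
  push_cast
  ring

/-- The extension is P(y) |y|^{-ℓ} with P = Re (y₀ + i y₁)^ℓ, a harmonic polynomial homogeneous of
degree ℓ. At |y| = 1 the Laplacian has a cross term -2ℓ (y·∇P) = -2ℓ² P and a term P Δ|y|^{-ℓ} = (ℓ²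
- ℓ) P, which add up to -ℓ(ℓ+1) P. -/
theorem isSphericalHarmonic_sectoral (ℓ : ℕ) : IsSphericalHarmonic ℓ (sectoral ℓ) := by
  refine ⟨contMDiff_sectoral ℓ, fun θ => ?_⟩
  have hC := contDiffAt_radialExt (contMDiff_sectoral (n := 2) ℓ) (coe_ne_zero θ)
  have hθ : ‖(θ : E3)‖ = 1 := by simp
  set w := horiz θ with hw
  set q : ℝ := -(ℓ : ℝ) / 2 with hq
  have key : ∀ i, fderiv ℝ (fun z => fderiv ℝ (radialExt (sectoral ℓ)) z (stdE i)) θ (stdE i) =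
      ((ℓ : ℂ) * (((ℓ - 1 : ℕ) : ℂ) * w ^ (ℓ - 1 - 1) * horiz (stdE i)) * horiz (stdE i)).re
      + 2 * ((ℓ : ℂ) * w ^ (ℓ - 1) * horiz (stdE i)).re * (-(ℓ : ℝ) * (θ : E3) i)
      + (w ^ ℓ).re * (q * ((q - 1) * (2 * (θ : E3) i) ^ 2 + 2)) := by
    intro i
    set e := stdE i
    set b : ℝ := (θ : E3) i with hb
    have he : ∀ s : ℝ, ‖(θ : E3) + s • e‖ ^ 2 = 1 + 2 * b * s + s ^ 2 := by
      intro s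
      rw [norm_add_sq_real, hθ, norm_smul, inner_smul_right]
      have h1 : ‖e‖ = 1 := (EuclideanSpace.basisFun (Fin 3) ℝ).norm_eq_one i
      have h2 : inner ℝ (θ : E3) e = b := by
        simp [e, stdE, hb, EuclideanSpace.inner_single_right]
      rw [h1, h2, mul_one, Real.norm_eq_abs, sq_abs]
      ring
    have hh : ∀ s : ℝ, horiz ((θ : E3) + s • e) = w + (s : ℂ) * horiz e := by
      intro s
      apply Complex.ext <;> simp [horiz, hw]
    have hpos : ∀ᶠ s : ℝ in 𝓝 (0 : ℝ), 0 < 1 + 2 * b * s + s ^ 2 := by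
      have : ContinuousAt (fun s : ℝ => 1 + 2 * b * s + s ^ 2) 0 := by fun_prop
      exact this.eventually (lt_mem_nhds (by norm_num))
    have hev : ∀ᶠ s : ℝ in 𝓝 (0 : ℝ), radialExt (sectoral ℓ) ((θ : E3) + s • e) =
        ((w + (s : ℂ) * horiz e) ^ ℓ).re * (1 + 2 * b * s + s ^ 2) ^ q := by
      filter_upwards [hpos] with s hs
      have hne : (θ : E3) + s • e ≠ 0 := by
        intro h0
        have := he s
        rw [h0] at this
        simp at this
        linarith
      rw [radialExt_sectoral ℓ hne, he, hh]
    have hlin : ∀ s : ℝ, HasDerivAt (fun s : ℝ => w + (s : ℂ) * horiz e) (horiz e) s := by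
      intro s
      simpa using ((Complex.ofRealCLM.hasDerivAt (x := s)).mul_const (horiz e)).const_add w
    have hpow : ∀ (n : ℕ) (s : ℝ), HasDerivAt (fun s : ℝ => (w + (s : ℂ) * horiz e) ^ n)
        ((n : ℂ) * (w + (s : ℂ) * horiz e) ^ (n - 1) * horiz e) s := fun n s => (hlin s).pow n
    have hre : ∀ {f : ℝ → ℂ} {f' : ℂ} {s : ℝ}, HasDerivAt f f' s →
        HasDerivAt (fun s => (f s).re) f'.re s := fun {f f' s} h => by
      simpa using! Complex.reCLM.hasFDerivAt.comp_hasDerivAt s h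
    have hquad : ∀ s : ℝ, HasDerivAt (fun s : ℝ => 1 + 2 * b * s + s ^ 2) (2 * b + 2 * s) s := by
      intro s
      have := (((hasDerivAt_id s).const_mul (2 * b)).const_add 1).add ((hasDerivAt_id s).pow 2)
      simpa using! this
    have hB : ∀ (r : ℝ) (s : ℝ), 0 < 1 + 2 * b * s + s ^ 2 →
        HasDerivAt (fun s : ℝ => (1 + 2 * b * s + s ^ 2) ^ r)
          ((2 * b + 2 * s) * r * (1 + 2 * b * s + s ^ 2) ^ (r - 1)) s := fun r s hs =>
      (hquad s).rpow_const (Or.inl hs.ne')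
    have hA' : HasDerivAt (fun s : ℝ => ((ℓ : ℂ) * (w + (s : ℂ) * horiz e) ^ (ℓ - 1) * horiz e).re)
        ((ℓ : ℂ) * (((ℓ - 1 : ℕ) : ℂ) * w ^ (ℓ - 1 - 1) * horiz e) * horiz e).re 0 := by
      have := hre (((hpow (ℓ - 1) 0).const_mul (ℓ : ℂ)).mul_const (horiz e))
      simpa using this
    have hB' : HasDerivAt (fun s : ℝ => (2 * b + 2 * s) * q * (1 + 2 * b * s + s ^ 2) ^ (q - 1))
        (2 * q + 2 * b * q * (2 * b * (q - 1))) 0 := by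
      have h1 : HasDerivAt (fun s : ℝ => (2 * b + 2 * s) * q) (2 * q) 0 := by
        simpa using (((hasDerivAt_id (0 : ℝ)).const_mul 2).const_add (2 * b)).mul_const q
      have := h1.mul (hB (q - 1) 0 (by norm_num))
      simpa using! this
    have h1 : ∀ᶠ s : ℝ in 𝓝 (0 : ℝ), HasDerivAt
        (fun s : ℝ => radialExt (sectoral ℓ) ((θ : E3) + s • e))
        (((ℓ : ℂ) * (w + (s : ℂ) * horiz e) ^ (ℓ - 1) * horiz e).re *
            (1 + 2 * b * s + s ^ 2) ^ q +
          ((w + (s : ℂ) * horiz e) ^ ℓ).re *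
            ((2 * b + 2 * s) * q * (1 + 2 * b * s + s ^ 2) ^ (q - 1))) s := by
      filter_upwards [hev.eventually_nhds, hpos] with s hs hs'
      exact (EventuallyEq.hasDerivAt_iff hs).2 ((hre (hpow ℓ s)).mul (hB q s hs'))
    have h2 := (hA'.mul (hB q 0 (by norm_num))).add ((hre (hpow ℓ 0)).mul hB')
    rw [fderiv_fderiv_eq_of_line hC h1 h2]
    simp only [Complex.ofReal_zero, zero_mul, add_zero, mul_zero, ne_eq, OfNat.ofNat_ne_zero,
      not_false_eq_true, zero_pow, Real.one_rpow, mul_one]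
    rw [hq]
    ring
  rw [sphLaplacian, laplacian_eq_sum hC]
  simp only [key]
  rw [Fin.sum_univ_three]
  have e0 : horiz (stdE 0) = 1 := by apply Complex.ext <;> simp [horiz, stdE]
  have e1 : horiz (stdE 1) = Complex.I := by apply Complex.ext <;> simp [horiz, stdE]
  have e2 : horiz (stdE 2) = 0 := by apply Complex.ext <;> simp [horiz, stdE]
  rw [e0, e1, e2]
  have hsq : (θ : E3) 0 ^ 2 + (θ : E3) 1 ^ 2 + (θ : E3) 2 ^ 2 = 1 := by
    have := EuclideanSpace.real_norm_sq_eq (θ : E3)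
    rw [hθ, Fin.sum_univ_three] at this
    linarith
  -- Euler's identity for P. The natural subtraction in ℓ - 1 is harmless, because the factor ℓ
  -- vanishes when ℓ = 0.
  have hEuler : ((ℓ : ℂ) * w ^ (ℓ - 1)).re * (θ : E3) 0 +
      ((ℓ : ℂ) * w ^ (ℓ - 1) * Complex.I).re * (θ : E3) 1 = ℓ * (w ^ ℓ).re := by
    have h1 : (ℓ : ℂ) * w ^ (ℓ - 1) * w = ℓ * w ^ ℓ := by
      rcases Nat.eq_zero_or_pos ℓ with h | h
      · simp [h]
      · rw [mul_assoc, ← pow_succ, Nat.sub_add_cancel h]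
    have h2 := congrArg Complex.re h1
    rw [Complex.mul_re] at h2
    have h3 : w.re = (θ : E3) 0 := rfl
    have h4 : w.im = (θ : E3) 1 := rfl
    rw [h3, h4] at h2
    rw [Complex.mul_I_re]
    have h5 : ((ℓ : ℂ) * w ^ ℓ).re = ℓ * (w ^ ℓ).re := by simp
    linarith
  -- Harmonicity of P: the second derivatives in the two horizontal directions differ by I² = -1.
  have hI2 : (ℓ : ℂ) * (((ℓ - 1 : ℕ) : ℂ) * w ^ (ℓ - 1 - 1) * Complex.I) * Complex.I =
      -((ℓ : ℂ) * (((ℓ - 1 : ℕ) : ℂ) * w ^ (ℓ - 1 - 1) * 1) * 1) := by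
    have := Complex.I_mul_I
    linear_combination ((ℓ : ℂ) * (((ℓ - 1 : ℕ) : ℂ) * w ^ (ℓ - 1 - 1))) * this
  rw [hI2]
  simp only [Complex.neg_re, mul_one, mul_zero, Complex.zero_re, zero_mul]
  rw [show sectoral ℓ θ = (w ^ ℓ).re from rfl, hq]
  linear_combination (-2 * (ℓ : ℝ)) * hEuler + ((w ^ ℓ).re * (ℓ : ℝ) * (ℓ + 2)) * hsq

theorem IsSphericalHarmonic.contMDiff_two {ℓ : ℕ} {Y : S2 → ℝ} (hY : IsSphericalHarmonic ℓ Y) :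
    ContMDiff (𝓡 2) 𝓘(ℝ, ℝ) 2 Y := hY.1.of_le ENat.LEInfty.out

theorem IsSphericalHarmonic.const_mul {ℓ : ℕ} {Y : S2 → ℝ} (hY : IsSphericalHarmonic ℓ Y)
    (c : ℝ) : IsSphericalHarmonic ℓ fun θ => c * Y θ := by
  refine ⟨contMDiff_const.mul hY.1, fun θ => ?_⟩
  rw [sphLaplacian_smul c hY.contMDiff_two, hY.2]
  ring

theorem IsSphericalHarmonic.sub {ℓ : ℕ} {Y Z : S2 → ℝ} (hY : IsSphericalHarmonic ℓ Y)
    (hZ : IsSphericalHarmonic ℓ Z) : IsSphericalHarmonic ℓ fun θ => Y θ - Z θ := by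
  refine ⟨hY.1.sub hZ.1, fun θ => ?_⟩
  rw [sphLaplacian_sub hY.contMDiff_two hZ.contMDiff_two, hY.2, hZ.2]
  ring

instance : IsFiniteMeasure sigma := inferInstanceAs (IsFiniteMeasure (volume : Measure E3).toSphere)

instance : sigma.IsOpenPosMeasure :=
  inferInstanceAs ((volume : Measure E3).toSphere.IsOpenPosMeasure)

theorem integrable_sigma {f : S2 → ℝ} (hf : Continuous f) : Integrable f sigma :=
  hf.integrable_of_hasCompactSupport (HasCompactSupport.of_compactSpace f)

theorem eq_zero_of_integral_sq_eq_zero {f : S2 → ℝ} (hf : Continuous f)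
    (h : ∫ θ, f θ * f θ ∂sigma = 0) : f = 0 := by
  have h1 : (fun θ => f θ * f θ) =ᵐ[sigma] 0 :=
    (integral_eq_zero_iff_of_nonneg (fun θ => mul_self_nonneg _) (integrable_sigma (hf.mul hf))).1 h
  have h2 : (fun θ => f θ * f θ) = 0 := by
    exact (Continuous.ae_eq_iff_eq sigma (hf.mul hf) continuous_const).1 h1
  funext θ
  simpa using congrFun h2 θ

theorem IsSphericalHarmonic.integral_mul_sphLaplacian {ℓ : ℕ} {Y f : S2 → ℝ}
    (hY : IsSphericalHarmonic ℓ Y) (hf : ContMDiff (𝓡 2) 𝓘(ℝ, ℝ) 2 f) :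
    ∫ θ, Y θ * sphLaplacian f θ ∂sigma = -((ℓ : ℝ) * (ℓ + 1)) * ∫ θ, Y θ * f θ ∂sigma := by
  rw [integral_mul_sphLaplacian_comm hf hY.contMDiff_two, ← integral_const_mul]
  refine integral_congr_ae (ae_of_all _ fun θ => ?_)
  simp only [hY.2]
  ring

/-- This is what lets a pairing of u with Y be estimated by the gradient of u, with a gain of
ℓ(ℓ+1). -/
theorem IsSphericalHarmonic.integral_inner_sphGrad {ℓ : ℕ} {Y f : S2 → ℝ}
    (hY : IsSphericalHarmonic ℓ Y) (hf : ContMDiff (𝓡 2) 𝓘(ℝ, ℝ) 2 f) :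
    ∫ θ, inner ℝ (sphGrad Y θ) (sphGrad f θ) ∂sigma =
      (ℓ : ℝ) * (ℓ + 1) * ∫ θ, Y θ * f θ ∂sigma := by
  have h1 := hY.integral_mul_sphLaplacian hf
  rw [WarpedWave.integral_mul_sphLaplacian hf hY.contMDiff_two] at h1
  linarith

/-- Eigenfunctions of a symmetric operator; the eigenvalues differ because k(k+1) - ℓ(ℓ+1) = (k -
ℓ)(k + ℓ + 1). -/
theorem IsSphericalHarmonic.orthogonal {ℓ k : ℕ} {Y Z : S2 → ℝ} (hY : IsSphericalHarmonic ℓ Y)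
    (hZ : IsSphericalHarmonic k Z) (h : ℓ ≠ k) : ∫ θ, Y θ * Z θ ∂sigma = 0 := by
  have h1 := hY.integral_mul_sphLaplacian hZ.contMDiff_two
  have h2 : ∫ θ, Y θ * sphLaplacian Z θ ∂sigma =
      -((k : ℝ) * (k + 1)) * ∫ θ, Y θ * Z θ ∂sigma := by
    rw [← integral_const_mul]
    refine integral_congr_ae (ae_of_all _ fun θ => ?_)
    simp only [hZ.2]
    ring
  rw [h1] at h2
  have h3 : ((k : ℝ) - ℓ) * (k + ℓ + 1) * ∫ θ, Y θ * Z θ ∂sigma = 0 := by linarith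
  have h4 : ((k : ℝ) - ℓ) ≠ 0 := sub_ne_zero.2 (by exact_mod_cast h.symm)
  have h5 : (k : ℝ) + ℓ + 1 ≠ 0 := by positivity
  simpa [h4, h5] using h3

/-- The difference of two candidates is itself a harmonic of degree ℓ and is orthogonal to itself,
so the arbitrary choice in `sphProj` is immaterial. -/
theorem sphProj_eq_of_isProj {ℓ : ℕ} {f Y : S2 → ℝ} (hY : IsSphericalHarmonic ℓ Y)
    (hf : Continuous f)
    (h : ∀ Z, IsSphericalHarmonic ℓ Z → ∫ θ, (f θ - Y θ) * Z θ ∂sigma = 0) :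
    sphProj ℓ f = Y := by
  have hex : ∃ Y : S2 → ℝ, IsSphericalHarmonic ℓ Y ∧
      ∀ Z : S2 → ℝ, IsSphericalHarmonic ℓ Z → ∫ θ, (f θ - Y θ) * Z θ ∂sigma = 0 := ⟨Y, hY, h⟩
  have hdef : sphProj ℓ f = hex.choose := by rw [sphProj, dif_pos hex]
  obtain ⟨hW, hW'⟩ := hex.choose_spec
  rw [hdef]
  set W := hex.choose
  have hD := hW.sub hY
  have hcD : Continuous fun θ => W θ - Y θ := hD.1.continuous
  have h0 : ∫ θ, (W θ - Y θ) * (W θ - Y θ) ∂sigma = 0 := by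
    have e1 := hW' _ hD
    have e2 := h _ hD
    have e3 : ∫ θ, (W θ - Y θ) * (W θ - Y θ) ∂sigma =
        ∫ θ, (f θ - Y θ) * (W θ - Y θ) - (f θ - W θ) * (W θ - Y θ) ∂sigma :=
      integral_congr_ae (ae_of_all _ fun θ => by ring)
    rw [e3, integral_sub, e1, e2, sub_zero]
    · exact integrable_sigma ((hf.sub hY.1.continuous).mul hcD)
    · exact integrable_sigma ((hf.sub hW.1.continuous).mul hcD)
  funext θ
  have := congrFun (eq_zero_of_integral_sq_eq_zero hcD h0) θ
  simp only [Pi.zero_apply] at this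
  linarith

theorem sphProj_const_mul {ℓ k : ℕ} {Y : S2 → ℝ} (hY : IsSphericalHarmonic ℓ Y) (c : ℝ) :
    sphProj k (fun θ => c * Y θ) = if k = ℓ then fun θ => c * Y θ else 0 := by
  have hc := hY.const_mul c
  split_ifs with h
  · subst h
    exact sphProj_eq_of_isProj hc hc.1.continuous (by simp)
  · refine sphProj_eq_of_isProj ?_ hc.1.continuous fun Z hZ => ?_
    · have := hZ0 k
      exact this
    · simpa using hc.orthogonal hZ (Ne.symm h)
where
  hZ0 (k : ℕ) : IsSphericalHarmonic k 0 := by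
    have := (isSphericalHarmonic_sectoral k).const_mul 0
    simpa [funext_iff, Pi.zero_def] using this

/-- Only the term of index ℓ of the spectral sum survives, so no convergence question arises. -/
theorem angPow_mul (m : ℕ) (s : ℝ) {ℓ : ℕ} {Y : S2 → ℝ} (hY : IsSphericalHarmonic ℓ Y)
    (φ : ℝ → ℝ) :
    angPow m s (fun x θ => φ x * Y θ) =
      fun x θ => ((1 + (ℓ : ℝ) * (ℓ + 1) / warp m x ^ 2) ^ (s / 2) * φ x) * Y θ := by
  funext x θ
  rw [angPow, tsum_eq_single ℓ]
  · rw [sphProj_const_mul hY, if_pos rfl]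
    ring
  · intro k hk
    rw [sphProj_const_mul hY, if_neg hk]
    simp

theorem sectoral_sq_pos (ℓ : ℕ) : 0 < ∫ θ, sectoral ℓ θ * sectoral ℓ θ ∂sigma := by
  refine lt_of_le_of_ne (integral_nonneg fun θ => mul_self_nonneg _) fun h => ?_
  have h1 := eq_zero_of_integral_sq_eq_zero
    (contMDiff_sectoral (n := ∞) ℓ).continuous h.symm
  have h2 := congrFun h1 ⟨stdE 0, mem_sphere_zero_iff_norm.2
    ((EuclideanSpace.basisFun (Fin 3) ℝ).norm_eq_one 0)⟩
  have e0 : horiz (stdE 0) = 1 := by apply Complex.ext <;> simp [horiz, stdE]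
  simp [sectoral, e0] at h2

/-! ### Integrals depending on parameters -/

/-- Supplies the constant dominating functions for differentiation under the integral sign. -/
theorem exists_bound_near {E X G : Type*} [TopologicalSpace E] [LocallyCompactSpace E]
    [TopologicalSpace X] [SeminormedAddCommGroup G] {f : E → X → G}
    (hf : Continuous f.uncurry) {s : Set X} (hs : IsCompact s) (e : E) :
    ∃ K ∈ 𝓝 e, ∃ C : ℝ, ∀ z ∈ K, ∀ x ∈ s, ‖f z x‖ ≤ C := by
  obtain ⟨K, hKc, hK⟩ := exists_compact_mem_nhds e
  obtain ⟨C, hC⟩ := (hKc.prod hs).bddAbove_image hf.norm.continuousOn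
  exact ⟨K, hK, C, fun z hz x hx => hC (mem_image_of_mem _ (mk_mem_prod hz hx))⟩

/-- Differentiation under the integral sign over a compact set. -/
theorem hasDerivAt_setIntegral_of_continuous {X : Type*} [TopologicalSpace X] [MeasurableSpace X]
    [OpensMeasurableSpace X] [SecondCountableTopology X] {ν : Measure X} [IsLocallyFiniteMeasure ν]
    {s : Set X} (hs : IsCompact s) (hsm : MeasurableSet s) {F F' : ℝ → X → ℝ}
    (hF : Continuous F.uncurry) (hF' : Continuous F'.uncurry)
    (h : ∀ t x, HasDerivAt (fun t => F t x) (F' t x) t) (t : ℝ) :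
    HasDerivAt (fun t => ∫ x in s, F t x ∂ν) (∫ x in s, F' t x ∂ν) t := by
  obtain ⟨K, hK, C, hC⟩ := exists_bound_near hF' hs t
  have hfin : IsFiniteMeasure (ν.restrict s) := ⟨by
    simpa using hs.measure_lt_top⟩
  have hint : Integrable (F t) (ν.restrict s) := by
    obtain ⟨_, hK2, C2, hC2⟩ := exists_bound_near hF hs t
    refine Integrable.of_bound (hF.uncurry_left t).aestronglyMeasurable C2 ?_
    exact (ae_restrict_iff' hsm).2 (ae_of_all _ fun x hx => hC2 t (mem_of_mem_nhds hK2) x hx)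
  refine (hasDerivAt_integral_of_dominated_loc_of_deriv_le (bound := fun _ => C) hK
    (Eventually.of_forall fun z => (hF.uncurry_left z).aestronglyMeasurable) hint
    (hF'.uncurry_left t).aestronglyMeasurable ?_ (integrable_const _) ?_).2
  · exact (ae_restrict_iff' hsm).2 (ae_of_all _ fun x hx z hz => hC z hz x hx)
  · exact ae_of_all _ fun x z _ => h z x

theorem hasFDerivAt_intervalIntegral_of_contDiff {E : Type*} [NormedAddCommGroup E]
    [NormedSpace ℝ E] [FiniteDimensional ℝ E] {H : E × ℝ → ℝ} (hH : ContDiff ℝ 1 H) (a b : ℝ)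
    (e : E) :
    HasFDerivAt (fun e => ∫ σ in a..b, H (e, σ))
      (∫ σ in a..b, (fderiv ℝ H (e, σ)).comp (ContinuousLinearMap.inl ℝ E ℝ)) e := by
  have : ProperSpace E := FiniteDimensional.proper ℝ E
  have hD : Continuous fun p : E × ℝ =>
      (fderiv ℝ H p).comp (ContinuousLinearMap.inl ℝ E ℝ) :=
    (hH.continuous_fderiv (by norm_num)).clm_comp continuous_const
  obtain ⟨K, hK, C, hC⟩ := exists_bound_near
    (f := fun (e : E) (σ : ℝ) => (fderiv ℝ H (e, σ)).comp (ContinuousLinearMap.inl ℝ E ℝ)) hD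
    (isCompact_uIcc (a := a) (b := b)) e
  refine intervalIntegral.hasFDerivAt_integral_of_dominated_of_fderiv_le (𝕜 := ℝ) (μ := volume)
    (a := a) (b := b) (F' := fun e σ => (fderiv ℝ H (e, σ)).comp (ContinuousLinearMap.inl ℝ E ℝ))
    (F := fun e σ => H (e, σ)) (bound := fun _ => C) hK
    (Eventually.of_forall fun z => ?_) ?_ ?_ ?_ intervalIntegrable_const ?_
  · exact (hH.continuous.comp (by fun_prop)).aestronglyMeasurable
  · exact (hH.continuous.comp (by fun_prop)).intervalIntegrable _ _
  · exact (hD.comp (by fun_prop : Continuous fun σ : ℝ => (e, σ))).aestronglyMeasurable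
  · exact ae_of_all _ fun σ hσ z hz => hC z hz σ (uIoc_subset_uIcc hσ)
  · refine ae_of_all _ fun σ _ z _ => ?_
    have h1 : HasFDerivAt (fun z : E => (z, σ)) (ContinuousLinearMap.inl ℝ E ℝ) z :=
      (hasFDerivAt_id z).prodMk (hasFDerivAt_const σ z)
    exact ((hH.differentiable (by norm_num)) (z, σ)).hasFDerivAt.comp z h1

/-- Induction on k: each directional derivative is again an integral of the same kind, with an
integrand of one order less. -/
theorem contDiff_intervalIntegral {E : Type*} [NormedAddCommGroup E] [NormedSpace ℝ E]
    [FiniteDimensional ℝ E] (k : ℕ) (a b : ℝ) :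
    ∀ {H : E × ℝ → ℝ}, ContDiff ℝ k H → ContDiff ℝ k fun e => ∫ σ in a..b, H (e, σ) := by
  induction k with
  | zero =>
    intro H hH
    have hc : Continuous H := hH.continuous
    rw [CharP.cast_eq_zero, contDiff_zero]
    exact intervalIntegral.continuous_parametric_intervalIntegral_of_continuous'
      (f := fun e σ => H (e, σ)) hc a b
  | succ k ih =>
    intro H hH
    have h1 : ContDiff ℝ 1 H := hH.of_le (by exact_mod_cast Nat.le_add_left 1 k)
    have hD := hasFDerivAt_intervalIntegral_of_contDiff h1 a b
    push_cast
    refine contDiff_succ_iff_fderiv_apply.2 ⟨fun e => (hD e).differentiableAt, by simp, fun v => ?_⟩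
    have h2 : ContDiff ℝ k fun p : E × ℝ => fderiv ℝ H p (v, 0) :=
      (hH.fderiv_right (m := k) (by norm_cast)).clm_apply contDiff_const
    have h3 : (fun e => fderiv ℝ (fun e => ∫ σ in a..b, H (e, σ)) e v) =
        fun e => ∫ σ in a..b, fderiv ℝ H (e, σ) (v, 0) := by
      funext e
      rw [(hD e).fderiv, ContinuousLinearMap.intervalIntegral_apply]
      · simp
      · apply Continuous.intervalIntegrable
        exact ((h1.continuous_fderiv (by norm_num)).comp
          (by fun_prop : Continuous fun σ : ℝ => (e, σ))).clm_comp continuous_const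
    rw [h3]
    exact ih h2

/-- An affine substitution moves the variable endpoints into the integrand. -/
theorem contDiff_intervalIntegral_of_endpoints {E : Type*} [NormedAddCommGroup E]
    [NormedSpace ℝ E] [FiniteDimensional ℝ E] {k : ℕ} {H : E × ℝ → ℝ} {a b : E → ℝ}
    (hH : ContDiff ℝ k H) (ha : ContDiff ℝ k a) (hb : ContDiff ℝ k b) :
    ContDiff ℝ k fun e => ∫ r in a e..b e, H (e, r) := by
  have h1 : (fun e => ∫ r in a e..b e, H (e, r)) =
      fun e => (b e - a e) * ∫ σ in (0 : ℝ)..1, H (e, (b e - a e) * σ + a e) := by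
    funext e
    have := intervalIntegral.smul_integral_comp_mul_add (a := 0) (b := 1)
      (fun r => H (e, r)) (b e - a e) (a e)
    rw [smul_eq_mul] at this
    rw [this]
    simp
  rw [h1]
  refine (hb.sub ha).mul (contDiff_intervalIntegral k 0 1
    (H := fun p : E × ℝ => H (p.1, (b p.1 - a p.1) * p.2 + a p.1)) (hH.comp ?_))
  exact contDiff_fst.prodMk ((((hb.comp contDiff_fst).sub (ha.comp contDiff_fst)).mul
    contDiff_snd).add (ha.comp contDiff_fst))

/-! ### The characteristic triangle -/

/-- The integral of `F` over the characteristic triangle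
`{(ξ', η') : ξ' ≤ ξ, η' ≤ η, 0 ≤ ξ' + η'}`. -/
def triInt (F : ℝ × ℝ → ℝ) (p : ℝ × ℝ) : ℝ := ∫ s in -p.2..p.1, ∫ r in -s..p.2, F (s, r)

/-- The two partial derivatives exist, by the fundamental theorem of calculus and by differentiation
under the integral, and they are jointly continuous. -/
theorem hasFDerivAt_primitive {Φ Φ' : ℝ → ℝ → ℝ} (hΦ : Continuous fun p : ℝ × ℝ => Φ p.1 p.2)
    (hΦ' : Continuous fun p : ℝ × ℝ => Φ' p.1 p.2)
    (h : ∀ s y, HasDerivAt (Φ s) (Φ' s y) y) (p : ℝ × ℝ) :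
    HasFDerivAt (fun p : ℝ × ℝ => ∫ s in (0 : ℝ)..p.1, Φ s p.2)
      (Φ p.1 p.2 • ContinuousLinearMap.fst ℝ ℝ ℝ +
        (∫ s in (0 : ℝ)..p.1, Φ' s p.2) • ContinuousLinearMap.snd ℝ ℝ ℝ) p := by
  have hc' : Continuous fun p : ℝ × ℝ => ∫ s in (0 : ℝ)..p.1, Φ' s p.2 :=
    intervalIntegral.continuous_parametric_intervalIntegral_of_continuous
      (f := fun (p : ℝ × ℝ) s => Φ' s p.2)
      (hΦ'.comp (by fun_prop : Continuous fun q : (ℝ × ℝ) × ℝ => (q.2, q.1.2))) continuous_fst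
  have h1 : ∀ v : ℝ × ℝ, HasFDerivAt (fun x => ∫ s in (0 : ℝ)..x, Φ s v.2)
      (ContinuousLinearMap.toSpanSingleton ℝ (Φ v.1 v.2)) v.1 := by
    intro v
    have hcv : Continuous fun s => Φ s v.2 :=
      hΦ.comp (by fun_prop : Continuous fun s : ℝ => (s, v.2))
    exact (intervalIntegral.integral_hasDerivAt_right (hcv.intervalIntegrable _ _)
      (hcv.stronglyMeasurableAtFilter _ _) hcv.continuousAt).hasFDerivAt
  have h2 : ∀ v : ℝ × ℝ, HasFDerivAt (fun y => ∫ s in (0 : ℝ)..v.1, Φ s y)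
      (ContinuousLinearMap.toSpanSingleton ℝ (∫ s in (0 : ℝ)..v.1, Φ' s v.2)) v.2 := by
    intro v
    obtain ⟨K, hK, C, hC⟩ := exists_bound_near (f := fun (y : ℝ) (s : ℝ) => Φ' s y)
      (hΦ'.comp (by fun_prop : Continuous fun q : ℝ × ℝ => (q.2, q.1)))
      (isCompact_uIcc (a := (0 : ℝ)) (b := v.1)) v.2
    refine (intervalIntegral.hasDerivAt_integral_of_dominated_loc_of_deriv_le (μ := volume)
      (a := 0) (b := v.1) (F := fun y s => Φ s y) (F' := fun y s => Φ' s y)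
      (bound := fun _ => C) hK (Eventually.of_forall fun y => ?_) ?_ ?_ ?_
      intervalIntegrable_const ?_).2.hasFDerivAt
    · exact (hΦ.comp (by fun_prop : Continuous fun s : ℝ => (s, y))).aestronglyMeasurable
    · exact (hΦ.comp (by fun_prop : Continuous fun s : ℝ => (s, v.2))).intervalIntegrable _ _
    · exact (hΦ'.comp (by fun_prop : Continuous fun s : ℝ => (s, v.2))).aestronglyMeasurable
    · exact ae_of_all _ fun s hs y hy => hC y hy s (uIoc_subset_uIcc hs)
    · exact ae_of_all _ fun s _ y _ => h s y
  have := (hasStrictFDerivAt_uncurry_coprod (u := p) (f := fun x y => ∫ s in (0 : ℝ)..x, Φ s y)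
    (f₁ := fun x y => ContinuousLinearMap.toSpanSingleton ℝ (Φ x y))
    (f₂ := fun x y => ContinuousLinearMap.toSpanSingleton ℝ (∫ s in (0 : ℝ)..x, Φ' s y))
    (Eventually.of_forall h1) (Eventually.of_forall h2)
    ((ContinuousLinearMap.toSpanSingletonCLE (𝕜 := ℝ) (E := ℝ)).continuous.comp hΦ).continuousAt
    ((ContinuousLinearMap.toSpanSingletonCLE (𝕜 := ℝ) (E := ℝ)).continuous.comp
      hc').continuousAt).hasFDerivAt
  refine this.congr_fderiv ?_
  ext <;> simp [Function.HasUncurry.uncurry]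

theorem hasFDerivAt_triInt {F : ℝ × ℝ → ℝ} (hF : Continuous F) (p : ℝ × ℝ) :
    HasFDerivAt (triInt F)
      ((∫ r in -p.1..p.2, F (p.1, r)) • ContinuousLinearMap.fst ℝ ℝ ℝ +
        (∫ s in -p.2..p.1, F (s, p.2)) • ContinuousLinearMap.snd ℝ ℝ ℝ) p := by
  set Φ : ℝ → ℝ → ℝ := fun s y => ∫ r in -s..y, F (s, r) with hΦdef
  have hFi : ∀ s a b, IntervalIntegrable (fun r => F (s, r)) volume a b := fun s a b =>
    (hF.comp (by fun_prop : Continuous fun r : ℝ => (s, r))).intervalIntegrable _ _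
  have hΦ : Continuous fun p : ℝ × ℝ => Φ p.1 p.2 := by
    have h1 : (fun p : ℝ × ℝ => Φ p.1 p.2) = fun p =>
        (∫ r in (0 : ℝ)..p.2, F (p.1, r)) - ∫ r in (0 : ℝ)..-p.1, F (p.1, r) := by
      funext p
      rw [intervalIntegral.integral_interval_sub_left (hFi _ _ _) (hFi _ _ _)]
    rw [h1]
    have h2 : Continuous (Function.uncurry fun (p : ℝ × ℝ) r => F (p.1, r)) :=
      hF.comp (by fun_prop : Continuous fun q : (ℝ × ℝ) × ℝ => (q.1.1, q.2))
    exact (intervalIntegral.continuous_parametric_intervalIntegral_of_continuous h2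
      continuous_snd).sub (intervalIntegral.continuous_parametric_intervalIntegral_of_continuous h2
      continuous_fst.neg)
  have hΦ' : ∀ s y, HasDerivAt (Φ s) (F (s, y)) y := by
    intro s y
    have hc : Continuous fun r => F (s, r) := hF.comp (by fun_prop)
    exact intervalIntegral.integral_hasDerivAt_right (hc.intervalIntegrable _ _)
      (hc.stronglyMeasurableAtFilter _ _) hc.continuousAt
  have hΦi : ∀ y a b, IntervalIntegrable (fun s => Φ s y) volume a b := fun y a b =>
    (hΦ.comp (by fun_prop : Continuous fun s : ℝ => (s, y))).intervalIntegrable _ _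
  have hJ := hasFDerivAt_primitive hΦ hF hΦ'
  have htri : triInt F = fun p => (∫ s in (0 : ℝ)..p.1, Φ s p.2) -
      ∫ s in (0 : ℝ)..-p.2, Φ s p.2 := by
    funext p
    rw [triInt, intervalIntegral.integral_interval_sub_left (hΦi _ _ _) (hΦi _ _ _)]
  rw [htri]
  have hneg : HasFDerivAt (fun p : ℝ × ℝ => (-p.2, p.2))
      ((-ContinuousLinearMap.snd ℝ ℝ ℝ).prod (ContinuousLinearMap.snd ℝ ℝ ℝ)) p :=
    hasFDerivAt_snd.neg.prodMk hasFDerivAt_snd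
  -- Moving the lower endpoint contributes nothing: the inner integral at s = -y runs from y to y.
  have h2 := (hJ p).sub ((hJ (-p.2, p.2)).comp p hneg)
  refine h2.congr_fderiv ?_
  have hFs : ∀ a b, IntervalIntegrable (fun s => F (s, p.2)) volume a b := fun a b =>
    (hF.comp (by fun_prop : Continuous fun s : ℝ => (s, p.2))).intervalIntegrable _ _
  ext
  · simp [hΦdef]
  · simp [hΦdef, intervalIntegral.integral_interval_sub_left (hFs _ _) (hFs _ _)]

theorem contDiff_char_fst {k : ℕ} {F : ℝ × ℝ → ℝ} (hF : ContDiff ℝ k F) :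
    ContDiff ℝ k fun p : ℝ × ℝ => ∫ r in -p.1..p.2, F (p.1, r) :=
  contDiff_intervalIntegral_of_endpoints (H := fun q : (ℝ × ℝ) × ℝ => F (q.1.1, q.2))
    (hF.comp (by fun_prop)) (by fun_prop) (by fun_prop)

theorem contDiff_char_snd {k : ℕ} {F : ℝ × ℝ → ℝ} (hF : ContDiff ℝ k F) :
    ContDiff ℝ k fun p : ℝ × ℝ => ∫ s in -p.2..p.1, F (s, p.2) :=
  contDiff_intervalIntegral_of_endpoints (H := fun q : (ℝ × ℝ) × ℝ => F (q.2, q.1.2))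
    (hF.comp (by fun_prop)) (by fun_prop) (by fun_prop)

/-- Each first derivative of the triangle integral is a line integral of F, hence as smooth as F.
The gain of one derivative drives the bootstrap in `contDiff_of_volterra`. -/
theorem contDiff_triInt {k : ℕ} {F : ℝ × ℝ → ℝ} (hF : ContDiff ℝ k F) :
    ContDiff ℝ (k + 1 : ℕ) (triInt F) := by
  have hD := hasFDerivAt_triInt hF.continuous
  push_cast
  refine contDiff_succ_iff_fderiv_apply.2 ⟨fun p => (hD p).differentiableAt, by simp, fun v => ?_⟩
  simp only [(hD _).fderiv]
  simp only [add_apply, smul_apply, ContinuousLinearMap.coe_fst', ContinuousLinearMap.coe_snd',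
    smul_eq_mul]
  exact ((contDiff_char_fst hF).mul contDiff_const).add ((contDiff_char_snd hF).mul contDiff_const)

theorem triInt_sub {F G : ℝ × ℝ → ℝ} (hF : Continuous F) (hG : Continuous G) (p : ℝ × ℝ) :
    triInt (fun q => F q - G q) p = triInt F p - triInt G p := by
  have hc : ∀ {F : ℝ × ℝ → ℝ}, Continuous F →
      Continuous fun s : ℝ => ∫ r in -s..p.2, F (s, r) := by
    intro F hF
    have h1 : (fun s : ℝ => ∫ r in -s..p.2, F (s, r)) = fun s =>
        -∫ r in p.2..-s, F (s, r) := by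
      funext s
      rw [intervalIntegral.integral_symm]
    rw [h1]
    exact (intervalIntegral.continuous_parametric_intervalIntegral_of_continuous
      (f := fun s r => F (s, r)) hF continuous_neg).neg
  rw [triInt, triInt, triInt, ← intervalIntegral.integral_sub
    ((hc hF).intervalIntegrable _ _) ((hc hG).intervalIntegrable _ _)]
  refine intervalIntegral.integral_congr fun s _ => ?_
  exact intervalIntegral.integral_sub
    ((hF.comp (by fun_prop : Continuous fun r : ℝ => (s, r))).intervalIntegrable _ _)
    ((hG.comp (by fun_prop : Continuous fun r : ℝ => (s, r))).intervalIntegrable _ _)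

theorem integral_cosh_shift {M : ℝ} (hM : 0 < M) (s y : ℝ) :
    ∫ r in -s..y, Real.cosh (M * (s + r)) = Real.sinh (M * (s + y)) / M := by
  have h : ∀ r, HasDerivAt (fun r => Real.sinh (M * (s + r)) / M) (Real.cosh (M * (s + r))) r := by
    intro r
    have h1 : HasDerivAt (fun r => M * (s + r)) M r := by
      simpa using ((hasDerivAt_id r).const_add s).const_mul M
    have h2 := (h1.sinh).div_const M
    rwa [mul_div_assoc, div_self hM.ne', mul_one] at h2
  rw [intervalIntegral.integral_eq_sub_of_hasDerivAt (fun r _ => h r)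
    (Continuous.intervalIntegrable (by fun_prop) _ _)]
  simp

theorem integral_sinh_shift {M : ℝ} (hM : 0 < M) (x y : ℝ) :
    ∫ s in -y..x, Real.sinh (M * (s + y)) / M = (Real.cosh (M * (x + y)) - 1) / M ^ 2 := by
  have h : ∀ s, HasDerivAt (fun s => Real.cosh (M * (s + y)) / M ^ 2)
      (Real.sinh (M * (s + y)) / M) s := by
    intro s
    have h1 : HasDerivAt (fun s => M * (s + y)) M s := by
      simpa using ((hasDerivAt_id s).add_const y).const_mul M
    have h2 := (h1.cosh).div_const (M ^ 2)
    have h3 : Real.sinh (M * (s + y)) * M / M ^ 2 = Real.sinh (M * (s + y)) / M := by field_simp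
    rwa [h3] at h2
  rw [intervalIntegral.integral_eq_sub_of_hasDerivAt (fun s _ => h s)
    (Continuous.intervalIntegrable (by fun_prop) _ _)]
  simp [sub_div]

/-- The growth of `triInt` measured with the weight `cosh (M (ξ + η))`. -/
theorem abs_triInt_le {F : ℝ × ℝ → ℝ} {M c : ℝ} (hM : 0 < M)
    (h : ∀ p : ℝ × ℝ, |F p| ≤ c * Real.cosh (M * (p.1 + p.2))) (p : ℝ × ℝ) :
    |triInt F p| ≤ c / M ^ 2 * Real.cosh (M * (p.1 + p.2)) := by
  have hc : 0 ≤ c := by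
    have := (abs_nonneg _).trans (h (0, 0))
    simpa using this
  have h1 : ∀ s, |∫ r in -s..p.2, F (s, r)| ≤ c * (|Real.sinh (M * (s + p.2))| / M) := by
    intro s
    have h2 := intervalIntegral.norm_integral_le_abs_of_norm_le (μ := volume) (a := -s) (b := p.2)
      (f := fun r => F (s, r)) (g := fun r => c * Real.cosh (M * (s + r)))
      (ae_of_all _ fun r => h (s, r)) (Continuous.intervalIntegrable (by fun_prop) _ _)
    rw [intervalIntegral.integral_const_mul, integral_cosh_shift hM, abs_mul, abs_div,
      abs_of_nonneg hc, abs_of_pos hM] at h2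
    exact h2
  have h3 : |triInt F p| ≤ |∫ s in -p.2..p.1, c * (|Real.sinh (M * (s + p.2))| / M)| := by
    exact intervalIntegral.norm_integral_le_abs_of_norm_le (μ := volume) (a := -p.2) (b := p.1)
      (f := fun s => ∫ r in -s..p.2, F (s, r))
      (g := fun s => c * (|Real.sinh (M * (s + p.2))| / M)) (ae_of_all _ fun s => h1 s)
      (Continuous.intervalIntegrable (by fun_prop) _ _)
  -- The sign of sinh is constant between -η and ξ, whichever is larger, so the absolute value moves
  -- outside. Both signs of the time variable are treated at once, which is why the weight is the
  -- even function cosh.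
  have h4 : |∫ s in -p.2..p.1, c * (|Real.sinh (M * (s + p.2))| / M)| =
      c * |∫ s in -p.2..p.1, Real.sinh (M * (s + p.2)) / M| := by
    rw [intervalIntegral.integral_const_mul, abs_mul, abs_of_nonneg hc]
    congr 1
    rcases le_total (-p.2) p.1 with hle | hle
    · congr 1
      refine intervalIntegral.integral_congr fun s hs => ?_
      rw [uIcc_of_le hle] at hs
      rw [abs_of_nonneg (Real.sinh_nonneg_iff.2 (mul_nonneg hM.le (by linarith [hs.1])))]
    · rw [← abs_neg, ← intervalIntegral.integral_neg]
      congr 1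
      refine intervalIntegral.integral_congr fun s hs => ?_
      rw [uIcc_of_ge hle] at hs
      rw [abs_of_nonpos (Real.sinh_nonpos_iff.2
        (mul_nonpos_of_nonneg_of_nonpos hM.le (by linarith [hs.2])))]
      ring
  have h5 : 0 ≤ Real.cosh (M * (p.1 + p.2)) - 1 := by
    linarith [Real.one_le_cosh (M * (p.1 + p.2))]
  rw [h4, integral_sinh_shift hM, abs_of_nonneg (div_nonneg h5 (by positivity))] at h3
  refine h3.trans ?_
  rw [div_mul_eq_mul_div, mul_div_assoc]
  gcongr
  linarith

/-! ### The one-dimensional wave equation with a potential -/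

/-- Banach's fixed point theorem for W = U / cosh(M(ξ+η)) in the bounded continuous functions.
Integration over the triangle gains M⁻² in this weighted norm, so a coefficient of size at most M²/4
gives a contraction with ratio 1/4, globally in time. -/
theorem exists_volterra_continuous {κ U₀ : ℝ × ℝ → ℝ} {M R : ℝ} (hM : 0 < M)
    (hκ : Continuous κ) (hκM : ∀ p, |κ p| ≤ M ^ 2 / 4) (hU₀ : Continuous U₀)
    (hR : ∀ p, |U₀ p| ≤ R) :
    ∃ U : ℝ × ℝ → ℝ, Continuous U ∧ ∀ p, U p = U₀ p + triInt (fun q => κ q * U q) p := by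
  set w : ℝ × ℝ → ℝ := fun p => Real.cosh (M * (p.1 + p.2)) with hw
  have hwc : Continuous w := by fun_prop
  have hw1 : ∀ p, 1 ≤ w p := fun p => Real.one_le_cosh _
  have hw0 : ∀ p, 0 < w p := fun p => lt_of_lt_of_le one_pos (hw1 p)
  set F : BoundedContinuousFunction (ℝ × ℝ) ℝ → ℝ × ℝ → ℝ := fun W q => κ q * (w q * W q) with hF
  have hFc : ∀ W, Continuous (F W) := fun W => hκ.mul (hwc.mul W.continuous)
  have htc : ∀ W, Continuous (triInt (F W)) := fun W =>
    continuous_iff_continuousAt.2 fun p => (hasFDerivAt_triInt (hFc W) p).continuousAt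
  have hest : ∀ (G : ℝ × ℝ → ℝ) (d : ℝ), (∀ q, |G q| ≤ d) → ∀ p,
      |triInt (fun q => κ q * (w q * G q)) p| ≤ d / 4 * w p := by
    intro G d hG p
    have h1 : ∀ q : ℝ × ℝ, |κ q * (w q * G q)| ≤
        (M ^ 2 / 4 * d) * Real.cosh (M * (q.1 + q.2)) := by
      intro q
      rw [abs_mul, abs_mul, abs_of_pos (hw0 q)]
      calc |κ q| * (w q * |G q|) ≤ (M ^ 2 / 4) * (w q * d) :=
            mul_le_mul (hκM q) (mul_le_mul_of_nonneg_left (hG q) (hw0 q).le)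
              (mul_nonneg (hw0 q).le (abs_nonneg _)) (by positivity)
        _ = _ := by rw [hw]; ring
    refine (abs_triInt_le hM h1 p).trans (le_of_eq ?_)
    rw [hw]
    field_simp
  have hb : ∀ W p, ‖(U₀ p + triInt (F W) p) / w p‖ ≤ R + ‖W‖ / 4 := by
    intro W p
    rw [Real.norm_eq_abs, abs_div, abs_of_pos (hw0 p), div_le_iff₀ (hw0 p)]
    have h1 := hest W ‖W‖ (fun q => W.norm_coe_le_norm q) p
    have h2 : R ≤ R * w p := le_mul_of_one_le_right ((abs_nonneg _).trans (hR p)) (hw1 p)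
    calc |U₀ p + triInt (F W) p| ≤ |U₀ p| + |triInt (F W) p| := abs_add_le _ _
      _ ≤ R + ‖W‖ / 4 * w p := add_le_add (hR p) h1
      _ ≤ _ := by linarith
  set T : BoundedContinuousFunction (ℝ × ℝ) ℝ → BoundedContinuousFunction (ℝ × ℝ) ℝ := fun W =>
    BoundedContinuousFunction.ofNormedAddCommGroup (fun p => (U₀ p + triInt (F W) p) / w p)
      ((hU₀.add (htc W)).div hwc fun p => (hw0 p).ne') _ (hb W) with hT
  have hcontr : ContractingWith (1 / 4) T := by
    refine ⟨by rw [← NNReal.coe_lt_coe]; norm_num, LipschitzWith.of_dist_le_mul fun W V => ?_⟩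
    rw [BoundedContinuousFunction.dist_le (by positivity)]
    intro p
    have h1 : T W p - T V p = triInt (fun q => κ q * (w q * (W q - V q))) p / w p := by
      have h2 := triInt_sub (hFc W) (hFc V) p
      have h3 : (fun q => F W q - F V q) = fun q => κ q * (w q * (W q - V q)) := by
        funext q; rw [hF]; ring
      rw [h3] at h2
      rw [h2, hT]
      simp only [BoundedContinuousFunction.coe_ofNormedAddCommGroup]
      ring
    rw [Real.dist_eq, h1, abs_div, abs_of_pos (hw0 p), div_le_iff₀ (hw0 p)]
    refine (hest (fun q => W q - V q) (dist W V) (fun q => ?_) p).trans (le_of_eq ?_)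
    · rw [← Real.dist_eq]; exact BoundedContinuousFunction.dist_coe_le_dist q
    · push_cast; ring
  obtain ⟨W, hW⟩ : ∃ W, T W = W := ⟨_, hcontr.fixedPoint_isFixedPt⟩
  refine ⟨fun p => w p * W p, hwc.mul W.continuous, fun p => ?_⟩
  have h1 : T W p = W p := by rw [hW]
  have h2 : T W p = (U₀ p + triInt (F W) p) / w p := rfl
  rw [h2, div_eq_iff (hw0 p).ne'] at h1
  change w p * W p = U₀ p + triInt (F W) p
  rw [mul_comm, h1]

theorem contDiff_of_volterra {κ U₀ U : ℝ × ℝ → ℝ} (hκ : ContDiff ℝ ∞ κ) (hU₀ : ContDiff ℝ ∞ U₀)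
    (hU : Continuous U) (h : ∀ p, U p = U₀ p + triInt (fun q => κ q * U q) p) (k : ℕ) :
    ContDiff ℝ k U := by
  induction k with
  | zero => rw [CharP.cast_eq_zero, contDiff_zero]; exact hU
  | succ k ih =>
    rw [funext h]
    exact (hU₀.of_le (by exact_mod_cast le_top)).add
      (contDiff_triInt ((hκ.of_le (by exact_mod_cast le_top)).mul ih))

/-- In the coordinates ξ = t + x, η = t - x the equation u_tt = u_xx - q u reads U_{ξη} = -(q/4) U.
With zero initial velocity it integrates to d'Alembert's half sum plus a triangle integral, which
vanishes on ξ + η = 0. -/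
theorem exists_wave_one_dim {q φ : ℝ → ℝ} {Q R : ℝ} (hq : ContDiff ℝ ∞ q) (hφ : ContDiff ℝ ∞ φ)
    (hQ : ∀ x, |q x| ≤ Q) (hR : ∀ x, |φ x| ≤ R) :
    ∃ u ut ux : ℝ × ℝ → ℝ, ∃ uxx : ℝ × ℝ → ℝ, ContDiff ℝ ∞ u ∧ (∀ x, u (0, x) = φ x) ∧
      (∀ x, ut (0, x) = 0) ∧
      (∀ t x, HasDerivAt (fun t => u (t, x)) (ut (t, x)) t) ∧
      (∀ t x, HasDerivAt (fun x => u (t, x)) (ux (t, x)) x) ∧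
      (∀ t x, HasDerivAt (fun x => ux (t, x)) (uxx (t, x)) x) ∧
      (∀ t x, HasDerivAt (fun t => ut (t, x)) (uxx (t, x) - q x * u (t, x)) t) := by
  -- The maximum with 1 only serves to make M = √Q' positive.
  set Q' := max Q 1 with hQ'
  have hQ0 : 0 < Q' := lt_of_lt_of_le one_pos (le_max_right _ _)
  set κ : ℝ × ℝ → ℝ := fun p => -(1 / 4) * q ((p.1 - p.2) / 2) with hκ
  set U₀ : ℝ × ℝ → ℝ := fun p => (φ p.1 + φ (-p.2)) / 2 with hU₀
  have hκs : ContDiff ℝ ∞ κ := contDiff_const.mul (hq.comp (by fun_prop))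
  have hU₀s : ContDiff ℝ ∞ U₀ :=
    ((hφ.comp contDiff_fst).add (hφ.comp contDiff_snd.neg)).div_const _
  obtain ⟨U, hUc, hU⟩ := exists_volterra_continuous (κ := κ) (U₀ := U₀) (M := √Q') (R := R)
    (Real.sqrt_pos.2 hQ0) hκs.continuous (fun p => by
      rw [Real.sq_sqrt hQ0.le, hκ, abs_mul]
      have := (hQ ((p.1 - p.2) / 2)).trans (le_max_left Q 1)
      norm_num
      linarith) hU₀s.continuous (fun p => by
      rw [hU₀, abs_le]
      have h1 := abs_le.1 (hR p.1)
      have h2 := abs_le.1 (hR (-p.2))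
      constructor <;> simp only <;> linarith)
  have hUk := contDiff_of_volterra hκs hU₀s hUc hU
  set F : ℝ × ℝ → ℝ := fun p => κ p * U p with hF
  have hFk : ∀ k : ℕ, ContDiff ℝ k F := fun k =>
    (hκs.of_le (by exact_mod_cast le_top)).mul (hUk k)
  have hφd : ∀ x, HasDerivAt φ (deriv φ x) x := fun x =>
    ((hφ.differentiable (by simp)) x).hasDerivAt
  have hφ' : ContDiff ℝ 1 (deriv φ) :=
    ((contDiff_infty_iff_deriv.1 hφ).2).of_le (by exact_mod_cast le_top)
  -- A and B are U_ξ and U_η, so u_t = A + B and u_x = A - B, and both mixed derivatives A_η and B_ξ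
  -- equal F.
  set A : ℝ × ℝ → ℝ := fun p => deriv φ p.1 / 2 + ∫ r in -p.1..p.2, F (p.1, r) with hA
  set B : ℝ × ℝ → ℝ := fun p => -deriv φ (-p.2) / 2 + ∫ s in -p.2..p.1, F (s, p.2) with hB
  have hAk : ContDiff ℝ 1 A := ((hφ'.comp contDiff_fst).div_const _).add
    (by exact_mod_cast contDiff_char_fst (hFk 1))
  have hBk : ContDiff ℝ 1 B := ((hφ'.comp contDiff_snd.neg).neg.div_const _).add
    (by exact_mod_cast contDiff_char_snd (hFk 1))
  have hUD : ∀ p, HasFDerivAt U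
      (A p • ContinuousLinearMap.fst ℝ ℝ ℝ + B p • ContinuousLinearMap.snd ℝ ℝ ℝ) p := by
    intro p
    have hn : HasFDerivAt (fun p : ℝ × ℝ => -p.2) (-ContinuousLinearMap.snd ℝ ℝ ℝ) p :=
      hasFDerivAt_snd.neg
    have h1 : HasFDerivAt U₀ _ p :=
      (((hφd p.1).comp_hasFDerivAt p hasFDerivAt_fst).add
        ((hφd (-p.2)).comp_hasFDerivAt p hn)).mul_const (2⁻¹)
    have h2 := h1.add (hasFDerivAt_triInt (hFk 0).continuous p)
    have h3 : U = fun p => U₀ p + triInt F p := funext hU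
    rw [h3]
    refine h2.congr_fderiv ?_
    ext
    · simp [hA]; ring
    · simp [hB]; ring
  have hAη : ∀ p, fderiv ℝ A p (0, 1) = F p := by
    intro p
    have h1 : HasDerivAt (fun y : ℝ => (p.1, y)) ((0 : ℝ), (1 : ℝ)) p.2 :=
      (hasDerivAt_const _ _).prodMk (hasDerivAt_id _)
    have h2 := ((hAk.differentiable (by norm_num)) p).hasFDerivAt.comp_hasDerivAt p.2 h1
    have hc : Continuous fun r => F (p.1, r) := (hFk 0).continuous.comp (by fun_prop)
    have h3 : HasDerivAt (fun y => A (p.1, y)) (F p) p.2 :=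
      (intervalIntegral.integral_hasDerivAt_right (a := -p.1) (b := p.2) (hc.intervalIntegrable _ _)
        (hc.stronglyMeasurableAtFilter _ _) hc.continuousAt).const_add (deriv φ p.1 / 2)
    exact h2.unique h3
  have hBξ : ∀ p, fderiv ℝ B p (1, 0) = F p := by
    intro p
    have h1 : HasDerivAt (fun y : ℝ => (y, p.2)) ((1 : ℝ), (0 : ℝ)) p.1 :=
      (hasDerivAt_id _).prodMk (hasDerivAt_const _ _)
    have h2 := ((hBk.differentiable (by norm_num)) p).hasFDerivAt.comp_hasDerivAt p.1 h1
    have hc : Continuous fun r => F (r, p.2) := (hFk 0).continuous.comp (by fun_prop)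
    have h3 : HasDerivAt (fun y => B (y, p.2)) (F p) p.1 :=
      (intervalIntegral.integral_hasDerivAt_right (a := -p.2) (b := p.1) (hc.intervalIntegrable _ _)
        (hc.stronglyMeasurableAtFilter _ _) hc.continuousAt).const_add (-deriv φ (-p.2) / 2)
    exact h2.unique h3
  have hlt : ∀ t x : ℝ, HasDerivAt (fun t => (t + x, t - x)) ((1 : ℝ), (1 : ℝ)) t := fun t x =>
    ((hasDerivAt_id t).add_const x).prodMk ((hasDerivAt_id t).sub_const x)
  have hlx : ∀ t x : ℝ, HasDerivAt (fun x => (t + x, t - x)) ((1 : ℝ), (-1 : ℝ)) x := fun t x =>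
    ((hasDerivAt_id x).const_add t).prodMk ((hasDerivAt_id x).const_sub t)
  have hdA := fun p => ((hAk.differentiable (by norm_num)) p).hasFDerivAt
  have hdB := fun p => ((hBk.differentiable (by norm_num)) p).hasFDerivAt
  refine ⟨fun p => U (p.1 + p.2, p.1 - p.2),
    fun p => A (p.1 + p.2, p.1 - p.2) + B (p.1 + p.2, p.1 - p.2),
    fun p => A (p.1 + p.2, p.1 - p.2) - B (p.1 + p.2, p.1 - p.2),
    fun p => fderiv ℝ A (p.1 + p.2, p.1 - p.2) (1, -1) - fderiv ℝ B (p.1 + p.2, p.1 - p.2) (1, -1),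
    ?_, ?_, ?_, ?_, ?_, ?_, ?_⟩
  · exact (contDiff_infty.2 hUk).comp (by fun_prop)
  · intro x
    simp only [hU, triInt, hU₀]
    simp
  · intro x
    simp [hA, hB]
    ring
  · intro t x
    have := (hUD (t + x, t - x)).comp_hasDerivAt t (hlt t x)
    simpa using! this
  · intro t x
    have := (hUD (t + x, t - x)).comp_hasDerivAt x (hlx t x)
    simpa [sub_eq_add_neg] using! this
  · intro t x
    exact ((hdA (t + x, t - x)).comp_hasDerivAt x (hlx t x)).sub
      ((hdB (t + x, t - x)).comp_hasDerivAt x (hlx t x))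
  · intro t x
    have h1 := ((hdA (t + x, t - x)).comp_hasDerivAt t (hlt t x)).add
      ((hdB (t + x, t - x)).comp_hasDerivAt t (hlt t x))
    have e1 : ((1 : ℝ), (1 : ℝ)) = (1, 0) + (0, 1) := by simp
    have e2 : ((1 : ℝ), (-1 : ℝ)) = (1, 0) - (0, 1) := by simp
    have e3 : F (t + x, t - x) = -(1 / 4) * q x * U (t + x, t - x) := by
      simp only [hF, hκ]
      congr 3
      ring
    refine h1.congr_deriv ?_
    simp only
    rw [e1, e2]
    simp only [map_add, map_sub, hAη, hBξ, e3]
    ring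

/-! ### The warping function -/

theorem warp_base_pos (m : ℕ) (x : ℝ) : 0 < x ^ (2 * m) + 1 := by
  have : 0 ≤ x ^ (2 * m) := by rw [pow_mul]; positivity
  linarith

theorem one_le_warp_base (m : ℕ) (x : ℝ) : 1 ≤ x ^ (2 * m) + 1 := by
  have : 0 ≤ x ^ (2 * m) := by rw [pow_mul]; positivity
  linarith

theorem one_le_warp (m : ℕ) (x : ℝ) : 1 ≤ warp m x :=
  Real.one_le_rpow (one_le_warp_base m x) (by positivity)

theorem warp_pos (m : ℕ) (x : ℝ) : 0 < warp m x := lt_of_lt_of_le one_pos (one_le_warp m x)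

theorem one_le_warp_sq (m : ℕ) (x : ℝ) : 1 ≤ warp m x ^ 2 := one_le_pow₀ (one_le_warp m x)

theorem warp_sq_le {m : ℕ} (hm : 1 ≤ m) (x : ℝ) : warp m x ^ 2 ≤ 1 + x ^ (2 * m) := by
  have hm' : (1 : ℝ) ≤ m := by exact_mod_cast hm
  rw [warp, ← Real.rpow_natCast, ← Real.rpow_mul (warp_base_pos m x).le, add_comm 1]
  conv_rhs => rw [← Real.rpow_one (x ^ (2 * m) + 1)]
  refine Real.rpow_le_rpow_of_exponent_le (one_le_warp_base m x) ?_
  rw [div_mul_eq_mul_div, div_le_one (by positivity)]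
  push_cast
  linarith

theorem warp_sq_le_two {m : ℕ} (hm : 1 ≤ m) {x : ℝ} (hx : |x| ≤ 1) : warp m x ^ 2 ≤ 2 := by
  have h1 := warp_sq_le hm x
  have h2 : x ^ (2 * m) ≤ 1 := by
    rw [pow_mul]
    exact pow_le_one₀ (sq_nonneg x) ((sq_le_one_iff_abs_le_one x).2 hx)
  linarith

theorem contDiff_warp {n : ℕ∞ω} (m : ℕ) : ContDiff ℝ n (warp m) :=
  ContDiff.rpow_const_of_ne (by fun_prop) fun x => (warp_base_pos m x).ne'

/-- After the substitution v = u/a the quotient a''/a appears as a potential, and the Volterra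
argument needs it bounded. -/
theorem exists_warp_second_deriv {m : ℕ} (hm : 1 ≤ m) : ∃ a' a'' : ℝ → ℝ, ∃ Q : ℝ,
    (∀ x, HasDerivAt (warp m) (a' x) x) ∧ (∀ x, HasDerivAt a' (a'' x) x) ∧
    ContDiff ℝ ∞ a'' ∧ ∀ x, |a'' x / warp m x| ≤ Q := by
  have hm0 : (0 : ℝ) < m := by exact_mod_cast hm
  set p : ℝ := 1 / (2 * (m : ℝ)) with hp
  have hb : ∀ (r x : ℝ), HasDerivAt (fun x : ℝ => (x ^ (2 * m) + 1) ^ r)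
      (((2 * m : ℕ) : ℝ) * x ^ (2 * m - 1) * r * (x ^ (2 * m) + 1) ^ (r - 1)) x := fun r x =>
    ((hasDerivAt_pow (2 * m) x).add_const 1).rpow_const (Or.inl (warp_base_pos m x).ne')
  have hp2 : (2 * m : ℝ) * p = 1 := by rw [hp]; field_simp
  have h1 : ∀ x, HasDerivAt (warp m) (x ^ (2 * m - 1) * (x ^ (2 * m) + 1) ^ (p - 1)) x := by
    intro x
    refine (hb p x).congr_deriv ?_
    push_cast
    linear_combination (x ^ (2 * m - 1) * (x ^ (2 * m) + 1) ^ (p - 1)) * hp2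
  refine ⟨_, fun x => ((2 * m - 1 : ℕ) : ℝ) * x ^ (2 * m - 1 - 1) * (x ^ (2 * m) + 1) ^ (p - 1) +
    x ^ (2 * m - 1) *
      (((2 * m : ℕ) : ℝ) * x ^ (2 * m - 1) * (p - 1) * (x ^ (2 * m) + 1) ^ (p - 1 - 1)),
    ((2 * m - 1 : ℕ) : ℝ) + 2 * m, h1, fun x => (hasDerivAt_pow (2 * m - 1) x).mul (hb (p - 1) x),
    ?_, ?_⟩
  · have hr : ∀ r : ℝ, ContDiff ℝ ∞ fun x : ℝ => (x ^ (2 * m) + 1) ^ r := fun r =>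
      ContDiff.rpow_const_of_ne (by fun_prop) fun x => (warp_base_pos m x).ne'
    have h2 := hr (p - 1)
    have h3 := hr (p - 1 - 1)
    fun_prop
  · intro x
    set b := x ^ (2 * m) + 1 with hbdef
    have hb0 : 0 < b := warp_base_pos m x
    have hb1 : 1 ≤ b := one_le_warp_base m x
    have e1 : b ^ (p - 1) = warp m x / b := by
      rw [Real.rpow_sub hb0, Real.rpow_one]; rfl
    have e2 : b ^ (p - 1 - 1) = warp m x / b / b := by
      rw [Real.rpow_sub hb0, e1, Real.rpow_one]
    simp only [← hbdef, e1, e2]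
    have hw := warp_pos m x
    obtain ⟨k, rfl⟩ : ∃ k, m = k + 1 := ⟨m - 1, by omega⟩
    have i1 : 2 * (k + 1) - 1 - 1 = 2 * k := by omega
    have hxk : 0 ≤ x ^ (2 * k) := by rw [pow_mul]; positivity
    -- Here 2k = 2m - 2: for x² ≤ 1 the left side is at most 1, otherwise it is at most x^{2m}.
    have hle : x ^ (2 * k) ≤ b := by
      rw [hbdef, show 2 * (k + 1) = 2 * k + 2 by ring, pow_add]
      rcases le_total (x ^ 2) 1 with h | h
      · have : x ^ (2 * k) ≤ 1 := by rw [pow_mul]; exact pow_le_one₀ (sq_nonneg x) h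
        nlinarith [mul_nonneg hxk (sq_nonneg x)]
      · nlinarith
    have hsq : x ^ (2 * (k + 1) - 1) * x ^ (2 * (k + 1) - 1) ≤ b * b := by
      have e3 : x ^ (2 * (k + 1) - 1) * x ^ (2 * (k + 1) - 1) =
          x ^ (2 * k) * x ^ (2 * (k + 1)) := by
        rw [← pow_add, ← pow_add]; congr 1; omega
      rw [e3]
      refine mul_le_mul hle (by rw [hbdef]; linarith) ?_ hb0.le
      rw [pow_mul]; positivity
    have hp01 : |p - 1| ≤ 1 := by
      rw [abs_le]
      have hp0 : 0 ≤ p := by positivity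
      have hp1 : p ≤ 1 := by
        rw [hp, div_le_one (by positivity)]
        push_cast
        linarith [(Nat.cast_nonneg k : (0 : ℝ) ≤ k)]
      constructor <;> linarith
    rw [i1]
    have e4 : (((2 * (k + 1) - 1 : ℕ) : ℝ) * x ^ (2 * k) * (warp (k + 1) x / b) +
        x ^ (2 * (k + 1) - 1) * (((2 * (k + 1) : ℕ) : ℝ) * x ^ (2 * (k + 1) - 1) * (p - 1) *
          (warp (k + 1) x / b / b))) / warp (k + 1) x =
        ((2 * (k + 1) - 1 : ℕ) : ℝ) * (x ^ (2 * k) / b) +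
        (2 * (k + 1)) * (x ^ (2 * (k + 1) - 1) * x ^ (2 * (k + 1) - 1) / (b * b)) * (p - 1) := by
      push_cast
      field_simp
    rw [e4]
    refine (abs_add_le _ _).trans (add_le_add ?_ ?_)
    · rw [abs_mul, abs_of_nonneg (Nat.cast_nonneg _), abs_of_nonneg (by positivity)]
      exact mul_le_of_le_one_right (Nat.cast_nonneg _) ((div_le_one hb0).2 hle)
    · rw [abs_mul, abs_mul, abs_of_nonneg (by positivity : (0 : ℝ) ≤ 2 * (k + 1)),
        abs_of_nonneg (div_nonneg (mul_self_nonneg _) (by positivity))]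
      have : x ^ (2 * (k + 1) - 1) * x ^ (2 * (k + 1) - 1) / (b * b) ≤ 1 :=
        (div_le_one (by positivity)).2 hsq
      push_cast
      calc _ ≤ 2 * ((k : ℝ) + 1) * 1 * 1 := by gcongr
        _ = _ := by ring

/-! ### Separated solutions of the wave equation -/

/-- Since a⁻² ∂_x (a² ∂_x (u/a)) = (u_xx - (a''/a) u)/a, the function (u/a) Y solves the wave
equation as soon as u solves the one-dimensional equation with potential a''/a + ℓ(ℓ+1)/a². -/
theorem exists_isWaveSolution {m : ℕ} (hm : 1 ≤ m) {ℓ : ℕ} {Y : S2 → ℝ}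
    (hY : IsSphericalHarmonic ℓ Y) {φ : ℝ → ℝ} (hφ : ContDiff ℝ ∞ φ)
    (hφc : HasCompactSupport φ) :
    ∃ v : ℝ × ℝ → ℝ, (∀ x, v (0, x) = φ x) ∧ (∀ x, HasDerivAt (fun t => v (t, x)) 0 0) ∧
      IsWaveSolution m ∞ (fun x θ => φ x * Y θ) (fun _ _ => 0) (fun t x θ => v (t, x) * Y θ) := by
  obtain ⟨a', a'', Q, ha', ha'', hsmooth, hQ⟩ := exists_warp_second_deriv hm
  have hw0 : ∀ x, warp m x ≠ 0 := fun x => (warp_pos m x).ne'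
  set lam : ℝ := (ℓ : ℝ) * (ℓ + 1) with hlam
  have hlam0 : 0 ≤ lam := by positivity
  have hq : ContDiff ℝ ∞ fun x => a'' x / warp m x + lam / warp m x ^ 2 :=
    (hsmooth.div (contDiff_warp m) hw0).add
      (contDiff_const.div ((contDiff_warp m).pow 2) fun x => pow_ne_zero 2 (hw0 x))
  have haφ : ContDiff ℝ ∞ fun x => warp m x * φ x := (contDiff_warp m).mul hφ
  obtain ⟨R, hR⟩ := (hφc.mul_left (f := warp m)).exists_bound_of_continuous haφ.continuous
  obtain ⟨u, ut, ux, uxx, hu, hu0, hut0, hut, hux, huxx, hutt⟩ :=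
    exists_wave_one_dim (Q := Q + lam) (R := R) hq haφ (fun x => by
      refine (abs_add_le _ _).trans (add_le_add (hQ x) ?_)
      rw [abs_of_nonneg (div_nonneg hlam0 (sq_nonneg _))]
      exact div_le_self hlam0 (one_le_warp_sq m x)) (fun x => hR x)
  refine ⟨fun p => u p / warp m p.2, fun x => ?_, fun x => ?_, ?_, ?_, ?_, ?_⟩
  · simp only [hu0]
    field_simp [hw0 x]
  · have := (hut 0 x).div_const (warp m x)
    rwa [hut0, zero_div] at this
  · have h1 : ContDiff ℝ ∞ fun p : ℝ × ℝ => u p / warp m p.2 :=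
      hu.div ((contDiff_warp m).comp contDiff_snd) fun p => hw0 p.2
    have h2 : ContMDiff (𝓘(ℝ, ℝ).prod (𝓘(ℝ, ℝ).prod (𝓡 2))) 𝓘(ℝ, ℝ × ℝ) ∞
        (fun p : ℝ × ℝ × S2 => (p.1, p.2.1)) :=
      contMDiff_fst.prodMk_space (contMDiff_fst.comp contMDiff_snd)
    exact (h1.contMDiff.comp h2).mul (hY.1.comp (contMDiff_snd.comp contMDiff_snd))
  · intro t x θ
    have e1 : deriv (fun t' => deriv (fun t'' => u (t'', x) / warp m x * Y θ) t') t =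
        (uxx (t, x) - (a'' x / warp m x + lam / warp m x ^ 2) * u (t, x)) / warp m x * Y θ := by
      have h1 : (fun t' => deriv (fun t'' => u (t'', x) / warp m x * Y θ) t') =
          fun t' => ut (t', x) / warp m x * Y θ := by
        funext t'
        exact (((hut t' x).div_const _).mul_const _).deriv
      rw [h1]
      exact (((hutt t x).div_const _).mul_const _).deriv
    have e2 : deriv (fun x' => warp m x' ^ 2 * deriv (fun x'' => u (t, x'') / warp m x'' * Y θ) x')
        x = (warp m x * uxx (t, x) - a'' x * u (t, x)) * Y θ := by
      have h1 : (fun x' => warp m x' ^ 2 * deriv (fun x'' => u (t, x'') / warp m x'' * Y θ) x') =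
          fun x' => (warp m x' * ux (t, x') - a' x' * u (t, x')) * Y θ := by
        funext x'
        have h2 : deriv (fun x'' => u (t, x'') / warp m x'' * Y θ) x' = _ :=
          (((hux t x').div (ha' x') (hw0 x')).mul_const (Y θ)).deriv
        rw [h2]
        have := hw0 x'
        field_simp
      rw [h1]
      have h2 := ((((ha' x).mul (huxx t x)).sub ((ha'' x).mul (hux t x))).mul_const (Y θ)).deriv
      refine Eq.trans h2 ?_
      ring
    have e3 : sphLaplacian (fun θ => u (t, x) / warp m x * Y θ) θ =
        u (t, x) / warp m x * (-lam * Y θ) := by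
      rw [sphLaplacian_smul _ hY.contMDiff_two, hY.2]
    rw [box, e1, e2, e3]
    have := hw0 x
    field_simp
    ring
  · intro x θ
    simp only [hu0]
    field_simp [hw0 x]
  · intro x θ
    have := ((hut 0 x).div_const (warp m x)).mul_const (Y θ)
    simpa [hut0] using this.deriv

/-! ### Integration against `dV` -/

theorem lintegral_volM (m : ℕ) {f : ℝ × S2 → ENNReal} (hf : Measurable f) :
    ∫⁻ p, f p ∂(volM m) =
      ∫⁻ p : ℝ × S2, ENNReal.ofReal (warp m p.1 ^ 2) * f p ∂((volume : Measure ℝ).prod sigma) := by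
  have hw : Measurable fun x => ENNReal.ofReal (warp m x ^ 2) :=
    (((contDiff_warp (n := 0) m).continuous).pow 2).measurable.ennreal_ofReal
  rw [volM, prod_withDensity_left hw, lintegral_withDensity_eq_lintegral_mul _
    (f := fun z : ℝ × S2 => ENNReal.ofReal (warp m z.1 ^ 2)) (hw.comp measurable_fst) hf]
  rfl

/-- Separation of variables in a nonnegative integral over `ℝ × S²`. -/
theorem lintegral_ofReal_mul {f : ℝ → ℝ} {k : S2 → ℝ} (hf : Integrable f) (hf0 : ∀ x, 0 ≤ f x)
    (hk : Continuous k) (hk0 : ∀ θ, 0 ≤ k θ) :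
    ∫⁻ p : ℝ × S2, ENNReal.ofReal (f p.1 * k p.2) ∂((volume : Measure ℝ).prod sigma) =
      ENNReal.ofReal ((∫ x, f x) * ∫ θ, k θ ∂sigma) := by
  rw [← integral_prod_mul, ofReal_integral_eq_lintegral_ofReal]
  · exact hf.mul_prod (integrable_sigma hk)
  · exact ae_of_all _ fun p => mul_nonneg (hf0 _) (hk0 _)

/-! ### Cauchy–Schwarz and the forced oscillator -/

/-- The polynomial t ↦ ∫ ‖tF + G‖² is nonnegative, so its discriminant is not positive. -/
theorem sq_integral_inner_le {X E : Type*} [MeasurableSpace X] {ν : Measure X}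
    [NormedAddCommGroup E] [InnerProductSpace ℝ E] {F G : X → E}
    (hFG : Integrable (fun x => inner ℝ (F x) (G x)) ν) (hF : Integrable (fun x => ‖F x‖ ^ 2) ν)
    (hG : Integrable (fun x => ‖G x‖ ^ 2) ν) :
    (∫ x, inner ℝ (F x) (G x) ∂ν) ^ 2 ≤ (∫ x, ‖F x‖ ^ 2 ∂ν) * ∫ x, ‖G x‖ ^ 2 ∂ν := by
  have h : ∀ t : ℝ, 0 ≤ (∫ x, ‖F x‖ ^ 2 ∂ν) * (t * t) + (2 * ∫ x, inner ℝ (F x) (G x) ∂ν) * t +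
      ∫ x, ‖G x‖ ^ 2 ∂ν := by
    intro t
    have h1 : ∫ x, ‖t • F x + G x‖ ^ 2 ∂ν = (∫ x, ‖F x‖ ^ 2 ∂ν) * (t * t) +
        (2 * ∫ x, inner ℝ (F x) (G x) ∂ν) * t + ∫ x, ‖G x‖ ^ 2 ∂ν := by
      have h2 : ∀ x, ‖t • F x + G x‖ ^ 2 =
          t * t * ‖F x‖ ^ 2 + 2 * t * inner ℝ (F x) (G x) + ‖G x‖ ^ 2 := by
        intro x
        rw [norm_add_sq_real, norm_smul, inner_smul_left, mul_pow, Real.norm_eq_abs, sq_abs]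
        simp only [conj_trivial]
        ring
      simp only [h2]
      have e1 : Integrable (fun x => t * t * ‖F x‖ ^ 2) ν := hF.const_mul _
      have e2 : Integrable (fun x => 2 * t * inner ℝ (F x) (G x)) ν := hFG.const_mul _
      rw [integral_add (f := fun x => t * t * ‖F x‖ ^ 2 + 2 * t * inner ℝ (F x) (G x))
        (e1.add e2) hG, integral_add e1 e2, integral_const_mul, integral_const_mul]
      ring
    rw [← h1]
    exact integral_nonneg fun x => sq_nonneg _
  have h3 := discrim_le_zero h
  rw [discrim] at h3
  nlinarith

theorem sq_intervalIntegral_le {f : ℝ → ℝ} (hf : Continuous f) {τ : ℝ} (hτ : 0 ≤ τ) :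
    (∫ s in (0 : ℝ)..τ, f s) ^ 2 ≤ τ * ∫ s in (0 : ℝ)..τ, f s ^ 2 := by
  have hi : ∀ {g : ℝ → ℝ}, Continuous g → Integrable g (volume.restrict (Ioc 0 τ)) := fun hg =>
    (hg.integrableOn_Icc).mono_set Ioc_subset_Icc_self
  have h := sq_integral_inner_le (ν := volume.restrict (Ioc 0 τ)) (F := fun _ : ℝ => (1 : ℝ))
    (G := f) (hi (by fun_prop)) (hi (by fun_prop)) (hi (by fun_prop))
  rw [intervalIntegral.integral_of_le hτ, intervalIntegral.integral_of_le hτ]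
  simpa [hτ] using h

/-- The forcing integrand sin(Ω(τ-s)) G(s) is the derivative in s of Ω cos(Ω(τ-s)) g(s) +
sin(Ω(τ-s)) g'(s). -/
theorem oscillator_duhamel {g g' G : ℝ → ℝ} {Ω : ℝ} (hΩ : Ω ≠ 0) (hG : Continuous G)
    (hg : ∀ t, HasDerivAt g (g' t) t) (hg' : ∀ t, HasDerivAt g' (-Ω ^ 2 * g t + G t) t)
    (h0 : g' 0 = 0) (τ : ℝ) :
    g τ - g 0 * Real.cos (Ω * τ) = Ω⁻¹ * ∫ s in (0 : ℝ)..τ, Real.sin (Ω * (τ - s)) * G s := by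
  have hd : ∀ s, HasDerivAt (fun s => Ω * (Real.cos (Ω * (τ - s)) * g s) +
      Real.sin (Ω * (τ - s)) * g' s) (Real.sin (Ω * (τ - s)) * G s) s := by
    intro s
    have h1 : HasDerivAt (fun s => Ω * (τ - s)) (-Ω) s := by
      simpa using ((hasDerivAt_id s).const_sub τ).const_mul Ω
    refine (((h1.cos.mul (hg s)).const_mul Ω).add (h1.sin.mul (hg' s))).congr_deriv ?_
    ring
  rw [intervalIntegral.integral_eq_sub_of_hasDerivAt (fun s _ => hd s)
    (Continuous.intervalIntegrable (by fun_prop) _ _)]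
  simp [h0]
  field_simp

/-- A forced oscillator whose position and forcing are both controlled by `H` cannot have
`∫ H` small. -/
theorem oscillator_lower_bound {g g' G H : ℝ → ℝ} {Ω A B T : ℝ} (hΩ : 0 < Ω) (hT : 0 < T)
    (hG : Continuous G) (hg : ∀ t, HasDerivAt g (g' t) t)
    (hg' : ∀ t, HasDerivAt g' (-Ω ^ 2 * g t + G t) t) (h0 : g' 0 = 0) (hH : Continuous H)
    (hA : ∀ t, g t ^ 2 ≤ A * H t) (hB : ∀ t, G t ^ 2 ≤ B * H t) :
    g 0 ^ 2 * ∫ t in (0 : ℝ)..T, Real.cos (Ω * t) ^ 2 ≤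
      2 * (A + T ^ 2 / Ω ^ 2 * B) * ∫ t in (0 : ℝ)..T, H t := by
  set K := ∫ t in (0 : ℝ)..T, H t with hK
  have hgc : Continuous g := continuous_iff_continuousAt.2 fun t => (hg t).continuousAt
  have hforce : ∫ s in (0 : ℝ)..T, G s ^ 2 ≤ B * K := by
    rw [hK, ← intervalIntegral.integral_const_mul]
    exact intervalIntegral.integral_mono_on hT.le ((hG.pow 2).intervalIntegrable _ _)
      ((hH.const_mul B).intervalIntegrable _ _) fun s _ => hB s
  -- Duhamel and Cauchy-Schwarz in time: the deviation from free oscillation is controlled by the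
  -- forcing, hence by K = ∫ H.
  have herr : ∀ τ ∈ Icc 0 T, (g τ - g 0 * Real.cos (Ω * τ)) ^ 2 ≤ T / Ω ^ 2 * (B * K) := by
    intro τ hτ
    rw [oscillator_duhamel hΩ.ne' hG hg hg' h0, mul_pow]
    have h1 := sq_intervalIntegral_le (f := fun s => Real.sin (Ω * (τ - s)) * G s)
      (by fun_prop) hτ.1
    have h2 : ∫ s in (0 : ℝ)..τ, (Real.sin (Ω * (τ - s)) * G s) ^ 2 ≤
        ∫ s in (0 : ℝ)..τ, G s ^ 2 := by
      refine intervalIntegral.integral_mono_on hτ.1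
        (Continuous.intervalIntegrable (by fun_prop) _ _)
        (Continuous.intervalIntegrable (by fun_prop) _ _) fun s _ => ?_
      rw [mul_pow]
      exact mul_le_of_le_one_left (sq_nonneg _) (Real.sin_sq_le_one _)
    have h3 : ∫ s in (0 : ℝ)..τ, G s ^ 2 ≤ ∫ s in (0 : ℝ)..T, G s ^ 2 :=
      intervalIntegral.integral_mono_interval le_rfl hτ.1 hτ.2
        (ae_of_all _ fun s => sq_nonneg _) ((hG.pow 2).intervalIntegrable _ _)
    have h4 : 0 ≤ ∫ s in (0 : ℝ)..τ, (Real.sin (Ω * (τ - s)) * G s) ^ 2 :=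
      intervalIntegral.integral_nonneg hτ.1 fun s _ => sq_nonneg _
    have h5 : (∫ s in (0 : ℝ)..τ, Real.sin (Ω * (τ - s)) * G s) ^ 2 ≤ T * (B * K) :=
      h1.trans (mul_le_mul hτ.2 (h2.trans (h3.trans hforce)) h4 hT.le)
    calc Ω⁻¹ ^ 2 * (∫ s in (0 : ℝ)..τ, Real.sin (Ω * (τ - s)) * G s) ^ 2
        ≤ Ω⁻¹ ^ 2 * (T * (B * K)) := mul_le_mul_of_nonneg_left h5 (by positivity)
      _ = _ := by field_simp
  -- The free oscillation is g minus the deviation, and (p - q)² ≤ 2p² + 2q².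
  have hpt : ∀ t ∈ Icc 0 T, g 0 ^ 2 * Real.cos (Ω * t) ^ 2 ≤
      2 * A * H t + 2 * (T / Ω ^ 2 * (B * K)) := by
    intro t ht
    have h1 := herr t ht
    have h2 := hA t
    nlinarith [sq_nonneg (g t + (g t - g 0 * Real.cos (Ω * t)))]
  rw [← intervalIntegral.integral_const_mul]
  calc _ ≤ ∫ t in (0 : ℝ)..T, (2 * A * H t + 2 * (T / Ω ^ 2 * (B * K))) :=
        intervalIntegral.integral_mono_on hT.le (Continuous.intervalIntegrable (by fun_prop) _ _)
          (Continuous.intervalIntegrable (by fun_prop) _ _) hpt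
    _ = _ := by
      rw [intervalIntegral.integral_add ((hH.const_mul _).intervalIntegrable _ _)
        intervalIntegrable_const, intervalIntegral.integral_const_mul,
        intervalIntegral.integral_const, ← hK]
      simp only [sub_zero, smul_eq_mul]
      ring

/-- The integral is T/2 up to an oscillating error of at most 1/(4Ω) ≤ T/4. -/
theorem le_integral_cos_sq {Ω T : ℝ} (hΩ : 0 < Ω) (h : 1 ≤ Ω * T) :
    T / 4 ≤ ∫ t in (0 : ℝ)..T, Real.cos (Ω * t) ^ 2 := by
  have hd : ∀ t, HasDerivAt (fun t => t / 2 + Real.sin (2 * Ω * t) / (4 * Ω))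
      (Real.cos (Ω * t) ^ 2) t := by
    intro t
    have h1 : HasDerivAt (fun t => 2 * Ω * t) (2 * Ω) t := by
      simpa using (hasDerivAt_id t).const_mul (2 * Ω)
    refine (((hasDerivAt_id t).div_const 2).add (h1.sin.div_const (4 * Ω))).congr_deriv ?_
    rw [mul_assoc 2 Ω t, Real.cos_two_mul]
    field_simp
    ring
  rw [intervalIntegral.integral_eq_sub_of_hasDerivAt (fun t _ => hd t)
    (Continuous.intervalIntegrable (by fun_prop) _ _)]
  have h2 : -(T / 4) ≤ Real.sin (2 * Ω * T) / (4 * Ω) := by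
    rw [le_div_iff₀ (by positivity)]
    linarith [Real.neg_one_le_sin (2 * Ω * T)]
  simp
  linarith

/-! ### The slab around the trapped set -/

/-- The measure `dx dσ` on `{|x| ≤ 3/8} × S²`. -/
def slab : Measure (ℝ × S2) := ((volume : Measure ℝ).restrict (Icc (-(3 / 8)) (3 / 8))).prod sigma

theorem slab_eq : slab =
    ((volume : Measure ℝ).prod sigma).restrict (Icc (-(3 / 8)) (3 / 8) ×ˢ (univ : Set S2)) := by
  rw [slab, ← Measure.prod_restrict, Measure.restrict_univ]

theorem isCompact_slab : IsCompact (Icc (-(3 / 8) : ℝ) (3 / 8) ×ˢ (univ : Set S2)) :=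
  isCompact_Icc.prod isCompact_univ

theorem measurableSet_slab : MeasurableSet (Icc (-(3 / 8) : ℝ) (3 / 8) ×ˢ (univ : Set S2)) :=
  measurableSet_Icc.prod MeasurableSet.univ

theorem integrable_slab {E : Type*} [NormedAddCommGroup E] {f : ℝ × S2 → E}
    (hf : Continuous f) : Integrable f slab := by
  rw [slab_eq]
  exact hf.continuousOn.integrableOn_compact isCompact_slab

section Pairing

variable {m ℓ : ℕ} {Y : S2 → ℝ} {u : ℝ → ℝ → S2 → ℝ}

/-- The angular Dirichlet energy in the slab at time `t`. -/
def slabEnergy (u : ℝ → ℝ → S2 → ℝ) (t : ℝ) : ℝ := ∫ p, ‖sphGrad (u t p.1) p.2‖ ^ 2 ∂slab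

theorem continuous_slabEnergy (hu : SmoothOnSpacetime 2 u) : Continuous (slabEnergy u) := by
  have h : Continuous (Function.uncurry fun (t : ℝ) (p : ℝ × S2) =>
      ‖sphGrad (u t p.1) p.2‖ ^ 2) := ((continuous_sphGrad hu).norm.pow 2)
  have := continuous_parametric_integral_of_continuous (μ := (volume : Measure ℝ).prod sigma) h
    isCompact_slab
  unfold slabEnergy
  rwa [slab_eq]

/-- The pairing of `u t` with `b Y` on the slab. -/
def slabPair (Y : S2 → ℝ) (u : ℝ → ℝ → S2 → ℝ) (b : ℝ → ℝ) (t : ℝ) : ℝ :=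
  ∫ p, b p.1 * (Y p.2 * u t p.1 p.2) ∂slab

theorem slab_integral_eq {b : ℝ → ℝ} {f : ℝ → S2 → ℝ} {F : ℝ → ℝ}
    (hc : Continuous fun p : ℝ × S2 => b p.1 * f p.1 p.2)
    (hF : ∀ x, ∫ θ, f x θ ∂sigma = F x) :
    ∫ p, b p.1 * f p.1 p.2 ∂slab = ∫ x in Icc (-(3 / 8) : ℝ) (3 / 8), b x * F x := by
  have h := integral_prod (fun p : ℝ × S2 => b p.1 * f p.1 p.2) (integrable_slab hc)
  refine h.trans (integral_congr_ae (ae_of_all _ fun x => ?_))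
  simp only [integral_const_mul, hF]

/-- Green's identity on each sphere turns ℓ(ℓ+1) times the pairing into an integral of b ∇Y · ∇u.
Cauchy-Schwarz, with ∫ |∇Y|² = ℓ(ℓ+1) ∫ Y², then leaves one net factor 1/(ℓ(ℓ+1)). Only the angular
part of the energy of u enters, and u need not be separated. -/
theorem slabPair_sq_le (hℓ : 1 ≤ ℓ) (hY : IsSphericalHarmonic ℓ Y) (hu : SmoothOnSpacetime 2 u)
    {b : ℝ → ℝ} (hb : Continuous b) (t : ℝ) :
    slabPair Y u b t ^ 2 ≤ ((∫ θ, Y θ * Y θ ∂sigma) / ((ℓ : ℝ) * (ℓ + 1)) *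
      ∫ x in Icc (-(3 / 8) : ℝ) (3 / 8), b x ^ 2) * slabEnergy u t := by
  set lam : ℝ := (ℓ : ℝ) * (ℓ + 1) with hlam
  have hl : (0 : ℝ) < ℓ := by exact_mod_cast hℓ
  have hlam0 : 0 < lam := by positivity
  have hYs := smoothOnSpacetime_const hY.contMDiff_two
  have hcu : Continuous fun p : ℝ × S2 => u t p.1 p.2 :=
    (continuous_of_smoothOnSpacetime hu).comp (by fun_prop : Continuous fun p : ℝ × S2 => (t, p))
  have hcG : Continuous fun p : ℝ × S2 => sphGrad (u t p.1) p.2 :=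
    (continuous_sphGrad hu).comp (by fun_prop : Continuous fun p : ℝ × S2 => (t, p))
  have hcY : Continuous fun θ => sphGrad Y θ :=
    (continuous_sphGrad hYs).comp (by fun_prop : Continuous fun θ : S2 => ((0 : ℝ), (0 : ℝ), θ))
  have hcY0 : Continuous Y := hY.1.continuous
  have h1 : ∫ p, inner ℝ (b p.1 • sphGrad Y p.2) (sphGrad (u t p.1) p.2) ∂slab =
      lam * slabPair Y u b t := by
    have e1 := slab_integral_eq (b := b) (f := fun x θ => inner ℝ (sphGrad Y θ) (sphGrad (u t x) θ))
      (F := fun x => lam * ∫ θ, Y θ * u t x θ ∂sigma) (by fun_prop) (fun x =>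
        hY.integral_inner_sphGrad (hu.slice t x))
    have e2 := slab_integral_eq (b := b) (f := fun x θ => Y θ * u t x θ)
      (F := fun x => ∫ θ, Y θ * u t x θ ∂sigma) (by fun_prop) (fun x => rfl)
    rw [slabPair, e2, ← integral_const_mul]
    simp only [inner_smul_left, conj_trivial]
    rw [e1]
    exact integral_congr_ae (ae_of_all _ fun x => by ring)
  have h2 : ∫ p, ‖b p.1 • sphGrad Y p.2‖ ^ 2 ∂slab =
      (∫ x in Icc (-(3 / 8) : ℝ) (3 / 8), b x ^ 2) * (lam * ∫ θ, Y θ * Y θ ∂sigma) := by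
    have e1 := hY.integral_inner_sphGrad hY.contMDiff_two
    rw [← e1, slab, ← integral_prod_mul]
    refine integral_congr_ae (ae_of_all _ fun p => ?_)
    simp only [norm_smul, mul_pow, Real.norm_eq_abs, sq_abs, real_inner_self_eq_norm_sq]
  have h3 := sq_integral_inner_le (ν := slab) (F := fun p : ℝ × S2 => b p.1 • sphGrad Y p.2)
    (G := fun p => sphGrad (u t p.1) p.2) (integrable_slab (by fun_prop))
    (integrable_slab (by fun_prop)) (integrable_slab (by fun_prop))
  rw [h1, h2, mul_pow] at h3
  have h4 : slabPair Y u b t ^ 2 = (lam ^ 2)⁻¹ * (lam ^ 2 * slabPair Y u b t ^ 2) := by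
    field_simp
  rw [h4]
  refine (mul_le_mul_of_nonneg_left h3 (by positivity)).trans (le_of_eq ?_)
  rw [slabEnergy]
  field_simp

end Pairing

/-! ### The oscillator equation satisfied by the pairing -/

section PairingEquation

variable {m ℓ : ℕ} {Y : S2 → ℝ} {u : ℝ → ℝ → S2 → ℝ}

theorem hasDerivAt_slabPair {U U' : ℝ → ℝ → S2 → ℝ} (hY : Continuous Y) {b : ℝ → ℝ}
    (hb : Continuous b) (hU : Continuous fun p : ℝ × ℝ × S2 => U p.1 p.2.1 p.2.2)
    (hU' : Continuous fun p : ℝ × ℝ × S2 => U' p.1 p.2.1 p.2.2)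
    (h : ∀ t x θ, HasDerivAt (fun t => U t x θ) (U' t x θ) t) (t : ℝ) :
    HasDerivAt (slabPair Y U b) (slabPair Y U' b t) t := by
  unfold slabPair
  rw [slab_eq]
  refine hasDerivAt_setIntegral_of_continuous (ν := (volume : Measure ℝ).prod sigma) isCompact_slab
    measurableSet_slab (F := fun t p => b p.1 * (Y p.2 * U t p.1 p.2))
    (F' := fun t p => b p.1 * (Y p.2 * U' t p.1 p.2)) ?_ ?_ (fun t p => ?_) t
  · exact (hb.comp (continuous_fst.comp continuous_snd)).mul
      ((hY.comp (continuous_snd.comp continuous_snd)).mul hU)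
  · exact (hb.comp (continuous_fst.comp continuous_snd)).mul
      ((hY.comp (continuous_snd.comp continuous_snd)).mul hU')
  · exact ((h t p.1 p.2).const_mul (Y p.2)).const_mul (b p.1)

/-- The test function produced by the radial part of the equation. -/
def radialResidue (m : ℕ) (lam : ℝ) (k : ℝ → ℝ) (x : ℝ) : ℝ :=
  deriv (fun y => warp m y ^ 2 * deriv k y) x + lam * (warp m x ^ 2 - 1) * k x

theorem contDiff_warp_sq_mul_deriv {k : ℝ → ℝ} (hk : ContDiff ℝ ∞ k) (m : ℕ) :
    ContDiff ℝ ∞ fun y => warp m y ^ 2 * deriv k y :=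
  ((contDiff_warp m).pow 2).mul (contDiff_infty_iff_deriv.1 hk).2

theorem continuous_radialResidue {k : ℝ → ℝ} (hk : ContDiff ℝ ∞ k) (m : ℕ) (lam : ℝ) :
    Continuous (radialResidue m lam k) := by
  have h1 := (contDiff_infty_iff_deriv.1 (contDiff_warp_sq_mul_deriv hk m)).2.continuous
  have h2 := (contDiff_warp (n := 0) m).continuous
  have h3 := hk.continuous
  unfold radialResidue
  fun_prop

/-- Two integrations by parts in `x`. -/
theorem integral_radial_by_parts {k : ℝ → ℝ} (hk : ContDiff ℝ ∞ k)
    (hk0 : k (-(3 / 8)) = 0 ∧ k (3 / 8) = 0) (hk1 : deriv k (-(3 / 8)) = 0 ∧ deriv k (3 / 8) = 0)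
    {f f' f'' : ℝ → ℝ} (hf : ∀ x, HasDerivAt f (f' x) x) (hf' : ∀ x, HasDerivAt f' (f'' x) x)
    (hc : Continuous f'') :
    ∫ x in Icc (-(3 / 8) : ℝ) (3 / 8),
        k x * (deriv (fun y => warp m y ^ 2) x * f' x + warp m x ^ 2 * f'' x) =
      ∫ x in Icc (-(3 / 8) : ℝ) (3 / 8), deriv (fun y => warp m y ^ 2 * deriv k y) x * f x := by
  have hw : ContDiff ℝ ∞ fun y => warp m y ^ 2 := (contDiff_warp m).pow 2
  have hwd : ∀ x, HasDerivAt (fun y => warp m y ^ 2) (deriv (fun y => warp m y ^ 2) x) x :=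
    fun x => ((hw.differentiable (by simp)) x).hasDerivAt
  have hkd : ∀ x, HasDerivAt k (deriv k x) x := fun x =>
    ((hk.differentiable (by simp)) x).hasDerivAt
  have hpd : ∀ x, HasDerivAt (fun y => warp m y ^ 2 * deriv k y)
      (deriv (fun y => warp m y ^ 2 * deriv k y) x) x := fun x =>
    (((contDiff_warp_sq_mul_deriv hk m).differentiable (by simp)) x).hasDerivAt
  have hwc := (contDiff_warp (n := 0) m).continuous
  have hw'c : Continuous (deriv fun y => warp m y ^ 2) :=
    (contDiff_infty_iff_deriv.1 hw).2.continuous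
  have hkc := hk.continuous
  have hpc : Continuous (deriv fun y => warp m y ^ 2 * deriv k y) :=
    (contDiff_infty_iff_deriv.1 (contDiff_warp_sq_mul_deriv hk m)).2.continuous
  have hfc : Continuous f := continuous_iff_continuousAt.2 fun x => (hf x).continuousAt
  have hf'c : Continuous f' := continuous_iff_continuousAt.2 fun x => (hf' x).continuousAt
  have hd : ∀ x, HasDerivAt
      (fun x => k x * (warp m x ^ 2 * f' x) - (warp m x ^ 2 * deriv k x) * f x)
      (k x * (deriv (fun y => warp m y ^ 2) x * f' x + warp m x ^ 2 * f'' x) -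
        deriv (fun y => warp m y ^ 2 * deriv k y) x * f x) x := by
    intro x
    refine (((hkd x).mul ((hwd x).mul (hf' x))).sub ((hpd x).mul (hf x))).congr_deriv ?_
    simp only [Pi.mul_apply]
    ring
  have hle : (-(3 / 8) : ℝ) ≤ 3 / 8 := by norm_num
  rw [integral_Icc_eq_integral_Ioc, integral_Icc_eq_integral_Ioc,
    ← intervalIntegral.integral_of_le hle, ← intervalIntegral.integral_of_le hle, ← sub_eq_zero,
    ← intervalIntegral.integral_sub (Continuous.intervalIntegrable (by fun_prop) _ _)
      (Continuous.intervalIntegrable (by fun_prop) _ _),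
    intervalIntegral.integral_eq_sub_of_hasDerivAt (fun x _ => hd x)
      (Continuous.intervalIntegrable (by fun_prop) _ _)]
  simp [hk0, hk1]

theorem slab_integral_eq_swap {f : ℝ × S2 → ℝ} (hf : Continuous f) :
    ∫ p, f p ∂slab = ∫ θ, (∫ x in Icc (-(3 / 8) : ℝ) (3 / 8), f (x, θ)) ∂sigma :=
  integral_prod_symm f (integrable_slab hf)

theorem wave_equation {ψ₀ ψ₁ : ℝ → S2 → ℝ} (hu : IsWaveSolution m 2 ψ₀ ψ₁ u) (t x : ℝ) (θ : S2) :
    warp m x ^ 2 * ddExt u (1, 0, 0) t x θ =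
      (deriv (fun y => warp m y ^ 2) x * dExt u (0, 1, 0) t x θ +
        warp m x ^ 2 * ddExt u (0, 1, 0) t x θ) + sphLaplacian (u t x) θ := by
  have hs := hu.smooth
  have h := hu.box_eq_zero t x θ
  have h1 : deriv (fun t' => deriv (fun t'' => u t'' x θ) t') t = ddExt u (1, 0, 0) t x θ := by
    have : (fun t' => deriv (fun t'' => u t'' x θ) t') = fun t' => dExt u (1, 0, 0) t' x θ :=
      funext fun t' => (hasDerivAt_fst hs t' x θ).deriv
    rw [this, (hasDerivAt_fst_fst hs t x θ).deriv]
  have h2 : deriv (fun x' => warp m x' ^ 2 * deriv (fun x'' => u t x'' θ) x') x =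
      deriv (fun y => warp m y ^ 2) x * dExt u (0, 1, 0) t x θ +
        warp m x ^ 2 * ddExt u (0, 1, 0) t x θ := by
    have : (fun x' => warp m x' ^ 2 * deriv (fun x'' => u t x'' θ) x') =
        fun x' => warp m x' ^ 2 * dExt u (0, 1, 0) t x' θ :=
      funext fun x' => by rw [(hasDerivAt_snd hs t x' θ).deriv]
    rw [this]
    have hwd : HasDerivAt (fun y => warp m y ^ 2) (deriv (fun y => warp m y ^ 2) x) x :=
      (((contDiff_warp (n := 1) m).pow 2).differentiable (by norm_num) x).hasDerivAt
    exact (hwd.mul (hasDerivAt_snd_snd hs t x θ)).deriv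
  rw [box, h1, h2] at h
  have hw : warp m x ^ 2 * (warp m x ^ 2)⁻¹ = 1 :=
    mul_inv_cancel₀ (pow_ne_zero 2 (warp_pos m x).ne')
  linear_combination (-(warp m x ^ 2)) * h + ((deriv (fun y => warp m y ^ 2) x *
    dExt u (0, 1, 0) t x θ + warp m x ^ 2 * ddExt u (0, 1, 0) t x θ) + sphLaplacian (u t x) θ) * hw

theorem continuous_slice {E : Type*} [TopologicalSpace E] {U : ℝ → ℝ → S2 → E}
    (hU : Continuous fun p : ℝ × ℝ × S2 => U p.1 p.2.1 p.2.2) (t : ℝ) :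
    Continuous fun p : ℝ × S2 => U t p.1 p.2 :=
  hU.comp (by fun_prop : Continuous fun p : ℝ × S2 => (t, p))

/-- Fubini with x innermost reduces this to the one-dimensional integration by parts on each line of
fixed θ. -/
theorem slab_integral_radial_part (hs : SmoothOnSpacetime 2 u) (hY : Continuous Y) {k : ℝ → ℝ}
    (hk : ContDiff ℝ ∞ k) (hk0 : k (-(3 / 8)) = 0 ∧ k (3 / 8) = 0)
    (hk1 : deriv k (-(3 / 8)) = 0 ∧ deriv k (3 / 8) = 0) (t : ℝ) :
    ∫ p, Y p.2 * (k p.1 * (deriv (fun y => warp m y ^ 2) p.1 * dExt u (0, 1, 0) t p.1 p.2 +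
        warp m p.1 ^ 2 * ddExt u (0, 1, 0) t p.1 p.2)) ∂slab =
      slabPair Y u (deriv fun y => warp m y ^ 2 * deriv k y) t := by
  have hcu := continuous_slice (continuous_of_smoothOnSpacetime hs) t
  have hcx := continuous_slice (continuous_dExt hs (0, 1, 0)) t
  have hcxx := continuous_slice (continuous_ddExt hs (0, 1, 0)) t
  have hkc := hk.continuous
  have hwc : Continuous (warp m) := (contDiff_warp (n := 0) m).continuous
  have hw : ContDiff ℝ ∞ fun y => warp m y ^ 2 := (contDiff_warp m).pow 2
  have hw'c : Continuous (deriv fun y => warp m y ^ 2) :=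
    (contDiff_infty_iff_deriv.1 hw).2.continuous
  have hpc : Continuous (deriv fun y => warp m y ^ 2 * deriv k y) :=
    (contDiff_infty_iff_deriv.1 (contDiff_warp_sq_mul_deriv hk m)).2.continuous
  have hl := slab_integral_eq_swap (f := fun p => Y p.2 * (k p.1 *
    (deriv (fun y => warp m y ^ 2) p.1 * dExt u (0, 1, 0) t p.1 p.2 +
      warp m p.1 ^ 2 * ddExt u (0, 1, 0) t p.1 p.2))) (by fun_prop)
  have hr := slab_integral_eq_swap (f := fun p =>
    deriv (fun y => warp m y ^ 2 * deriv k y) p.1 * (Y p.2 * u t p.1 p.2)) (by fun_prop)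
  rw [slabPair, hl, hr]
  refine integral_congr_ae (ae_of_all _ fun θ => ?_)
  have h := integral_radial_by_parts hk hk0 hk1 (m := m) (fun x => hasDerivAt_snd hs t x θ)
      (fun x => hasDerivAt_snd_snd hs t x θ)
      (hcxx.comp (by fun_prop : Continuous fun x : ℝ => (x, θ)))
  have hsw : ∀ x, deriv (fun y => warp m y ^ 2 * deriv k y) x * (Y θ * u t x θ) =
      Y θ * (deriv (fun y => warp m y ^ 2 * deriv k y) x * u t x θ) := fun x => by ring
  simp only [hsw, integral_const_mul, h]

theorem slab_integral_angular_part (hs : SmoothOnSpacetime 2 u) (hY : IsSphericalHarmonic ℓ Y)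
    {k : ℝ → ℝ} (hk : Continuous k) (t : ℝ) :
    ∫ p, k p.1 * (Y p.2 * sphLaplacian (u t p.1) p.2) ∂slab =
      -((ℓ : ℝ) * (ℓ + 1)) * slabPair Y u k t := by
  have hcu := continuous_slice (continuous_of_smoothOnSpacetime hs) t
  have hcL := continuous_slice (U := fun t x θ => sphLaplacian (u t x) θ)
    (continuous_sphLaplacian hs) t
  have hcY : Continuous Y := hY.1.continuous
  have h1 := slab_integral_eq (b := k) (f := fun x θ => Y θ * sphLaplacian (u t x) θ)
      (F := fun x => -((ℓ : ℝ) * (ℓ + 1)) * ∫ θ, Y θ * u t x θ ∂sigma) (by fun_prop)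
      (fun x => hY.integral_mul_sphLaplacian (hs.slice t x))
  have h2 := slab_integral_eq (b := k) (f := fun x θ => Y θ * u t x θ)
      (F := fun x => ∫ θ, Y θ * u t x θ ∂sigma) (by fun_prop) (fun x => rfl)
  rw [h1, slabPair, h2, ← integral_const_mul]
  exact integral_congr_ae (ae_of_all _ fun x => by ring)

/-- Pairing a² u_tt = (a² u_x)_x + Δu with kY moves every derivative onto kY and gives (a² k')' -
ℓ(ℓ+1) k. Adding and subtracting ℓ(ℓ+1) a² k isolates an exact oscillator for the pairing with a² k;
the remainder carries the factor a² - 1, which is small near x = 0. -/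
theorem slabPair_second_deriv (hY : IsSphericalHarmonic ℓ Y) {ψ₀ ψ₁ : ℝ → S2 → ℝ}
    (hu : IsWaveSolution m 2 ψ₀ ψ₁ u) {k : ℝ → ℝ} (hk : ContDiff ℝ ∞ k)
    (hk0 : k (-(3 / 8)) = 0 ∧ k (3 / 8) = 0) (hk1 : deriv k (-(3 / 8)) = 0 ∧ deriv k (3 / 8) = 0)
    (t : ℝ) :
    slabPair Y (ddExt u (1, 0, 0)) (fun x => warp m x ^ 2 * k x) t =
      -((ℓ : ℝ) * (ℓ + 1)) * slabPair Y u (fun x => warp m x ^ 2 * k x) t +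
        slabPair Y u (radialResidue m ((ℓ : ℝ) * (ℓ + 1)) k) t := by
  have hs := hu.smooth
  have hcu := continuous_slice (continuous_of_smoothOnSpacetime hs) t
  have hcx := continuous_slice (continuous_dExt hs (0, 1, 0)) t
  have hcxx := continuous_slice (continuous_ddExt hs (0, 1, 0)) t
  have hcL := continuous_slice (U := fun t x θ => sphLaplacian (u t x) θ)
    (continuous_sphLaplacian hs) t
  have hcY : Continuous Y := hY.1.continuous
  have hkc := hk.continuous
  have hwc : Continuous (warp m) := (contDiff_warp (n := 0) m).continuous
  have hw : ContDiff ℝ ∞ fun y => warp m y ^ 2 := (contDiff_warp m).pow 2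
  have hw'c : Continuous (deriv fun y => warp m y ^ 2) :=
    (contDiff_infty_iff_deriv.1 hw).2.continuous
  have hpc : Continuous (deriv fun y => warp m y ^ 2 * deriv k y) :=
    (contDiff_infty_iff_deriv.1 (contDiff_warp_sq_mul_deriv hk m)).2.continuous
  have hRc := continuous_radialResidue hk m ((ℓ : ℝ) * (ℓ + 1))
  have e1 : slabPair Y (ddExt u (1, 0, 0)) (fun x => warp m x ^ 2 * k x) t =
      (∫ p, Y p.2 * (k p.1 * (deriv (fun y => warp m y ^ 2) p.1 * dExt u (0, 1, 0) t p.1 p.2 +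
        warp m p.1 ^ 2 * ddExt u (0, 1, 0) t p.1 p.2)) ∂slab) +
      ∫ p, k p.1 * (Y p.2 * sphLaplacian (u t p.1) p.2) ∂slab := by
    rw [slabPair, ← integral_add (integrable_slab (by fun_prop)) (integrable_slab (by fun_prop))]
    refine integral_congr_ae (ae_of_all _ fun p => ?_)
    have hw := wave_equation hu t p.1 p.2
    simp only
    calc _ = k p.1 * Y p.2 * (warp m p.1 ^ 2 * ddExt u (1, 0, 0) t p.1 p.2) := by ring
      _ = _ := by rw [hw]; ring
  have e2 : slabPair Y u (radialResidue m ((ℓ : ℝ) * (ℓ + 1)) k) t =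
      slabPair Y u (deriv fun y => warp m y ^ 2 * deriv k y) t +
        (ℓ : ℝ) * (ℓ + 1) * (slabPair Y u (fun x => warp m x ^ 2 * k x) t - slabPair Y u k t) := by
    simp only [slabPair]
    rw [← integral_sub (integrable_slab (by fun_prop)) (integrable_slab (by fun_prop)),
      ← integral_const_mul,
      ← integral_add (integrable_slab (by fun_prop)) (integrable_slab (by fun_prop))]
    refine integral_congr_ae (ae_of_all _ fun p => ?_)
    simp only [radialResidue]
    ring
  rw [e1, slab_integral_radial_part hs hcY hk hk0 hk1, slab_integral_angular_part hs hY hkc, e2]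
  ring

/-- Lower bound for the angular energy in the slab of an arbitrary `C²` solution with separated
Cauchy data. -/
theorem slabEnergy_lower_bound (hℓ : 1 ≤ ℓ) (hY : IsSphericalHarmonic ℓ Y) {φ : ℝ → ℝ}
    (hu : IsWaveSolution m 2 (fun x θ => φ x * Y θ) (fun _ _ => 0) u) {k : ℝ → ℝ}
    (hk : ContDiff ℝ ∞ k) (hk0 : k (-(3 / 8)) = 0 ∧ k (3 / 8) = 0)
    (hk1 : deriv k (-(3 / 8)) = 0 ∧ deriv k (3 / 8) = 0) {lam N T : ℝ}
    (hlam : lam = (ℓ : ℝ) * (ℓ + 1)) (hN : N = ∫ θ, Y θ * Y θ ∂sigma) (hT : 0 < T)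
    (hlT : 1 ≤ √lam * T) :
    ((∫ x in Icc (-(3 / 8) : ℝ) (3 / 8), warp m x ^ 2 * k x * φ x) * N) ^ 2 * (T / 4) ≤
      2 * (N / lam * (∫ x in Icc (-(3 / 8) : ℝ) (3 / 8), (warp m x ^ 2 * k x) ^ 2) +
        T ^ 2 / lam * (N / lam * ∫ x in Icc (-(3 / 8) : ℝ) (3 / 8), radialResidue m lam k x ^ 2)) *
      ∫ t in (0 : ℝ)..T, slabEnergy u t := by
  have hs := hu.smooth
  have hl : (0 : ℝ) < ℓ := by exact_mod_cast hℓ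
  have hlam0 : 0 < lam := by rw [hlam]; positivity
  have hw : ContDiff ℝ ∞ fun x => warp m x ^ 2 * k x := ((contDiff_warp m).pow 2).mul hk
  set b := fun x => warp m x ^ 2 * k x with hb
  have hYc := hY.1.continuous
  have hg := hasDerivAt_slabPair hYc hw.continuous (continuous_of_smoothOnSpacetime hs)
    (continuous_dExt hs (1, 0, 0)) (hasDerivAt_fst hs)
  have hg' : ∀ t, HasDerivAt (slabPair Y (dExt u (1, 0, 0)) b)
      (-(√lam) ^ 2 * slabPair Y u b t + slabPair Y u (radialResidue m lam k) t) t := by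
    intro t
    rw [Real.sq_sqrt hlam0.le, hlam, ← slabPair_second_deriv hY hu hk hk0 hk1]
    exact hasDerivAt_slabPair hYc hw.continuous (continuous_dExt hs (1, 0, 0))
      (continuous_ddExt hs (1, 0, 0)) (hasDerivAt_fst_fst hs) t
  have hRc := continuous_radialResidue hk m lam
  have hGc : Continuous (slabPair Y u (radialResidue m lam k)) :=
    continuous_iff_continuousAt.2 fun t => (hasDerivAt_slabPair hYc hRc
      (continuous_of_smoothOnSpacetime hs) (continuous_dExt hs (1, 0, 0))
      (hasDerivAt_fst hs) t).continuousAt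
  have h0 : slabPair Y (dExt u (1, 0, 0)) b 0 = 0 := by
    have : ∀ x θ, dExt u (1, 0, 0) 0 x θ = 0 := fun x θ => by
      rw [← (hasDerivAt_fst hs 0 x θ).deriv, hu.initial_deriv]
    simp [slabPair, this]
  have hinit : slabPair Y u b 0 =
      (∫ x in Icc (-(3 / 8) : ℝ) (3 / 8), warp m x ^ 2 * k x * φ x) * N := by
    rw [hN, ← integral_prod_mul, slabPair]
    refine integral_congr_ae (ae_of_all _ fun p => ?_)
    simp only [hu.initial, hb]
    ring
  have hmain := oscillator_lower_bound (Real.sqrt_pos.2 hlam0) hT hGc hg hg' h0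
    (continuous_slabEnergy hs)
    (fun t => slabPair_sq_le hℓ hY hs hw.continuous t) (fun t => slabPair_sq_le hℓ hY hs hRc t)
  rw [hinit, Real.sq_sqrt hlam0.le, ← hlam, ← hN] at hmain
  exact (mul_le_mul_of_nonneg_left (le_integral_cos_sq (Real.sqrt_pos.2 hlam0) hlT)
    (sq_nonneg _)).trans hmain

end PairingEquation

/-! ### The rescaled profile -/

/-- A bump function on the line, supported in `[-1/4, 1/4]`. -/
def bump : ContDiffBump (0 : ℝ) := ⟨1 / 8, 1 / 4, by norm_num, by norm_num⟩

/-- The bump function as a plain function. -/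
def profile (x : ℝ) : ℝ := bump x

theorem contDiff_profile : ContDiff ℝ ∞ profile := bump.contDiff

theorem tsupport_profile : tsupport profile = Metric.closedBall 0 (1 / 4) := bump.tsupport_eq

theorem hasCompactSupport_profile : HasCompactSupport profile := bump.hasCompactSupport

theorem notMem_tsupport_profile {y : ℝ} (hy : 1 / 4 < |y|) : y ∉ tsupport profile := by
  rw [tsupport_profile]
  simpa using hy

theorem profile_eq_zero {y : ℝ} (hy : 1 / 4 < |y|) : profile y = 0 :=
  image_eq_zero_of_notMem_tsupport (notMem_tsupport_profile hy)

theorem deriv_profile_eq_zero {y : ℝ} (hy : 1 / 4 < |y|) : deriv profile y = 0 :=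
  image_eq_zero_of_notMem_tsupport fun h => notMem_tsupport_profile hy (tsupport_deriv_subset h)

theorem deriv_deriv_profile_eq_zero {y : ℝ} (hy : 1 / 4 < |y|) : deriv (deriv profile) y = 0 :=
  image_eq_zero_of_notMem_tsupport fun h =>
    notMem_tsupport_profile hy (tsupport_deriv_subset (tsupport_deriv_subset h))

theorem contDiff_deriv_profile : ContDiff ℝ ∞ (deriv profile) :=
  (contDiff_infty_iff_deriv.1 contDiff_profile).2

theorem continuous_deriv_deriv_profile : Continuous (deriv (deriv profile)) :=
  (contDiff_infty_iff_deriv.1 contDiff_deriv_profile).2.continuous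

theorem integral_profile_sq_pos : 0 < ∫ x, profile x ^ 2 := by
  have hc : Continuous profile := contDiff_profile.continuous
  refine (hc.pow 2).integral_pos_of_hasCompactSupport_nonneg_nonzero (μ := volume) ?_
    (fun x => sq_nonneg _) (x := 0) ?_
  · exact hasCompactSupport_profile.comp_left (g := fun y : ℝ => y ^ 2) (by simp)
  · have : profile 0 = 1 := bump.one_of_mem_closedBall (by simp [bump])
    simp [this]

/-- The profile at scale `h`. -/
def scaled (h x : ℝ) : ℝ := profile (x / h)

theorem contDiff_scaled (h : ℝ) : ContDiff ℝ ∞ (scaled h) :=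
  contDiff_profile.comp (contDiff_id.div_const h)

theorem hasDerivAt_scaled (h x : ℝ) :
    HasDerivAt (scaled h) (deriv profile (x / h) / h) x := by
  have h1 := ((contDiff_profile.differentiable (by simp)) (x / h)).hasDerivAt
  have h2 := h1.comp x ((hasDerivAt_id x).div_const h)
  rwa [mul_one_div] at h2

theorem deriv_scaled (h : ℝ) : deriv (scaled h) = fun x => deriv profile (x / h) / h :=
  funext fun x => (hasDerivAt_scaled h x).deriv

theorem hasDerivAt_deriv_scaled (h x : ℝ) :
    HasDerivAt (deriv (scaled h)) (deriv (deriv profile) (x / h) / h / h) x := by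
  rw [deriv_scaled]
  have h1 := ((contDiff_deriv_profile.differentiable (by simp)) (x / h)).hasDerivAt
  have h2 := h1.comp x ((hasDerivAt_id x).div_const h)
  rw [mul_one_div] at h2
  exact h2.div_const h

theorem quarter_lt_abs_div {h x : ℝ} (hh : 0 < h) (hh1 : h ≤ 1) (hx : 1 / 4 < |x|) :
    1 / 4 < |x / h| := by
  rw [abs_div, abs_of_pos hh, lt_div_iff₀ hh]
  linarith

theorem scaled_eq_zero {h x : ℝ} (hh : 0 < h) (hh1 : h ≤ 1) (hx : 1 / 4 < |x|) :
    scaled h x = 0 := profile_eq_zero (quarter_lt_abs_div hh hh1 hx)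

theorem deriv_scaled_eq_zero {h x : ℝ} (hh : 0 < h) (hh1 : h ≤ 1) (hx : 1 / 4 < |x|) :
    deriv (scaled h) x = 0 := by
  simp only [deriv_scaled, deriv_profile_eq_zero (quarter_lt_abs_div hh hh1 hx), zero_div]

theorem hasCompactSupport_scaled {h : ℝ} (hh : 0 < h) (hh1 : h ≤ 1) :
    HasCompactSupport (scaled h) := by
  refine HasCompactSupport.intro (K := Icc (-(1 / 4)) (1 / 4)) isCompact_Icc fun x hx => ?_
  refine scaled_eq_zero hh hh1 ?_
  by_contra hc
  exact hx (abs_le.1 (not_lt.1 hc))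

theorem integral_comp_div_scale {h : ℝ} (hh : 0 < h) (f : ℝ → ℝ) :
    ∫ x, f (x / h) = h * ∫ x, f x := by
  rw [Measure.integral_comp_div, abs_of_pos hh, smul_eq_mul]

theorem setIntegral_Icc_eq {f : ℝ → ℝ} (hf : ∀ x, 1 / 4 < |x| → f x = 0) :
    ∫ x in Icc (-(3 / 8) : ℝ) (3 / 8), f x = ∫ x, f x := by
  refine setIntegral_eq_integral_of_forall_compl_eq_zero fun x hx => hf x ?_
  by_contra hc
  have := abs_le.1 (not_lt.1 hc)
  exact hx ⟨by linarith [this.1], by linarith [this.2]⟩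

theorem integrable_of_eq_zero {f : ℝ → ℝ} (hc : Continuous f) (hf : ∀ x, 1 / 4 < |x| → f x = 0) :
    Integrable f := by
  refine hc.integrable_of_hasCompactSupport
    (HasCompactSupport.intro (K := Icc (-(1 / 4)) (1 / 4)) isCompact_Icc fun x hx => hf x ?_)
  by_contra h
  exact hx (abs_le.1 (not_lt.1 h))

theorem exists_deriv_warp_sq_bound (m : ℕ) :
    ∃ C : ℝ, 0 ≤ C ∧ ∀ x, |x| ≤ 1 → |deriv (fun y => warp m y ^ 2) x| ≤ C := by
  have hw : ContDiff ℝ ∞ fun y => warp m y ^ 2 := (contDiff_warp m).pow 2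
  obtain ⟨C, hC⟩ := (isCompact_Icc (a := (-1 : ℝ)) (b := 1)).exists_bound_of_continuousOn
    (contDiff_infty_iff_deriv.1 hw).2.continuous.continuousOn
  exact ⟨C, (norm_nonneg _).trans (hC 0 (by simp)), fun x hx => hC x (abs_le.1 hx)⟩

/-- The dominating function of the rescaled radial residue. -/
def residueBound (C y : ℝ) : ℝ :=
  C * |deriv profile y| + 2 * |deriv (deriv profile) y| + |profile y|

theorem residueBound_eq_zero (C : ℝ) {y : ℝ} (hy : 1 / 4 < |y|) : residueBound C y = 0 := by
  simp [residueBound, profile_eq_zero hy, deriv_profile_eq_zero hy, deriv_deriv_profile_eq_zero hy]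

theorem continuous_residueBound (C : ℝ) : Continuous (residueBound C) := by
  have h1 := contDiff_profile.continuous
  have h2 := contDiff_deriv_profile.continuous
  have h3 := continuous_deriv_deriv_profile
  unfold residueBound
  fun_prop

theorem radialResidue_scaled (m : ℕ) (lam h x : ℝ) :
    radialResidue m lam (scaled h) x =
      deriv (fun y => warp m y ^ 2) x * (deriv profile (x / h) / h) +
        warp m x ^ 2 * (deriv (deriv profile) (x / h) / h / h) +
        lam * (warp m x ^ 2 - 1) * profile (x / h) := by
  have hwd : HasDerivAt (fun y => warp m y ^ 2) (deriv (fun y => warp m y ^ 2) x) x :=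
    (((contDiff_warp (n := 1) m).pow 2).differentiable (by norm_num) x).hasDerivAt
  have := (hwd.mul (hasDerivAt_deriv_scaled h x)).deriv
  rw [radialResidue]
  refine congr_arg₂ (· + ·) (this.trans ?_) rfl
  rw [deriv_scaled]

/-- Two derivatives of the profile cost h⁻². On its support λ(a² - 1) ≤ λ h^{2m} = h⁻², which is
exactly what the relation between λ and h provides. -/
theorem abs_radialResidue_scaled_le {m : ℕ} (hm : 1 ≤ m) {C lam h : ℝ} (hC0 : 0 ≤ C)
    (hC : ∀ x, |x| ≤ 1 → |deriv (fun y => warp m y ^ 2) x| ≤ C) (hh : 0 < h) (hh1 : h ≤ 1)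
    (hlam : lam * h ^ (2 * m + 2) = 1) (x : ℝ) :
    |radialResidue m lam (scaled h) x| ≤ (h ^ 2)⁻¹ * residueBound C (x / h) := by
  rw [radialResidue_scaled]
  rcases lt_or_ge (1 / 4) |x / h| with hx | hx
  · rw [residueBound_eq_zero C hx, profile_eq_zero hx, deriv_profile_eq_zero hx,
      deriv_deriv_profile_eq_zero hx]
    simp
  have hxh : |x| ≤ h := by
    rw [abs_div, abs_of_pos hh, div_le_iff₀ hh] at hx
    linarith
  have hx1 : |x| ≤ 1 := hxh.trans hh1
  have hlam0 : 0 < lam := pos_of_mul_pos_left (hlam ▸ one_pos) (by positivity)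
  have h1 : lam * (warp m x ^ 2 - 1) ≤ (h ^ 2)⁻¹ := by
    have e1 : x ^ (2 * m) ≤ h ^ (2 * m) := by
      rw [pow_mul, pow_mul, ← sq_abs]
      gcongr
    have e2 := warp_sq_le hm x
    rw [← one_div, le_div_iff₀ (by positivity)]
    calc lam * (warp m x ^ 2 - 1) * h ^ 2 ≤ lam * h ^ (2 * m) * h ^ 2 := by
          gcongr
          linarith
      _ = lam * h ^ (2 * m + 2) := by ring
      _ = 1 := hlam
  have h2 : 0 ≤ lam * (warp m x ^ 2 - 1) :=
    mul_nonneg hlam0.le (sub_nonneg.2 (one_le_warp_sq m x))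
  have h3 : h⁻¹ ≤ (h ^ 2)⁻¹ := by
    gcongr
    nlinarith
  refine (abs_add_le _ _).trans ((add_le_add (abs_add_le _ _) le_rfl).trans ?_)
  rw [abs_mul, abs_mul, abs_mul, abs_of_nonneg h2, abs_div, abs_div, abs_div, abs_of_pos hh,
    abs_of_nonneg (sq_nonneg (warp m x))]
  calc _ = |deriv (fun y => warp m y ^ 2) x| * (|deriv profile (x / h)| * h⁻¹) +
        warp m x ^ 2 * (|deriv (deriv profile) (x / h)| * (h ^ 2)⁻¹) +
        lam * (warp m x ^ 2 - 1) * |profile (x / h)| := by field_simp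
    _ ≤ C * (|deriv profile (x / h)| * (h ^ 2)⁻¹) +
        2 * (|deriv (deriv profile) (x / h)| * (h ^ 2)⁻¹) + (h ^ 2)⁻¹ * |profile (x / h)| := by
      gcongr
      · exact hC x hx1
      · exact warp_sq_le_two hm hx1
    _ = _ := by rw [residueBound]; ring

/-! ### The balance of scales and concentration near the trapped sphere -/

/-- The scales of the construction: frequency `lam`, width `h`, time `T`. -/
structure TrappingScales (m : ℕ) (lam h T : ℝ) : Prop where
  lam_ge : 1 ≤ lam
  h_pos : 0 < h
  h_le : h ≤ 1
  lam_mul : lam * h ^ (2 * m + 2) = 1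
  time_eq : T = h ^ 2 * √lam
  time_eq_rpow : T = lam ^ loss m

theorem trappingScales (m : ℕ) {lam : ℝ} (hlam : 1 ≤ lam) :
    TrappingScales m lam (lam ^ (-(1 / (2 * ((m : ℝ) + 1))))) (lam ^ loss m) where
  lam_ge := hlam
  h_pos := Real.rpow_pos_of_pos (by linarith) _
  h_le := Real.rpow_le_one_of_one_le_of_nonpos hlam (by rw [neg_nonpos]; positivity)
  lam_mul := by
    rw [← Real.rpow_natCast, ← Real.rpow_mul (by linarith)]
    have : -(1 / (2 * ((m : ℝ) + 1))) * ((2 * m + 2 : ℕ) : ℝ) = -1 := by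
      push_cast
      field_simp
    rw [this, Real.rpow_neg_one, mul_inv_cancel₀ (by linarith)]
  -- The exponents match because -1/(m+1) + 1/2 = (m-1)/(2(m+1)).
  time_eq := by
    rw [← Real.rpow_natCast, ← Real.rpow_mul (by linarith), Real.sqrt_eq_rpow,
      ← Real.rpow_add (by linarith), loss]
    congr 1
    push_cast
    field_simp
    ring
  time_eq_rpow := rfl

namespace TrappingScales

variable {m : ℕ} {lam h T : ℝ}

theorem lam_pos (H : TrappingScales m lam h T) : 0 < lam := by linarith [H.lam_ge]

theorem time_pos (H : TrappingScales m lam h T) : 0 < T := by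
  rw [H.time_eq]
  have := H.h_pos
  have := H.lam_pos
  positivity

theorem one_le_lam_mul_sq (H : TrappingScales m lam h T) : 1 ≤ lam * h ^ 2 := by
  have h1 : h ^ (2 * m) ≤ 1 := pow_le_one₀ H.h_pos.le H.h_le
  have h2 : 0 ≤ lam * h ^ 2 := mul_nonneg H.lam_pos.le (sq_nonneg _)
  calc 1 = lam * h ^ 2 * h ^ (2 * m) := by rw [← H.lam_mul]; ring
    _ ≤ _ := mul_le_of_le_one_right h2 h1

theorem one_le_sqrt_mul (H : TrappingScales m lam h T) : 1 ≤ √lam * T := by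
  have := H.one_le_lam_mul_sq
  have e : √lam * T = lam * h ^ 2 := by
    rw [H.time_eq]
    calc _ = (√lam * √lam) * h ^ 2 := by ring
      _ = _ := by rw [Real.mul_self_sqrt H.lam_pos.le]
  rwa [e]

end TrappingScales

/-- Concentration of the angular energy of every `C²` solution with the rescaled data near the
trapped set. -/
theorem exists_slabEnergy_lower_bound {m : ℕ} (hm : 1 ≤ m) : ∃ c : ℝ, 0 < c ∧
    ∀ (ℓ : ℕ) (Y : S2 → ℝ) (h T N : ℝ) (u : ℝ → ℝ → S2 → ℝ), 1 ≤ ℓ → IsSphericalHarmonic ℓ Y →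
      N = ∫ θ, Y θ * Y θ ∂sigma → 0 < N → TrappingScales m ((ℓ : ℝ) * (ℓ + 1)) h T →
      IsWaveSolution m 2 (fun x θ => scaled h x * Y θ) (fun _ _ => 0) u →
      c * (((ℓ : ℝ) * (ℓ + 1)) * T * N * h) ≤ ∫ t in (0 : ℝ)..T, slabEnergy u t := by
  obtain ⟨C, hC0, hC⟩ := exists_deriv_warp_sq_bound m
  set D := ∫ x, profile x ^ 2 with hD
  set D' := ∫ x, residueBound C x ^ 2 with hD'
  have hDpos : 0 < D := integral_profile_sq_pos
  have hD'0 : 0 ≤ D' := integral_nonneg fun x => sq_nonneg _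
  -- The constant results from (hDN)² T/4 ≤ 2 (N/λ)(4hD + hD') ∫ H after division by hN/λ.
  refine ⟨D ^ 2 / (8 * (4 * D + D')), by positivity, ?_⟩
  intro ℓ Y h T N u hℓ hY hN hN0 H hu
  set lam : ℝ := (ℓ : ℝ) * (ℓ + 1) with hlam
  have hh := H.h_pos
  have hl := H.lam_pos
  have hT := H.time_pos
  have hz : ∀ x, 1 / 4 < |x| → scaled h x = 0 := fun x => scaled_eq_zero hh H.h_le
  have hsc : Continuous (scaled h) := (contDiff_scaled h).continuous
  have hwc : Continuous (warp m) := (contDiff_warp (n := 0) m).continuous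
  have hmain := slabEnergy_lower_bound hℓ hY hu (contDiff_scaled h)
    ⟨hz _ (by norm_num [abs_of_pos]), hz _ (by norm_num [abs_of_pos])⟩
    ⟨deriv_scaled_eq_zero hh H.h_le (by norm_num [abs_of_pos]),
      deriv_scaled_eq_zero hh H.h_le (by norm_num [abs_of_pos])⟩ hlam hN hT H.one_le_sqrt_mul
  have hsq : Integrable fun x => scaled h x ^ 2 :=
    integrable_of_eq_zero (by fun_prop) fun x hx => by simp [hz x hx]
  have hsqint : ∫ x, scaled h x ^ 2 = h * D := integral_comp_div_scale hh fun y => profile y ^ 2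
  have b1 : h * D ≤ ∫ x in Icc (-(3 / 8) : ℝ) (3 / 8), warp m x ^ 2 * scaled h x * scaled h x := by
    rw [setIntegral_Icc_eq (f := fun x => warp m x ^ 2 * scaled h x * scaled h x)
      (fun x hx => by simp [hz x hx]), ← hsqint]
    refine integral_mono hsq (integrable_of_eq_zero (by fun_prop) fun x hx => by simp [hz x hx])
      fun x => ?_
    have := one_le_warp_sq m x
    simp only
    nlinarith [sq_nonneg (scaled h x)]
  have b2 : ∫ x in Icc (-(3 / 8) : ℝ) (3 / 8), (warp m x ^ 2 * scaled h x) ^ 2 ≤ 4 * (h * D) := by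
    rw [setIntegral_Icc_eq (f := fun x => (warp m x ^ 2 * scaled h x) ^ 2)
      (fun x hx => by simp [hz x hx]), ← hsqint, ← integral_const_mul]
    refine integral_mono (integrable_of_eq_zero (by fun_prop) fun x hx => by simp [hz x hx])
      (hsq.const_mul 4) fun x => ?_
    simp only
    rcases lt_or_ge (1 / 4) |x| with hx | hx
    · simp [hz x hx]
    · have h1 := warp_sq_le_two hm (x := x) (by linarith)
      have h2 := one_le_warp_sq m x
      rw [mul_pow]
      have : (warp m x ^ 2) ^ 2 ≤ 4 := by nlinarith
      gcongr
  have b3 : ∫ x in Icc (-(3 / 8) : ℝ) (3 / 8), radialResidue m lam (scaled h) x ^ 2 ≤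
      (h ^ 3)⁻¹ * D' := by
    have hle := abs_radialResidue_scaled_le hm hC0 hC hh H.h_le H.lam_mul
    have hcr := continuous_residueBound C
    have hz' : ∀ x, 1 / 4 < |x| → residueBound C (x / h) = 0 := fun x hx =>
      residueBound_eq_zero C (quarter_lt_abs_div hh H.h_le hx)
    have hp : ∀ x, radialResidue m lam (scaled h) x ^ 2 ≤
        (h ^ 4)⁻¹ * residueBound C (x / h) ^ 2 := fun x => by
      rw [← sq_abs]
      refine (pow_le_pow_left₀ (abs_nonneg _) (hle x) 2).trans (le_of_eq ?_)
      rw [mul_pow, inv_pow]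
      ring
    have hi : Integrable fun x => (h ^ 4)⁻¹ * residueBound C (x / h) ^ 2 :=
      integrable_of_eq_zero (by fun_prop) fun x hx => by simp [hz' x hx]
    have hrz : ∀ x, 1 / 4 < |x| → radialResidue m lam (scaled h) x = 0 := fun x hx => by
      have := hle x
      rw [hz' x hx, mul_zero] at this
      exact abs_nonpos_iff.1 this
    have hrc := continuous_radialResidue (contDiff_scaled h) m lam
    rw [setIntegral_Icc_eq (f := fun x => radialResidue m lam (scaled h) x ^ 2)
      (fun x hx => by simp [hrz x hx])]
    refine (integral_mono (integrable_of_eq_zero (by fun_prop) fun x hx => by simp [hrz x hx])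
      hi hp).trans (le_of_eq ?_)
    rw [integral_const_mul, integral_comp_div_scale hh fun y => residueBound C y ^ 2, ← hD']
    field_simp
  set K := ∫ t in (0 : ℝ)..T, slabEnergy u t with hK
  have hK0 : 0 ≤ K := intervalIntegral.integral_nonneg hT.le fun t _ =>
    integral_nonneg fun p => sq_nonneg _
  -- With this choice of T the forcing term h⁴ · h⁻³ has the same size h as the term coming from the
  -- pairing itself.
  have hT2 : T ^ 2 / lam = h ^ 4 := by
    rw [H.time_eq, mul_pow, Real.sq_sqrt hl.le]
    field_simp
  rw [hT2] at hmain
  have hfin : (h * D * N) ^ 2 * (T / 4) ≤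
      2 * (N / lam * (4 * (h * D)) + h ^ 4 * (N / lam * ((h ^ 3)⁻¹ * D'))) * K := by
    calc _ ≤ _ := by gcongr
      _ ≤ _ := hmain
      _ ≤ _ := by gcongr
  have e : 2 * (N / lam * (4 * (h * D)) + h ^ 4 * (N / lam * ((h ^ 3)⁻¹ * D'))) * K =
      (2 * (4 * D + D') * K) * (h * N / lam) := by
    field_simp
  have e' : (h * D * N) ^ 2 * (T / 4) = (D ^ 2 / 4 * (lam * T * N * h)) * (h * N / lam) := by
    field_simp
  rw [e, e'] at hfin
  have hf2 := le_of_mul_le_mul_right hfin (by positivity)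
  rw [div_mul_eq_mul_div, div_le_iff₀ (by positivity)]
  linarith

/-! ### The norms of separated functions -/

section Separated

variable {m ℓ : ℕ} {Y : S2 → ℝ}

theorem IsSphericalHarmonic.continuous_sphGrad (hY : IsSphericalHarmonic ℓ Y) :
    Continuous fun θ => sphGrad Y θ :=
  (WarpedWave.continuous_sphGrad (smoothOnSpacetime_const hY.contMDiff_two)).comp
    (by fun_prop : Continuous fun θ : S2 => ((0 : ℝ), (0 : ℝ), θ))

theorem IsSphericalHarmonic.integral_norm_sphGrad_sq (hY : IsSphericalHarmonic ℓ Y) :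
    ∫ θ, ‖sphGrad Y θ‖ ^ 2 ∂sigma = (ℓ : ℝ) * (ℓ + 1) * ∫ θ, Y θ * Y θ ∂sigma := by
  simpa only [real_inner_self_eq_norm_sq] using hY.integral_inner_sphGrad hY.contMDiff_two

/-- The factor a² is the density of dV; it cancels the a⁻² of the angular gradient, so angular norms
reduce to integrals against dx dσ. -/
theorem angGradNorm_mul_sq (hY : IsSphericalHarmonic ℓ Y) (f : ℝ → ℝ) (x : ℝ) (θ : S2) :
    warp m x ^ 2 * angGradNorm m (fun x θ => f x * Y θ) x θ ^ 2 =
      f x ^ 2 * ‖sphGrad Y θ‖ ^ 2 := by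
  have hw := (warp_pos m x).ne'
  rw [angGradNorm, sphGrad_smul _ (hY.contMDiff_two.of_le (by norm_num)), norm_smul, mul_pow,
    mul_pow, Real.norm_eq_abs, sq_abs]
  field_simp

theorem continuous_angGradNorm_mul (hY : IsSphericalHarmonic ℓ Y) {f : ℝ → ℝ} (hf : Continuous f) :
    Continuous fun p : ℝ × S2 => angGradNorm m (fun x θ => f x * Y θ) p.1 p.2 := by
  have h1 := hY.continuous_sphGrad
  have h2 : Continuous fun x => (warp m x)⁻¹ :=
    ((contDiff_warp (n := 0) m).continuous).inv₀ fun x => (warp_pos m x).ne'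
  have h3 : Continuous fun p : ℝ × S2 => f p.1 • sphGrad Y p.2 := by fun_prop
  simp only [angGradNorm, sphGrad_smul _ (hY.contMDiff_two.of_le (by norm_num : (1 : ℕ∞ω) ≤ 2))]
  exact (h2.comp continuous_fst).mul h3.norm

theorem sqNorm_angGradNorm_mul (hY : IsSphericalHarmonic ℓ Y) {f : ℝ → ℝ} (hf : Continuous f)
    (hfi : Integrable fun x => f x ^ 2) :
    sqNorm m (angGradNorm m fun x θ => f x * Y θ) =
      ENNReal.ofReal ((∫ x, f x ^ 2) * ((ℓ : ℝ) * (ℓ + 1) * ∫ θ, Y θ * Y θ ∂sigma)) := by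
  have h1 := hY.continuous_sphGrad
  have h2 : Continuous fun p : ℝ × S2 => angGradNorm m (fun x θ => f x * Y θ) p.1 p.2 ^ 2 :=
    (continuous_angGradNorm_mul hY hf).pow 2
  rw [sqNorm, lintegral_volM m h2.measurable.ennreal_ofReal, ← hY.integral_norm_sphGrad_sq,
    ← lintegral_ofReal_mul hfi (fun x => sq_nonneg _) (by fun_prop) (fun θ => sq_nonneg _)]
  refine lintegral_congr fun p => ?_
  rw [← ENNReal.ofReal_mul (sq_nonneg _), angGradNorm_mul_sq hY]

theorem energy_mul (hY : IsSphericalHarmonic ℓ Y) {f f' : ℝ → ℝ}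
    (hf : ∀ x, HasDerivAt f (f' x) x)
    (hfc : Continuous f') (hfi : Integrable fun x => f x ^ 2)
    (hfi' : Integrable fun x => warp m x ^ 2 * f' x ^ 2) {v : ℝ → ℝ → S2 → ℝ}
    (hv : v 0 = fun x θ => f x * Y θ) (hv' : ∀ x θ, deriv (fun t => v t x θ) 0 = 0) :
    energy m v 0 =
      ENNReal.ofReal ((∫ x, warp m x ^ 2 * f' x ^ 2) * ∫ θ, Y θ * Y θ ∂sigma) +
      ENNReal.ofReal ((∫ x, f x ^ 2) * ((ℓ : ℝ) * (ℓ + 1) * ∫ θ, Y θ * Y θ ∂sigma)) := by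
  have hYc : Continuous Y := hY.1.continuous
  have hfc0 : Continuous f := continuous_iff_continuousAt.2 fun x => (hf x).continuousAt
  have hg := continuous_angGradNorm_mul (m := m) hY hfc0
  have hwc : Continuous (warp m) := (contDiff_warp (n := 0) m).continuous
  have e : ∀ p : ℝ × S2, sqDeriv m v 0 p.1 p.2 =
      f' p.1 ^ 2 * (Y p.2 * Y p.2) + angGradNorm m (fun x θ => f x * Y θ) p.1 p.2 ^ 2 := by
    intro p
    rw [sqDeriv, hv', hv, ((hf p.1).mul_const (Y p.2)).deriv]
    ring
  have hm1 : Continuous fun p : ℝ × S2 => f' p.1 ^ 2 * (Y p.2 * Y p.2) := by fun_prop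
  simp only [energy, e]
  have hadd : ∀ p : ℝ × S2, ENNReal.ofReal
      (f' p.1 ^ 2 * (Y p.2 * Y p.2) + angGradNorm m (fun x θ => f x * Y θ) p.1 p.2 ^ 2) =
      ENNReal.ofReal (f' p.1 ^ 2 * (Y p.2 * Y p.2)) +
        ENNReal.ofReal (angGradNorm m (fun x θ => f x * Y θ) p.1 p.2 ^ 2) := fun p =>
    ENNReal.ofReal_add (mul_nonneg (sq_nonneg _) (mul_self_nonneg _)) (sq_nonneg _)
  simp only [hadd]
  rw [lintegral_add_left hm1.measurable.ennreal_ofReal]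
  refine congr_arg₂ (· + ·) ?_ (sqNorm_angGradNorm_mul hY hfc0 hfi)
  rw [lintegral_volM m hm1.measurable.ennreal_ofReal, ← lintegral_ofReal_mul hfi'
    (fun x => by positivity) (by fun_prop) (fun θ => mul_self_nonneg _)]
  refine lintegral_congr fun p => ?_
  rw [← ENNReal.ofReal_mul (sq_nonneg _), mul_assoc]

end Separated

/-! ### The angular energy in the slab -/

section SlabNorms

variable {m : ℕ} {u : ℝ → ℝ → S2 → ℝ}

/-- The same cancellation of a² against a⁻², for general u; it is the reason `slab` carries dx dσ
rather than dV. -/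
theorem setLIntegral_angGradNorm_slab (hu : SmoothOnSpacetime 2 u) (t : ℝ) :
    ∫⁻ p in Icc (-(3 / 8) : ℝ) (3 / 8) ×ˢ (univ : Set S2),
        ENNReal.ofReal (angGradNorm m (u t) p.1 p.2 ^ 2) ∂(volM m) =
      ENNReal.ofReal (slabEnergy u t) := by
  have hG : Continuous fun p : ℝ × S2 => sphGrad (u t p.1) p.2 :=
    continuous_slice (U := fun t x θ => sphGrad (u t x) θ) (continuous_sphGrad hu) t
  have hw : Continuous fun x => (warp m x)⁻¹ :=
    ((contDiff_warp (n := 0) m).continuous).inv₀ fun x => (warp_pos m x).ne'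
  have hc : Continuous fun p : ℝ × S2 => angGradNorm m (u t) p.1 p.2 ^ 2 := by
    unfold angGradNorm
    exact ((hw.comp continuous_fst).mul hG.norm).pow 2
  rw [slabEnergy, ofReal_integral_eq_lintegral_ofReal (integrable_slab (by fun_prop))
    (ae_of_all _ fun p => sq_nonneg _), slab_eq, ← lintegral_indicator measurableSet_slab,
    ← lintegral_indicator measurableSet_slab,
    lintegral_volM m (hc.measurable.ennreal_ofReal.indicator measurableSet_slab)]
  refine lintegral_congr fun p => ?_
  by_cases hp : p ∈ Icc (-(3 / 8) : ℝ) (3 / 8) ×ˢ (univ : Set S2)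
  · rw [indicator_of_mem hp, indicator_of_mem hp, ← ENNReal.ofReal_mul (sq_nonneg _), angGradNorm]
    have := (warp_pos m p.1).ne'
    congr 1
    field_simp
  · rw [indicator_of_notMem hp, indicator_of_notMem hp, mul_zero]

theorem setLIntegral_slabEnergy (hu : SmoothOnSpacetime 2 u) {T : ℝ} (hT : 0 ≤ T) :
    ∫⁻ t in Icc 0 T, ENNReal.ofReal (slabEnergy u t) =
      ENNReal.ofReal (∫ t in (0 : ℝ)..T, slabEnergy u t) := by
  rw [intervalIntegral.integral_of_le hT, ← integral_Icc_eq_integral_Ioc,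
    ofReal_integral_eq_lintegral_ofReal
      ((continuous_slabEnergy hu).continuousOn.integrableOn_compact isCompact_Icc)
      (ae_of_all _ fun t => integral_nonneg fun p => sq_nonneg _)]

theorem slabEnergy_le_lintegral_cutoff (hu : SmoothOnSpacetime 2 u) {β : ℝ → ℝ}
    (hβ : ∀ ρ : ℝ, ρ < 1 / 2 → β ρ = 1) {T : ℝ} (hT : 0 ≤ T) :
    ENNReal.ofReal (∫ t in (0 : ℝ)..T, slabEnergy u t) ≤
      ∫⁻ t in Icc 0 T, sqNorm m (fun x θ => β |x| * angGradNorm m (u t) x θ) := by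
  rw [← setLIntegral_slabEnergy hu hT]
  refine lintegral_mono fun t => ?_
  rw [← setLIntegral_angGradNorm_slab (m := m) hu, sqNorm]
  refine (le_of_eq ?_).trans (setLIntegral_le_lintegral (Icc (-(3 / 8) : ℝ) (3 / 8) ×ˢ univ) _)
  refine setLIntegral_congr_fun measurableSet_slab fun p hp => ?_
  -- The half-width 3/8 lies below 1/2, where the cutoff is still 1, and above 1/4, beyond which the
  -- rescaled profile vanishes.
  have hx : |p.1| < 1 / 2 := by
    have := hp.1
    rw [abs_lt]
    constructor <;> linarith [this.1, this.2]
  simp only [hβ _ hx, one_mul]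

theorem slabEnergy_le_sqNormLE1 (hu : SmoothOnSpacetime 2 u) {T : ℝ} (hT : 0 ≤ T) :
    ENNReal.ofReal (∫ t in (0 : ℝ)..T, slabEnergy u t) ≤ sqNormLE1 m T u := by
  -- The slab lies inside the first dyadic region 1 ≤ ⟨x⟩ < 2.
  refine le_trans ?_ (le_iSup _ 0)
  rw [← setLIntegral_slabEnergy hu hT, pow_zero, inv_one, one_mul]
  refine lintegral_mono fun t => ?_
  rw [← setLIntegral_angGradNorm_slab (m := m) hu]
  refine (lintegral_mono fun p => ENNReal.ofReal_le_ofReal ?_).trans (lintegral_mono_set ?_)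
  · rw [sqDeriv]
    have : 0 ≤ (1 + p.1 ^ 2)⁻¹ * u t p.1 p.2 ^ 2 := by positivity
    nlinarith [sq_nonneg (deriv (fun t' => u t' p.1 p.2) t),
      sq_nonneg (deriv (fun x' => u t x' p.2) p.1)]
  · refine prod_mono (fun x hx => ?_) subset_rfl
    have hx2 : x ^ 2 < 3 := by nlinarith [hx.1, hx.2]
    refine ⟨?_, ?_⟩
    · rw [pow_zero, Real.one_le_sqrt]
      linarith [sq_nonneg x]
    · rw [Real.sqrt_lt' (by norm_num)]
      norm_num
      linarith

end SlabNorms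

/-! ### The multiplier of `⟨D_ω⟩^s` on spherical harmonics -/

/-- The multiplier `(1 + lam a⁻²)^{s/2}`. -/
def angWeight (m : ℕ) (lam s x : ℝ) : ℝ := (1 + lam / warp m x ^ 2) ^ (s / 2)

section Weight

variable {m : ℕ} {lam : ℝ}

theorem one_le_angWeight_base (hlam : 1 ≤ lam) (x : ℝ) : 1 ≤ 1 + lam / warp m x ^ 2 := by
  have := warp_pos m x
  have : 0 ≤ lam / warp m x ^ 2 := by positivity
  linarith

theorem angWeight_pos (hlam : 1 ≤ lam) (s x : ℝ) : 0 < angWeight m lam s x :=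
  Real.rpow_pos_of_pos (by linarith [one_le_angWeight_base (m := m) hlam x]) _

theorem angWeight_sq (hlam : 1 ≤ lam) (s x : ℝ) :
    angWeight m lam s x ^ 2 = (1 + lam / warp m x ^ 2) ^ s := by
  rw [angWeight, ← Real.rpow_natCast, ← Real.rpow_mul
    (by linarith [one_le_angWeight_base (m := m) hlam x])]
  congr 1
  push_cast
  ring

theorem angWeight_sq_le (hm : 1 ≤ m) (hlam : 1 ≤ lam) (s : ℝ) {x : ℝ} (hx : |x| ≤ 1) :
    angWeight m lam s x ^ 2 ≤ 2 ^ |s| * lam ^ s := by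
  have hW1 := one_le_warp_sq m x
  have hW2 := warp_sq_le_two hm hx
  have hW0 : 0 < warp m x ^ 2 := by linarith
  have hl : 0 < lam := by linarith
  -- The base of the weight is b λ with b between 1/2 and 2. The power of b is at most 2^|s| for
  -- either sign of s; negative s is needed because the loss minus δ may be negative.
  set b := lam⁻¹ + (warp m x ^ 2)⁻¹ with hb
  have hb2 : b ≤ 2 := by
    have h1 : lam⁻¹ ≤ 1 := inv_le_one_of_one_le₀ hlam
    have h2 : (warp m x ^ 2)⁻¹ ≤ 1 := inv_le_one_of_one_le₀ hW1
    linarith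
  have hb1 : 2⁻¹ ≤ b := by
    have h1 : 0 ≤ lam⁻¹ := by positivity
    have h2 : (2 : ℝ)⁻¹ ≤ (warp m x ^ 2)⁻¹ := by gcongr
    linarith
  have hb0 : 0 < b := by linarith [show (0 : ℝ) < 2⁻¹ by norm_num]
  have e : 1 + lam / warp m x ^ 2 = b * lam := by
    rw [hb]
    field_simp
  rw [angWeight_sq hlam, e, Real.mul_rpow hb0.le hl.le]
  gcongr
  rcases le_total 0 s with hs | hs
  · rw [abs_of_nonneg hs]
    exact Real.rpow_le_rpow hb0.le hb2 hs
  · rw [abs_of_nonpos hs, Real.rpow_neg (by norm_num), ← Real.inv_rpow (by norm_num)]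
    exact Real.rpow_le_rpow_of_nonpos (by norm_num) hb1 hs

theorem one_le_angWeight (hlam : 1 ≤ lam) {s : ℝ} (hs : 0 ≤ s) (x : ℝ) :
    1 ≤ angWeight m lam s x :=
  Real.one_le_rpow (one_le_angWeight_base hlam x) (by linarith)

theorem contDiff_angWeight (hlam : 1 ≤ lam) (s : ℝ) : ContDiff ℝ ∞ (angWeight m lam s) :=
  (contDiff_const.add (contDiff_const.div ((contDiff_warp m).pow 2)
    fun x => pow_ne_zero 2 (warp_pos m x).ne')).rpow_const_of_ne fun x =>
      (one_pos.trans_le (one_le_angWeight_base hlam x)).ne'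

/-- The logarithmic derivative of the weight is -(s/2) W' λ/(W² + λW) with W = a² ≥ 1, which is
bounded uniformly in λ. Differentiating the weight therefore costs no power of the frequency. -/
theorem abs_deriv_angWeight_le (hlam : 1 ≤ lam) (s : ℝ) {C x : ℝ}
    (hC : |deriv (fun y => warp m y ^ 2) x| ≤ C) :
    |deriv (angWeight m lam s) x| ≤ |s| * C * angWeight m lam s x := by
  have hwd : HasDerivAt (fun y => warp m y ^ 2) (deriv (fun y => warp m y ^ 2) x) x :=
    (((contDiff_warp (n := 1) m).pow 2).differentiable (by norm_num) x).hasDerivAt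
  have hW1 := one_le_warp_sq m x
  have hB1 := one_le_angWeight_base (m := m) hlam x
  set W := warp m x ^ 2 with hW
  set W' := deriv (fun y => warp m y ^ 2) x with hW'
  have hd := (((hasDerivAt_const x lam).div hwd (by linarith)).const_add 1).rpow_const
    (p := s / 2) (Or.inl (by simp only [Pi.div_apply]; linarith))
  have e : deriv (angWeight m lam s) x = -(s / 2) * W' * (lam / (W ^ 2 + lam * W)) *
      angWeight m lam s x := by
    refine (HasDerivAt.deriv (f := angWeight m lam s) hd).trans ?_
    simp only [Pi.div_apply, ← hW]
    rw [Real.rpow_sub_one (by linarith), angWeight, ← hW]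
    have : 0 < W := by linarith
    have : 0 < lam := by linarith
    have : 0 < W + lam := by positivity
    field_simp
    ring
  have hq : lam / (W ^ 2 + lam * W) ≤ 1 := by
    rw [div_le_one (by nlinarith)]
    nlinarith
  have hq0 : 0 ≤ lam / (W ^ 2 + lam * W) := div_nonneg (by linarith) (by nlinarith)
  rw [e, abs_mul, abs_of_pos (angWeight_pos hlam s x), abs_mul, abs_mul, abs_neg, abs_of_nonneg hq0,
    abs_div, abs_two]
  have hp := angWeight_pos (m := m) hlam s x
  refine mul_le_mul_of_nonneg_right ?_ hp.le
  calc |s| / 2 * |W'| * (lam / (W ^ 2 + lam * W)) ≤ |s| / 2 * |W'| * 1 := by gcongr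
    _ ≤ |s| * C := by
      rw [mul_one]
      gcongr
      linarith [abs_nonneg s]

end Weight

/-! ### The separated data -/

section Data

variable {m ℓ : ℕ} {Y : S2 → ℝ} {h T lam N : ℝ}

theorem isTestFunction_mul (hY : IsSphericalHarmonic ℓ Y) {φ : ℝ → ℝ} (hφ : ContDiff ℝ ∞ φ)
    (hφc : HasCompactSupport φ) : IsTestFunction fun x θ => φ x * Y θ := by
  refine ⟨(hφ.contMDiff.comp contMDiff_fst).mul (hY.1.comp contMDiff_snd), ?_⟩
  refine HasCompactSupport.intro (K := tsupport φ ×ˢ (univ : Set S2))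
    (IsCompact.prod hφc isCompact_univ) fun p hp => ?_
  have : p.1 ∉ tsupport φ := fun hx => hp ⟨hx, mem_univ _⟩
  simp only [image_eq_zero_of_notMem_tsupport this, zero_mul]

theorem isTestFunction_zero : IsTestFunction fun _ _ => 0 :=
  ⟨contMDiff_const, HasCompactSupport.zero⟩

theorem isSphericalHarmonic_zero (ℓ : ℕ) : IsSphericalHarmonic ℓ fun _ => 0 := by
  simpa using (isSphericalHarmonic_sectoral ℓ).const_mul 0

theorem angPow_zero (s : ℝ) : angPow m s (fun _ _ => 0) = fun _ _ => 0 := by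
  simpa using angPow_mul m s (isSphericalHarmonic_zero 0) (fun _ => (0 : ℝ))

theorem integral_weighted_scaled_sq_le (hm : 1 ≤ m) (H : TrappingScales m lam h T) (s : ℝ) :
    ∫ x, (angWeight m lam s x * scaled h x) ^ 2 ≤
      2 ^ |s| * (∫ x, profile x ^ 2) * (lam ^ s * h) := by
  have hz : ∀ x, 1 / 4 < |x| → scaled h x = 0 := fun x => scaled_eq_zero H.h_pos H.h_le
  have hwc := (contDiff_angWeight (m := m) H.lam_ge s).continuous
  have hsc := (contDiff_scaled h).continuous
  have e : ∫ x, scaled h x ^ 2 = h * ∫ x, profile x ^ 2 :=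
    integral_comp_div_scale H.h_pos fun y => profile y ^ 2
  calc _ ≤ ∫ x, 2 ^ |s| * lam ^ s * scaled h x ^ 2 := by
        refine integral_mono (integrable_of_eq_zero (by fun_prop) fun x hx => by simp [hz x hx])
          (integrable_of_eq_zero (by fun_prop) fun x hx => by simp [hz x hx]) fun x => ?_
        simp only
        rcases lt_or_ge (1 / 4) |x| with hx | hx
        · simp [hz x hx]
        · rw [mul_pow]
          gcongr
          exact angWeight_sq_le hm H.lam_ge s (by linarith)
    _ = _ := by
      rw [integral_const_mul, e]
      ring

/-- For s ≥ 0 the weight is at least 1. The bound serves to show that the data norm is positive. -/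
theorem le_integral_weighted_scaled_sq (H : TrappingScales m lam h T) {s : ℝ} (hs : 0 ≤ s) :
    h * ∫ x, profile x ^ 2 ≤ ∫ x, (angWeight m lam s x * scaled h x) ^ 2 := by
  have hz : ∀ x, 1 / 4 < |x| → scaled h x = 0 := fun x => scaled_eq_zero H.h_pos H.h_le
  have hwc := (contDiff_angWeight (m := m) H.lam_ge s).continuous
  have hsc := (contDiff_scaled h).continuous
  rw [← integral_comp_div_scale H.h_pos fun y => profile y ^ 2]
  refine integral_mono (f := fun x => scaled h x ^ 2)
    (integrable_of_eq_zero (by fun_prop) fun x hx => by simp [hz x hx])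
    (integrable_of_eq_zero (by fun_prop) fun x hx => by simp [hz x hx]) fun x => ?_
  simp only [mul_pow]
  exact le_mul_of_one_le_left (sq_nonneg _) (one_le_pow₀ (one_le_angWeight H.lam_ge hs x))

theorem integral_deriv_weighted_scaled_sq_le (hm : 1 ≤ m) (H : TrappingScales m lam h T) (s : ℝ)
    {C : ℝ} (hC : ∀ x, |x| ≤ 1 → |deriv (fun y => warp m y ^ 2) x| ≤ C) :
    ∫ x, warp m x ^ 2 * (deriv (angWeight m lam s) x * scaled h x +
        angWeight m lam s x * deriv (scaled h) x) ^ 2 ≤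
      2 ^ |s| * (4 * ((|s| * C) ^ 2 * (∫ x, profile x ^ 2) + ∫ x, deriv profile x ^ 2)) *
        (lam ^ s * lam * h) := by
  have hh := H.h_pos
  have hl := H.lam_pos
  have hz : ∀ x, 1 / 4 < |x| → scaled h x = 0 := fun x => scaled_eq_zero H.h_pos H.h_le
  have hz' : ∀ x, 1 / 4 < |x| → deriv (scaled h) x = 0 := fun x =>
    deriv_scaled_eq_zero H.h_pos H.h_le
  have hwa : Continuous (warp m) := (contDiff_warp (n := 0) m).continuous
  have hwc := (contDiff_angWeight (m := m) H.lam_ge s).continuous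
  have hwc' := (contDiff_infty_iff_deriv.1 (contDiff_angWeight (m := m) H.lam_ge s)).2.continuous
  have hsc := (contDiff_scaled h).continuous
  have hsc' := (contDiff_infty_iff_deriv.1 (contDiff_scaled h)).2.continuous
  set D := ∫ x, profile x ^ 2 with hD
  set D' := ∫ x, deriv profile x ^ 2 with hD'
  have hD0 : 0 ≤ D := integral_nonneg fun x => sq_nonneg _
  have hD'0 : 0 ≤ D' := integral_nonneg fun x => sq_nonneg _
  have e : ∫ x, scaled h x ^ 2 = h * D := integral_comp_div_scale hh fun y => profile y ^ 2
  have e' : ∫ x, deriv (scaled h) x ^ 2 = h⁻¹ * D' := by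
    have h1 : ∀ x, deriv (scaled h) x ^ 2 = (h ^ 2)⁻¹ * deriv profile (x / h) ^ 2 := fun x => by
      simp only [deriv_scaled]
      field_simp
    simp only [h1]
    rw [integral_const_mul, integral_comp_div_scale hh fun y => deriv profile y ^ 2, ← hD']
    field_simp
  have hi1 : Integrable fun x => (|s| * C) ^ 2 * scaled h x ^ 2 :=
    integrable_of_eq_zero (by fun_prop) fun x hx => by simp [hz x hx]
  have hi2 : Integrable fun x => deriv (scaled h) x ^ 2 :=
    integrable_of_eq_zero (by fun_prop) fun x hx => by simp [hz' x hx]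
  calc _ ≤ ∫ x, 2 ^ |s| * lam ^ s * 4 *
          ((|s| * C) ^ 2 * scaled h x ^ 2 + deriv (scaled h) x ^ 2) := by
        refine integral_mono (integrable_of_eq_zero (by fun_prop) fun x hx => by
          simp [hz x hx, hz' x hx]) ((hi1.add hi2).const_mul _) fun x => ?_
        simp only
        rcases lt_or_ge (1 / 4) |x| with hx | hx
        · simp [hz x hx, hz' x hx]
        have hx1 : |x| ≤ 1 := by linarith
        have h1 := abs_deriv_angWeight_le H.lam_ge s (hC x hx1)
        have h2 := angWeight_sq_le hm H.lam_ge s hx1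
        have h3 := warp_sq_le_two hm hx1
        have h4 : deriv (angWeight m lam s) x ^ 2 ≤ (|s| * C) ^ 2 * angWeight m lam s x ^ 2 := by
          rw [← sq_abs, ← mul_pow]
          gcongr
        calc _ ≤ 2 * (2 * ((deriv (angWeight m lam s) x * scaled h x) ^ 2 +
              (angWeight m lam s x * deriv (scaled h) x) ^ 2)) := by
              gcongr
              exact add_sq_le
          _ = 4 * (deriv (angWeight m lam s) x ^ 2 * scaled h x ^ 2 +
              angWeight m lam s x ^ 2 * deriv (scaled h) x ^ 2) := by ring
          _ ≤ 4 * ((|s| * C) ^ 2 * angWeight m lam s x ^ 2 * scaled h x ^ 2 +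
              angWeight m lam s x ^ 2 * deriv (scaled h) x ^ 2) := by gcongr
          _ = angWeight m lam s x ^ 2 *
              (4 * ((|s| * C) ^ 2 * scaled h x ^ 2 + deriv (scaled h) x ^ 2)) := by ring
          _ ≤ 2 ^ |s| * lam ^ s *
              (4 * ((|s| * C) ^ 2 * scaled h x ^ 2 + deriv (scaled h) x ^ 2)) := by gcongr
          _ = _ := by ring
    _ = 2 ^ |s| * lam ^ s * 4 * ((|s| * C) ^ 2 * (h * D) + h⁻¹ * D') := by
      rw [integral_const_mul, integral_add hi1 hi2, integral_const_mul, e, e']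
    _ ≤ 2 ^ |s| * lam ^ s * 4 * ((|s| * C) ^ 2 * (lam * h * D) + lam * h * D') := by
      have h1 : h ≤ lam * h := le_mul_of_one_le_left hh.le H.lam_ge
      -- Since λ h² ≥ 1, the radial derivative of the data is dominated by the angular one.
      have h2 : h⁻¹ ≤ lam * h := by
        rw [inv_le_iff_one_le_mul₀ hh]
        exact H.one_le_lam_mul_sq.trans (le_of_eq (by ring))
      gcongr
    _ = _ := by ring

end Data

/-! ### The data norm and the energy of the rescaled data -/

section FinalEstimates

variable {m : ℕ}

theorem sqDataNorm_scaled {ℓ : ℕ} {Y : S2 → ℝ} (hY : IsSphericalHarmonic ℓ Y) {h T : ℝ}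
    (H : TrappingScales m ((ℓ : ℝ) * (ℓ + 1)) h T) (s : ℝ) :
    sqDataNorm m s (fun x θ => scaled h x * Y θ) (fun _ _ => 0) =
      ENNReal.ofReal ((∫ x, (angWeight m ((ℓ : ℝ) * (ℓ + 1)) s x * scaled h x) ^ 2) *
        ((ℓ : ℝ) * (ℓ + 1) * ∫ θ, Y θ * Y θ ∂sigma)) := by
  have hwc := (contDiff_angWeight (m := m) H.lam_ge s).continuous
  have hsc := (contDiff_scaled h).continuous
  rw [sqDataNorm, angPow_zero, angPow_mul m s hY (scaled h)]
  have h0 : sqNorm m (fun _ _ => 0) = 0 := by simp [sqNorm]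
  rw [h0, add_zero]
  exact sqNorm_angGradNorm_mul hY (f := fun x => angWeight m ((ℓ : ℝ) * (ℓ + 1)) s x * scaled h x)
    (by fun_prop) (integrable_of_eq_zero (by fun_prop) fun x hx => by
      simp [scaled_eq_zero H.h_pos H.h_le hx])

theorem exists_energy_scaled_le (hm : 1 ≤ m) (s : ℝ) : ∃ C : ℝ, 0 ≤ C ∧
    ∀ (ℓ : ℕ) (Y : S2 → ℝ) (h T : ℝ) (v : ℝ × ℝ → ℝ), IsSphericalHarmonic ℓ Y →
      TrappingScales m ((ℓ : ℝ) * (ℓ + 1)) h T → (∀ x, v (0, x) = scaled h x) →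
      (∀ x, HasDerivAt (fun t => v (t, x)) 0 0) →
      energy m (fun t => angPow m s fun x θ => v (t, x) * Y θ) 0 ≤
        ENNReal.ofReal (C * (((ℓ : ℝ) * (ℓ + 1)) ^ s * ((ℓ : ℝ) * (ℓ + 1)) * h *
          ∫ θ, Y θ * Y θ ∂sigma)) := by
  obtain ⟨C, hC0, hC⟩ := exists_deriv_warp_sq_bound m
  set D := ∫ x, profile x ^ 2 with hD
  set D' := ∫ x, deriv profile x ^ 2 with hD'
  have hD0 : 0 ≤ D := integral_nonneg fun x => sq_nonneg _
  have hD'0 : 0 ≤ D' := integral_nonneg fun x => sq_nonneg _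
  refine ⟨2 ^ |s| * (4 * ((|s| * C) ^ 2 * D + D')) + 2 ^ |s| * D, by positivity, ?_⟩
  intro ℓ Y h T v hY H hv hv'
  set lam : ℝ := (ℓ : ℝ) * (ℓ + 1) with hlam
  set N := ∫ θ, Y θ * Y θ ∂sigma with hN
  have hN0 : 0 ≤ N := integral_nonneg fun θ => mul_self_nonneg _
  have hh := H.h_pos
  have hl := H.lam_pos
  have hz : ∀ x, 1 / 4 < |x| → scaled h x = 0 := fun x => scaled_eq_zero H.h_pos H.h_le
  have hz' : ∀ x, 1 / 4 < |x| → deriv (scaled h) x = 0 := fun x =>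
    deriv_scaled_eq_zero H.h_pos H.h_le
  have hwa : Continuous (warp m) := (contDiff_warp (n := 0) m).continuous
  have hwd := contDiff_angWeight (m := m) H.lam_ge s
  have hwc := hwd.continuous
  have hwc' := (contDiff_infty_iff_deriv.1 hwd).2.continuous
  have hsc := (contDiff_scaled h).continuous
  have hsc' := (contDiff_infty_iff_deriv.1 (contDiff_scaled h)).2.continuous
  have e : ∀ t, angPow m s (fun x θ => v (t, x) * Y θ) =
      fun x θ => angWeight m lam s x * v (t, x) * Y θ := fun t =>
    angPow_mul m s hY fun x => v (t, x)
  have hf : ∀ x, HasDerivAt (fun x => angWeight m lam s x * scaled h x)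
      (deriv (angWeight m lam s) x * scaled h x + angWeight m lam s x * deriv (scaled h) x) x :=
    fun x => ((hwd.differentiable (by simp) x).hasDerivAt).mul
      (((contDiff_scaled h).differentiable (by simp) x).hasDerivAt)
  simp only [e]
  rw [energy_mul hY hf (by fun_prop)
    (integrable_of_eq_zero (by fun_prop) fun x hx => by simp [hz x hx])
    (integrable_of_eq_zero (by fun_prop) fun x hx => by simp [hz x hx, hz' x hx])
    (by simp only [hv]) (fun x θ => by
      simpa using (((hv' x).const_mul (angWeight m lam s x)).mul_const (Y θ)).deriv)]
  rw [← ENNReal.ofReal_add (mul_nonneg (integral_nonneg fun x => by positivity) hN0)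
    (mul_nonneg (integral_nonneg fun x => sq_nonneg _) (by positivity))]
  refine ENNReal.ofReal_le_ofReal ?_
  have h1 := integral_deriv_weighted_scaled_sq_le hm H s hC
  have h2 := integral_weighted_scaled_sq_le hm H s
  rw [← hD, ← hD'] at h1
  rw [← hD] at h2
  calc _ ≤ 2 ^ |s| * (4 * ((|s| * C) ^ 2 * D + D')) * (lam ^ s * lam * h) * N +
        2 ^ |s| * D * (lam ^ s * h) * (lam * N) := by gcongr
    _ = _ := by ring

end FinalEstimates

theorem loss_nonneg {m : ℕ} (hm : 1 ≤ m) : 0 ≤ loss m := by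
  have hm' : (1 : ℝ) ≤ m := by exact_mod_cast hm
  exact div_nonneg (by linarith) (by linarith)

theorem one_le_eigenvalue {ℓ : ℕ} (hℓ : 1 ≤ ℓ) : (1 : ℝ) ≤ (ℓ : ℝ) * (ℓ + 1) := by
  have hℓ' : (1 : ℝ) ≤ ℓ := by exact_mod_cast hℓ
  nlinarith

end WarpedWave

end

/-! ### The main theorem -/

open WarpedWave in
theorem theorem1p3 (m : ℕ) (hm : 1 ≤ m) (β : ℝ → ℝ) (hβ_smooth : ContDiff ℝ ∞ β)
    (hβ_mono : Antitone β) (hβ_one : ∀ ρ : ℝ, ρ < 1 / 2 → β ρ = 1)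
    (hβ_zero : ∀ ρ : ℝ, 1 < ρ → β ρ = 0) :
    (∃ c : ℝ, 0 < c ∧ ∃ L : ℕ, ∀ ℓ : ℕ, L ≤ ℓ →
      ∃ ψ₀ ψ₁ : ℝ → S2 → ℝ, ∃ T : ℝ, 0 < T ∧
        IsTestFunction ψ₀ ∧ IsTestFunction ψ₁ ∧
        (∀ x, IsSphericalHarmonic ℓ (ψ₀ x)) ∧ (∀ x, IsSphericalHarmonic ℓ (ψ₁ x)) ∧
        0 < sqDataNorm m (loss m) ψ₀ ψ₁ ∧
        (∃ ψ : ℝ → ℝ → S2 → ℝ, IsWaveSolution m ∞ ψ₀ ψ₁ ψ) ∧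
        ∀ ψ : ℝ → ℝ → S2 → ℝ, IsWaveSolution m 2 ψ₀ ψ₁ ψ →
          ENNReal.ofReal c * sqDataNorm m (loss m) ψ₀ ψ₁ ≤
            ∫⁻ t in Set.Icc 0 T, sqNorm m (fun x θ => β |x| * angGradNorm m (ψ t) x θ)) ∧
    (∀ δ : ℝ, 0 < δ → ∀ C : ℝ,
      ∃ ψ₀ ψ₁ : ℝ → S2 → ℝ, ∃ T : ℝ, 0 < T ∧
        IsTestFunction ψ₀ ∧ IsTestFunction ψ₁ ∧
        ∃ ψ : ℝ → ℝ → S2 → ℝ, IsWaveSolution m ∞ ψ₀ ψ₁ ψ ∧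
          ENNReal.ofReal C * energy m (fun t => angPow m (loss m - δ) (ψ t)) 0 <
            sqNormLE1 m T ψ) := by
  obtain ⟨c, hc, hlower⟩ := exists_slabEnergy_lower_bound hm
  have hD := integral_profile_sq_pos
  constructor
  · set D := ∫ x, profile x ^ 2 with hDdef
    -- The data norm is at most 2^|loss| D · T λ N h because T = λ^loss, and the slab energy is at
    -- least c T λ N h. The threshold 1 for ℓ guarantees λ ≥ 1.
    refine ⟨c / (2 ^ |loss m| * D), by positivity, 1, fun ℓ hℓ => ?_⟩
    have hlam1 := one_le_eigenvalue hℓ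
    have H := trappingScales m hlam1
    have hY := isSphericalHarmonic_sectoral ℓ
    have hN := sectoral_sq_pos ℓ
    set lam : ℝ := (ℓ : ℝ) * (ℓ + 1) with hlam
    set h := lam ^ (-(1 / (2 * ((m : ℝ) + 1)))) with hh
    set N := ∫ θ, sectoral ℓ θ * sectoral ℓ θ ∂sigma with hNdef
    have hsupp := hasCompactSupport_scaled H.h_pos H.h_le
    have h0 := H.h_pos
    have hl0 := H.lam_pos
    refine ⟨fun x θ => scaled h x * sectoral ℓ θ, fun _ _ => 0, lam ^ loss m, H.time_pos,
      isTestFunction_mul hY (contDiff_scaled h) hsupp, isTestFunction_zero,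
      fun x => hY.const_mul _, fun _ => isSphericalHarmonic_zero ℓ, ?_, ?_, ?_⟩
    · rw [sqDataNorm_scaled hY H, ENNReal.ofReal_pos]
      have := le_integral_weighted_scaled_sq H (loss_nonneg hm)
      exact mul_pos (lt_of_lt_of_le (by positivity) this) (by positivity)
    · obtain ⟨v, -, -, hv⟩ := exists_isWaveSolution hm hY (contDiff_scaled h) hsupp
      exact ⟨_, hv⟩
    · intro ψ hψ
      refine le_trans ?_ (slabEnergy_le_lintegral_cutoff hψ.smooth hβ_one H.time_pos.le)
      rw [sqDataNorm_scaled hY H, ← ENNReal.ofReal_mul (by positivity)]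
      refine ENNReal.ofReal_le_ofReal (le_trans ?_
        (hlower ℓ _ h _ N ψ hℓ hY hNdef hN H hψ))
      have h1 := integral_weighted_scaled_sq_le hm H (loss m)
      calc _ ≤ c / (2 ^ |loss m| * D) * (2 ^ |loss m| * D * (lam ^ loss m * h) * (lam * N)) := by
            gcongr
        _ = _ := by
          rw [← hlam]
          field_simp
  · intro δ hδ C
    obtain ⟨C', hC'0, hC'⟩ := exists_energy_scaled_le hm (loss m - δ)
    -- The surplus λ^δ ≥ ℓ^δ must beat the product of the constants; `max C 0` allows for negative
    -- C.
    obtain ⟨ℓ, hℓ1, hℓ⟩ : ∃ ℓ : ℕ, 1 ≤ ℓ ∧ max C 0 * C' / c < (ℓ : ℝ) ^ δ := by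
      have ht := (tendsto_rpow_atTop hδ).comp tendsto_natCast_atTop_atTop (α := ℕ)
      exact ((eventually_ge_atTop 1).and (ht.eventually_gt_atTop _)).exists
    have hlam1 := one_le_eigenvalue hℓ1
    have H := trappingScales m hlam1
    have hY := isSphericalHarmonic_sectoral ℓ
    have hN := sectoral_sq_pos ℓ
    have hle : (ℓ : ℝ) ^ δ ≤ ((ℓ : ℝ) * (ℓ + 1)) ^ δ := by
      gcongr
      nlinarith [(Nat.cast_nonneg ℓ : (0 : ℝ) ≤ ℓ)]
    set lam : ℝ := (ℓ : ℝ) * (ℓ + 1) with hlam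
    set h := lam ^ (-(1 / (2 * ((m : ℝ) + 1)))) with hh
    set N := ∫ θ, sectoral ℓ θ * sectoral ℓ θ ∂sigma with hNdef
    have hsupp := hasCompactSupport_scaled H.h_pos H.h_le
    have h0 := H.h_pos
    have hl0 := H.lam_pos
    obtain ⟨v, hv0, hv1, hv⟩ := exists_isWaveSolution hm hY (contDiff_scaled h) hsupp
    refine ⟨_, _, lam ^ loss m, H.time_pos, isTestFunction_mul hY (contDiff_scaled h) hsupp,
      isTestFunction_zero, _, hv, ?_⟩
    have hv2 : IsWaveSolution m 2 (fun x θ => scaled h x * sectoral ℓ θ) (fun _ _ => 0)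
        (fun t x θ => v (t, x) * sectoral ℓ θ) :=
      ⟨hv.smooth.of_le ENat.LEInfty.out, hv.box_eq_zero, hv.initial, hv.initial_deriv⟩
    refine lt_of_lt_of_le ?_ (slabEnergy_le_sqNormLE1 hv2.smooth H.time_pos.le)
    refine lt_of_lt_of_le ?_ (ENNReal.ofReal_le_ofReal
      (hlower ℓ _ h _ N _ hℓ1 hY hNdef hN H hv2))
    -- The lower bound contains T = λ^loss while the energy only contains λ^(loss - δ).
    have hT : lam ^ loss m = lam ^ (loss m - δ) * lam ^ δ := by
      rw [← Real.rpow_add hl0, sub_add_cancel]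
    have hp : 0 < lam ^ (loss m - δ) := Real.rpow_pos_of_pos hl0 _
    calc _ ≤ ENNReal.ofReal (max C 0) *
          ENNReal.ofReal (C' * (lam ^ (loss m - δ) * lam * h * N)) :=
          mul_le_mul' (ENNReal.ofReal_le_ofReal (le_max_left _ _)) (hC' ℓ _ h _ v hY H hv0 hv1)
      _ = ENNReal.ofReal (max C 0 * C' * (lam ^ (loss m - δ) * lam * h * N)) := by
          rw [← ENNReal.ofReal_mul (le_max_right _ _), mul_assoc (max C 0)]
      _ < _ := by
          have hq : max C 0 * C' < c * lam ^ δ := by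
            rw [div_lt_iff₀ hc] at hℓ
            nlinarith
          have hpos : 0 < lam ^ (loss m - δ) * lam * h * N := by positivity
          rw [ENNReal.ofReal_lt_ofReal_iff (by positivity)]
          calc _ < c * lam ^ δ * (lam ^ (loss m - δ) * lam * h * N) := by gcongr
            _ = _ := by rw [hT]; ring
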